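/- Let $F$ be an infinite field and $n\ge 1$. For a group $G$ let $H_n(G)$ be its $n$-th integral homology, computed by the bar complex, and for pairwise commuting $g_1,\dots,g_n\in G$ put $$\mathbf c(g_1,\dots,g_n)=\sum_{\sigma\in\Sigma_n}\operatorname{sign}(\sigma)\,[g_{\sigma(1)}|\cdots|g_{\sigma(n)}]\in H_n(G).$$ Let $K_n^M(F)$ be Milnor's $K$-group, i.e. the quotient of $(F^\ast)^{\otimes n}$ by the subgroup generated by all $a_1\otimes\cdots\otimes a_n$ with $a_i+a_{i+1}=1$ for some $i$; the class of $a_1\otimes\cdots\otimes a_n$ is written $\{a_1,\dots,a_n\}$. For $a_1,\dots,a_n\in F^\ast$ put $A_{1,n}=\operatorname{diag}(a_1,I_{n-1})$ and, for $2\le i\le n$, $$A_{i,n}=\operatorname{diag}(\underbrace{a_i,\dots,a_i}_{i-1},\,a_i^{-(i-1)},\,I_{n-i}),\qquad [a_1,\dots,a_n]=\mathbf c(A_{1,n},\dots,A_{n,n})\in H_n(\mathrm{GL}_n(F)).$$ Let $C_p(F^n)$ be the free abelian group on the sequences of $p$ vectors of $F^n$ any $\min(p,n)$ of which are linearly independent,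 with the alternating sum of the faces $\partial=\sum_i(-1)^id_i$ ($d_i$ omits the $i$-th vector, $i=0,1,\dots$) as differential, and let $S(F^n)=\ker(C_n(F^n)\to C_{n-1}(F^n))$. Suslin's map $s_n:H_n(\mathrm{GL}_n(F))\to K_n^M(F)$ is the composite of the edge homomorphism $H_n(\mathrm{GL}_n(F),\mathbb Z)\to H_0(\mathrm{GL}_n(F),S(F^n))$ of the exact sequence $0\to S(F^n)\to C_n(F^n)\to\cdots\to C_1(F^n)\to\mathbb Z\to 0$ (the iterated connecting homomorphism) with the homomorphism $H_0(\mathrm{GL}_n(F),S(F^n))\to K_n^M(F)$ that sends the class of $\partial(v_1,\dots,v_n,\sum_i a_iv_i)$ to $\{a_1,\dots,a_n\}$; its sign is normalized so that $s_n(\mathbf c(D_1,\dots,D_n))=\{a_1,\dots,a_n\}$ for $D_i=\operatorname{diag}(I_{i-1},a_i,I_{n-i})$. (i) There is a unique homomorphism $\nu_n:K_n^M(F)\to H_n(\mathrm{GL}_n(F))$ with $\nu_n(\{a_1,\dots,a_n\})=[a_1,\dots,a_n]$ for all $a_1,\dots,a_n\in F^\ast$. (ii) The composite $s_n\circ\nu_n:K_n^M(F)\to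 K_n^M(F)$ is multiplication by $(-1)^{n-1}(n-1)!$. -/

import Mathlib

open scoped MatrixGroups

universe u

/-! ### Milnor K-theory -/

namespace MilnorK

variable (F : Type u) [Field F] (n : ℕ)

/-- The subgroup of `(Fˣ)^{⊗ n}` generated by the pure tensors `a₁ ⊗ ⋯ ⊗ aₙ` with
`aᵢ + aᵢ₊₁ = 1` for some `i`.  This is the degree `n` part of the two-sided ideal of the tensor
algebra of the abelian group `Fˣ` generated by the elements `a ⊗ (1 - a)`, `a ≠ 0, 1`. -/
def steinberg : Submodule ℤ (PiTensorProduct ℤ fun _ : Fin n => Additive Fˣ) :=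
  Submodule.span ℤ {t | ∃ (a : Fin n → Fˣ) (i j : Fin n), (j : ℕ) = i + 1 ∧
    (a i : F) + (a j : F) = 1 ∧ t = PiTensorProduct.tprod ℤ fun l => Additive.ofMul (a l)}

end MilnorK

/-- The `n`-th Milnor `K`-group of a field `F` (written additively). -/
abbrev MilnorK (F : Type u) [Field F] (n : ℕ) : Type u :=
  (PiTensorProduct ℤ fun _ : Fin n => Additive Fˣ) ⧸ MilnorK.steinberg F n

namespace MilnorK

variable {F : Type u} [Field F] {n : ℕ}

/-- The universal symbol as a multilinear map. -/
noncomputable def symbolMap : MultilinearMap ℤ (fun _ : Fin n => Additive Fˣ) (MilnorK F n) :=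
  (steinberg F n).mkQ.compMultilinearMap (PiTensorProduct.tprod ℤ)

/-- The symbol `{a₁, …, aₙ}` in Milnor `K`-theory. -/
noncomputable def symbol (a : Fin n → Fˣ) : MilnorK F n :=
  symbolMap fun i => Additive.ofMul (a i)

theorem symbol_eq_zero_of_adjacent (a : Fin n → Fˣ) (i j : Fin n) (hij : (j : ℕ) = i + 1)
    (h : (a i : F) + (a j : F) = 1) : symbol a = 0 := by
  refine (Submodule.Quotient.mk_eq_zero _).2 (Submodule.subset_span ⟨a, i, j, hij, h, rfl⟩)

theorem symbol_update_mul (a : Fin n → Fˣ) (i : Fin n) (x y : Fˣ) :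
    symbol (Function.update a i (x * y)) =
      symbol (Function.update a i x) + symbol (Function.update a i y) := by
  have e : ∀ z : Fˣ, symbol (Function.update a i z) =
      symbolMap (F := F) (Function.update (fun l => Additive.ofMul (a l)) i (Additive.ofMul z)) := by
    intro z
    unfold symbol
    refine congrArg _ ?_
    funext l
    by_cases h : l = i
    · subst h; simp
    · simp [h]
  rw [e, e, e, ofMul_mul, MultilinearMap.map_update_add]

/-- Consequences of bimultiplicativity and the Steinberg relation for a pairing. -/
theorem pairing_relations {A : Type*} [AddCommGroup A] (φ : Fˣ → Fˣ → A)
    (h₁ : ∀ x y z, φ (x * y) z = φ x z + φ y z) (h₂ : ∀ x y z, φ x (y * z) = φ x y + φ x z)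
    (h₃ : ∀ x y : Fˣ, (x : F) + (y : F) = 1 → φ x y = 0) :
    (∀ x, φ x (-x) = 0) ∧ (∀ x y, φ x y = - φ y x) ∧
    (∀ p q d e : Fˣ, (d : F) = p - q → (e : F) = q - p → φ d q = φ p q - φ p e) := by
  have o₁ : ∀ z, φ 1 z = 0 := fun z => by simpa using h₁ 1 1 z
  have o₂ : ∀ z, φ z 1 = 0 := fun z => by simpa using h₂ z 1 1
  have i₁ : ∀ x z, φ x⁻¹ z = - φ x z := fun x z => by
    rw [eq_neg_iff_add_eq_zero, ← h₁, inv_mul_cancel, o₁]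
  have i₂ : ∀ x z, φ z x⁻¹ = - φ z x := fun x z => by
    rw [eq_neg_iff_add_eq_zero, ← h₂, inv_mul_cancel, o₂]
  have n₁ : ∀ x, φ x (-x) = 0 := by
    intro x
    by_cases hx : x = 1
    · subst hx; exact o₁ _
    · have hx' : (1 : F) - x ≠ 0 := fun h => hx (Units.ext (by simpa using (sub_eq_zero.1 h).symm))
      have hxi : (1 : F) - (x⁻¹ : Fˣ) ≠ 0 := fun h => hx (by
        have : x⁻¹ = 1 := Units.ext (by simpa using (sub_eq_zero.1 h).symm)
        simpa using this)
      have e : -x = Units.mk0 _ hx' * (Units.mk0 _ hxi)⁻¹ := by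
        rw [eq_mul_inv_iff_mul_eq]
        ext
        simp only [Units.val_mul, Units.val_neg, Units.val_mk0, Units.val_inv_eq_inv_val]
        field_simp
        ring
      have a := h₃ x (Units.mk0 _ hx') (by simp)
      have b := h₃ x⁻¹ (Units.mk0 _ hxi) (by simp)
      rw [i₁] at b
      rw [e, h₂, i₂, a, neg_eq_zero.1 b]; simp
  have sk : ∀ x y, φ x y = - φ y x := by
    intro x y
    have a := n₁ (x * y)
    have e1 : -(x * y) = (-x) * y := by simp
    have e2 : φ y (-x) = φ y (-1) + φ y x := by rw [← h₂]; simp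
    have e3 : φ y (-y) = φ y (-1) + φ y y := by rw [← h₂]; simp
    rw [e1, h₂, h₁, h₁, n₁, e2] at a
    rw [n₁] at e3
    rw [eq_neg_iff_add_eq_zero]
    calc φ x y + φ y x = 0 + (φ y (-1) + φ y x) + (φ x y + φ y y) - (φ y (-1) + φ y y) := by abel
      _ = 0 := by rw [a, ← e3]; simp
  refine ⟨n₁, sk, ?_⟩
  intro p q d e hd he
  have hde : e = d * (-1) := by ext; simp [hd, he]
  have a := h₃ (d * p⁻¹) (q * p⁻¹) (by
    simp only [Units.val_mul, hd, Units.val_inv_eq_inv_val]; field_simp; ring)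
  rw [h₁, h₂, h₂, i₁, i₁, i₂, i₂] at a
  have b : φ p p + φ p (-1) = 0 := by rw [← h₂]; simpa using n₁ p
  have c : φ p (-1) + φ p (-1) = 0 := by rw [← h₂]; simp [o₂]
  rw [hde, h₂, sk p d]
  have key : φ d q = φ p q + φ d p - φ p p := by
    rw [← sub_eq_zero, ← a]; abel
  rw [key]
  have : - φ p p = - φ p (-1) := by
    rw [eq_neg_of_add_eq_zero_left b, neg_neg, ← eq_neg_of_add_eq_zero_left c]
  rw [sub_eq_add_neg, this]; abel

theorem symbol_swap_adjacent (a : Fin n → Fˣ) (i j : Fin n) (hij : (j : ℕ) = i + 1) :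
    symbol (a ∘ Equiv.swap i j) = - symbol a := by
  have ne : i ≠ j := by rintro rfl; omega
  have := (pairing_relations (F := F)
    (fun x y => symbol (Function.update (Function.update a i x) j y))
    (by
      intro x y z
      simp only [Function.update_comm ne]
      exact symbol_update_mul _ _ _ _)
    (by intro x y z; exact symbol_update_mul _ _ _ _)
    (by
      intro x y h
      refine symbol_eq_zero_of_adjacent _ i j hij ?_
      simpa [ne] using h)).2.1 (a j) (a i)
  have e1 : Function.update (Function.update a i (a j)) j (a i) = a ∘ Equiv.swap i j := by
    funext l
    by_cases h1 : l = j
    · subst h1; simp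
    · by_cases h2 : l = i
      · subst h2; simp [ne]
      · simp [h1, h2, Equiv.swap_apply_of_ne_of_ne h2 h1]
  have e2 : Function.update (Function.update a i (a i)) j (a j) = a := by simp
  simpa only [e1, e2] using this

theorem symbol_perm (a : Fin n → Fˣ) (σ : Equiv.Perm (Fin n)) :
    symbol (a ∘ σ) = (Equiv.Perm.sign σ : ℤ) • symbol a := by
  cases n with
  | zero => 
    have : σ = 1 := Subsingleton.elim _ _
    subst this; simp
  | succ m =>
    have h : ∀ σ ∈ Submonoid.closure
        (Set.range fun i : Fin m ↦ Equiv.swap i.castSucc i.succ), ∀ a : Fin (m + 1) → Fˣ,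
        symbol (a ∘ σ) = (Equiv.Perm.sign σ : ℤ) • symbol a := by
      intro σ hσ
      induction hσ using Submonoid.closure_induction with
      | mem x hx =>
        obtain ⟨i, rfl⟩ := hx
        intro a
        rw [symbol_swap_adjacent a _ _ (by simp),
          Equiv.Perm.sign_swap (Fin.castSucc_lt_succ (i := i)).ne]
        simp
      | one => intro a; simp
      | mul x y _ _ hx hy =>
        intro a
        have : a ∘ ⇑(x * y) = (a ∘ x) ∘ y := rfl
        rw [this, hy, hx, smul_smul, Equiv.Perm.sign_mul]
        simp [mul_comm]
    refine h σ ?_ a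
    rw [Equiv.Perm.mclosure_swap_castSucc_succ]
    trivial

theorem symbol_eq_zero_of_add_eq_one (a : Fin n → Fˣ) (i j : Fin n) (hij : i ≠ j)
    (h : (a i : F) + (a j : F) = 1) : symbol a = 0 := by
  have hn : 1 < n := by
    rcases Nat.lt_or_ge 1 n with h | h
    · exact h
    · exfalso; apply hij; ext; omega
  obtain ⟨k, l, hkl, hv⟩ : ∃ k l : Fin n, k ≠ l ∧ (l : ℕ) = k + 1 :=
    ⟨⟨0, by omega⟩, ⟨1, hn⟩, by simp, rfl⟩
  let j' := Equiv.swap k i j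
  have hj' : k ≠ j' := by
    intro h
    have : Equiv.swap k i j' = j := Equiv.swap_apply_self k i j
    rw [← h, Equiv.swap_apply_left] at this
    exact hij this
  let σ : Equiv.Perm (Fin n) := Equiv.swap k i * Equiv.swap l j'
  have h1 : σ k = i := by
    simp only [σ, Equiv.Perm.mul_apply]
    rw [Equiv.swap_apply_of_ne_of_ne hkl hj']; simp
  have h2 : σ l = j := by simp [σ, j']
  have := symbol_eq_zero_of_adjacent (a ∘ σ) k l hv (by simpa [h1, h2] using h)
  rw [symbol_perm] at this
  have h3 : (Equiv.Perm.sign σ : ℤ) • (Equiv.Perm.sign σ : ℤ) • symbol a = 0 := by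
    rw [this, smul_zero]
  rcases Int.units_eq_one_or (Equiv.Perm.sign σ) with h | h <;> simpa [h] using this

/-- Left multiplication by `{x}`, as a homomorphism from degree `n` to degree `n + 1`. -/
noncomputable def leftMul (x : Fˣ) : MilnorK F n →ₗ[ℤ] MilnorK F (n + 1) :=
  (steinberg F n).liftQ
    (PiTensorProduct.lift ((symbolMap (F := F) (n := n + 1)).curryLeft (Additive.ofMul x))) <| by
    rw [steinberg, Submodule.span_le]
    rintro _ ⟨a, i, j, hij, h, rfl⟩
    rw [SetLike.mem_coe, LinearMap.mem_ker, PiTensorProduct.lift.tprod,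
      MultilinearMap.curryLeft_apply]
    have := symbol_eq_zero_of_adjacent (Fin.cons x a : Fin (n + 1) → Fˣ) i.succ j.succ
      (by simp [hij]) (by simpa using h)
    rw [← this, symbol]
    refine congrArg _ ?_
    funext l
    refine Fin.cases ?_ (fun l => ?_) l <;> simp

theorem leftMul_symbol (x : Fˣ) (a : Fin n → Fˣ) :
    leftMul x (symbol a) = symbol (Fin.cons x a : Fin (n + 1) → Fˣ) := by
  change PiTensorProduct.lift ((symbolMap (F := F) (n := n + 1)).curryLeft (Additive.ofMul x))
    (PiTensorProduct.tprod ℤ fun l => Additive.ofMul (a l)) = _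
  rw [PiTensorProduct.lift.tprod, MultilinearMap.curryLeft_apply, symbol]
  refine congrArg _ ?_
  funext l
  refine Fin.cases ?_ (fun l => ?_) l <;> simp

/-- The unit `y - x` (and `1` if `x = y`). -/
noncomputable def diff (x y : Fˣ) : Fˣ :=
  open Classical in if h : (y : F) - x ≠ 0 then Units.mk0 _ h else 1

theorem val_diff {x y : Fˣ} (h : x ≠ y) : (diff x y : F) = y - x := by
  have : (y : F) - x ≠ 0 := fun e => h (Units.ext (sub_eq_zero.1 e).symm)
  simp [diff, this]

theorem symbol_cons_mul (x y : Fˣ) (w : Fin n → Fˣ) :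
    symbol (Fin.cons (x * y) w : Fin (n + 1) → Fˣ) =
      symbol (Fin.cons x w : Fin (n + 1) → Fˣ) + symbol (Fin.cons y w : Fin (n + 1) → Fˣ) := by
  simpa using symbol_update_mul (Fin.cons x w : Fin (n + 1) → Fˣ) 0 x y

theorem symbol_cons_diff (w : Fin n → Fˣ) (i : Fin n) (p q : Fˣ) (h : p ≠ q) :
    symbol (Fin.cons (diff q p) (Function.update w i q) : Fin (n + 1) → Fˣ) =
      symbol (Fin.cons p (Function.update w i q) : Fin (n + 1) → Fˣ) -
      symbol (Fin.cons p (Function.update w i (diff p q)) : Fin (n + 1) → Fˣ) := by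
  refine (pairing_relations (F := F)
    (fun x y => symbol (Fin.cons x (Function.update w i y) : Fin (n + 1) → Fˣ))
    (fun x y z => symbol_cons_mul _ _ _) ?_ ?_).2.2 p q (diff q p) (diff p q)
    (val_diff h.symm) (val_diff h)
  · intro x y z
    simp only [Fin.cons_update]
    exact symbol_update_mul _ _ _ _
  · intro x y hxy
    exact symbol_eq_zero_of_add_eq_one _ 0 i.succ (Fin.succ_ne_zero i).symm (by simpa using hxy)

/-- The relation between symbols that corresponds to `n + 2` vectors in general position. -/
theorem symbol_mul_sub_symbol : ∀ (n : ℕ) (a c : Fin n → Fˣ), Function.Injective c →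
    symbol (a * c) - symbol a =
      ∑ i, symbol (Function.update (fun j => a j * diff (c i) (c j)) i (c i))
  | 0, a, c, _ => by
    have : a * c = a := Subsingleton.elim _ _
    simp [this]
  | n + 1, a, c, hc => by
    set a' : Fin n → Fˣ := fun j => a j.succ with ha'
    set c' : Fin n → Fˣ := fun j => c j.succ with hc'
    set d : Fin n → Fˣ := fun j => diff (c 0) (c j.succ) with hd
    have hc0 : ∀ j : Fin n, c 0 ≠ c j.succ := fun j h => (Fin.succ_ne_zero j) (hc h).symm
    have hci : Function.Injective c' := fun i j h => Fin.succ_injective _ (hc h)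
    have hdi : Function.Injective d := fun i j h => by
      apply hci
      have := congrArg (Units.val) h
      simp only [hd, val_diff (hc0 _)] at this
      exact Units.ext (sub_left_injective this)
    have hdd : ∀ i j, i ≠ j → diff (d i) (d j) = diff (c' i) (c' j) := by
      intro i j hij
      ext
      rw [val_diff (hdi.ne hij), val_diff (hci.ne hij)]
      simp only [hd, hc', val_diff (hc0 _)]
      ring
    have ih₁ := symbol_mul_sub_symbol n a' c' hci
    have ih₂ := symbol_mul_sub_symbol n a' d hdi
    have t₀ : Function.update (fun j => a j * diff (c 0) (c j)) 0 (c 0) =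
        (Fin.cons (c 0) (a' * d) : Fin (n + 1) → Fˣ) := by
      funext l
      refine Fin.cases ?_ (fun l => ?_) l <;> simp [ha', hd]
    have t : ∀ i : Fin n, symbol (Function.update
          (fun j => a j * diff (c i.succ) (c j)) i.succ (c i.succ)) =
        leftMul (a 0 * c 0) (symbol (Function.update
          (fun j => a' j * diff (c' i) (c' j)) i (c' i))) -
        leftMul (c 0) (symbol (Function.update (fun j => a' j * diff (d i) (d j)) i (d i))) := by
      intro i
      have e1 : Function.update (fun j => a j * diff (c i.succ) (c j)) i.succ (c i.succ) =
          (Fin.cons (a 0 * diff (c i.succ) (c 0)) (Function.update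
            (fun j => a' j * diff (c' i) (c' j)) i (c' i)) : Fin (n + 1) → Fˣ) := by
        rw [Fin.cons_update]
        congr 1
        funext l
        refine Fin.cases ?_ (fun l => ?_) l <;> simp [ha', hc']
      have e2 : Function.update (fun j => a' j * diff (d i) (d j)) i (d i) =
          Function.update (fun j => a' j * diff (c' i) (c' j)) i (d i) := by
        funext l
        by_cases h : l = i
        · subst h; simp
        · simp [h, hdd i l (Ne.symm h)]
      rw [e1, e2, leftMul_symbol, leftMul_symbol, symbol_cons_mul, symbol_cons_mul]
      have := symbol_cons_diff (fun j => a' j * diff (c' i) (c' j)) i (c 0) (c' i) (hc0 i)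
      simp only [hc', hd] at this ⊢
      rw [this]; abel
    rw [Fin.sum_univ_succ, t₀, Finset.sum_congr rfl (fun i _ => t i), Finset.sum_sub_distrib,
      ← map_sum, ← map_sum, ← ih₁, ← ih₂, map_sub, map_sub]
    simp only [leftMul_symbol]
    have f1 : (Fin.cons (a 0 * c 0) (a' * c') : Fin (n + 1) → Fˣ) = a * c := by
      funext l
      refine Fin.cases ?_ (fun l => ?_) l <;> simp [ha', hc']
    have f2 : symbol a = symbol (Fin.cons (a 0) a' : Fin (n + 1) → Fˣ) := by
      congr 1
      funext l
      refine Fin.cases ?_ (fun l => ?_) l <;> simp [ha']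
    rw [f1, symbol_cons_mul (a 0) (c 0) a', ← f2]
    abel

end MilnorK

/-! ### Integral homology of groups and the classes `c(g₁, …, gₙ)` -/

/-- The ring `ℤ`, lifted to the universe `u`. -/
def LiftedInt : Type u := ULift.{u} ℤ

instance : CommRing LiftedInt.{u} := inferInstanceAs (CommRing (ULift.{u} ℤ))

/-- The isomorphism of rings between the lifted copy of `ℤ` and `ℤ`. -/
def LiftedInt.equiv : LiftedInt.{u} ≃+* ℤ := ULift.ringEquiv

instance (F : Type u) [Field F] (n : ℕ) : Module LiftedInt.{u} (MilnorK F n) :=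
  Module.compHom _ LiftedInt.equiv.{u}.toRingHom

/-- The `n`-th integral homology of a group `G`, computed by the bar complex.  The ring `ℤ` is
lifted to the universe of `G`; this has no effect on the homology groups. -/
noncomputable abbrev integralHomology (G : Type u) [Group G] (n : ℕ) :=
  groupHomology (Rep.trivial LiftedInt.{u} G LiftedInt.{u}) n

namespace BarClass

variable {G : Type u} [Group G] {n : ℕ}

/-- The bar chain `∑_σ sign(σ) [g_{σ(1)} | ⋯ | g_{σ(n)}]`. -/
noncomputable def chain (g : Fin n → G) : (Fin n → G) →₀ LiftedInt.{u} :=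
  ∑ σ : Equiv.Perm (Fin n), Finsupp.single (g ∘ σ) ((Equiv.Perm.sign σ : ℤ) : LiftedInt.{u})

theorem contractNth_swap (j : Fin n) (h : Fin (n + 1) → G)
    (hc : Commute (h j.castSucc) (h j.succ)) :
    Fin.contractNth j.castSucc (· * ·) (h ∘ Equiv.swap j.castSucc j.succ) =
      Fin.contractNth j.castSucc (· * ·) h := by
  funext k
  rcases lt_trichotomy (k : ℕ) j with hk | hk | hk
  · rw [Fin.contractNth_apply_of_lt _ _ _ _ (by simpa using hk),
      Fin.contractNth_apply_of_lt _ _ _ _ (by simpa using hk), Function.comp_apply,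
      Equiv.swap_apply_of_ne_of_ne]
    · intro e; simp [Fin.ext_iff] at e; omega
    · intro e; simp [Fin.ext_iff] at e; omega
  · obtain rfl : k = j := Fin.ext hk
    rw [Fin.contractNth_apply_of_eq _ _ _ _ (by simp),
      Fin.contractNth_apply_of_eq _ _ _ _ (by simp)]
    simpa using hc.symm.eq
  · rw [Fin.contractNth_apply_of_gt _ _ _ _ (by simpa using hk),
      Fin.contractNth_apply_of_gt _ _ _ _ (by simpa using hk), Function.comp_apply,
      Equiv.swap_apply_of_ne_of_ne]
    · intro e; simp [Fin.ext_iff] at e; omega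
    · intro e; simp [Fin.ext_iff] at e; omega

theorem d_chain (g : Fin (n + 1) → G) (hg : ∀ i j, Commute (g i) (g j)) :
    groupHomology.inhomogeneousChains.d
      (Rep.trivial LiftedInt.{u} G LiftedInt.{u}) n (chain g) = 0 := by
  rw [chain, map_sum]
  have e : ∀ σ : Equiv.Perm (Fin (n + 1)), groupHomology.inhomogeneousChains.d
      (Rep.trivial LiftedInt.{u} G LiftedInt.{u}) n
      (Finsupp.single (g ∘ σ) ((Equiv.Perm.sign σ : ℤ) : LiftedInt.{u})) =
      (Finsupp.single (fun i => g (σ i.succ)) ((Equiv.Perm.sign σ : ℤ) : LiftedInt.{u}) +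
        (-1 : LiftedInt.{u}) ^ (n + 1) •
          Finsupp.single (fun i => g (σ i.castSucc)) ((Equiv.Perm.sign σ : ℤ) : LiftedInt.{u})) +
      ∑ j : Fin n, (-1 : LiftedInt.{u}) ^ ((j : ℕ) + 1) •
        Finsupp.single (Fin.contractNth j.castSucc (· * ·) (g ∘ σ))
          ((Equiv.Perm.sign σ : ℤ) : LiftedInt.{u}) := by
    intro σ
    rw [groupHomology.inhomogeneousChains.d_single, Fin.sum_univ_castSucc]
    have : Fin.contractNth (Fin.last n) (· * ·) (g ∘ σ) = fun i => g (σ i.castSucc) := by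
      funext k
      rw [Fin.contractNth_apply_of_lt _ _ _ _ (by simp)]
      rfl
    rw [this, add_assoc, add_comm (Finset.sum _ _)]
    rfl
  rw [Finset.sum_congr rfl (fun σ _ => e σ), Finset.sum_add_distrib, Finset.sum_comm]
  have z : ∀ j : Fin n, ∑ σ : Equiv.Perm (Fin (n + 1)), (-1 : LiftedInt.{u}) ^ ((j : ℕ) + 1) •
        Finsupp.single (Fin.contractNth j.castSucc (· * ·) (g ∘ σ))
          ((Equiv.Perm.sign σ : ℤ) : LiftedInt.{u}) = 0 := by
    intro j
    rw [← Finset.smul_sum]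
    have ne : j.castSucc ≠ j.succ := (Fin.castSucc_lt_succ (i := j)).ne
    rw [Finset.sum_involution (fun σ _ => σ * Equiv.swap j.castSucc j.succ), smul_zero]
    · intro σ _
      have : g ∘ ⇑(σ * Equiv.swap j.castSucc j.succ) =
        (g ∘ σ) ∘ Equiv.swap j.castSucc j.succ := rfl
      rw [this, contractNth_swap j (g ∘ σ) (hg _ _), ← Finsupp.single_add]
      simp [Equiv.Perm.sign_swap ne]
    · intro σ _ _ h
      have := mul_eq_left.1 h
      exact ne (Equiv.swap_eq_one_iff.1 this)
    · intro σ _; exact Finset.mem_univ _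
    · intro σ _; simp [mul_assoc]
  rw [Finset.sum_eq_zero (fun j _ => z j), add_zero, Finset.sum_add_distrib,
    ← Finset.smul_sum]
  have r : ∑ σ : Equiv.Perm (Fin (n + 1)),
      Finsupp.single (fun i : Fin n => g (σ i.castSucc))
        ((Equiv.Perm.sign σ : ℤ) : LiftedInt.{u}) =
      (-1 : LiftedInt.{u}) ^ n • ∑ σ : Equiv.Perm (Fin (n + 1)),
        Finsupp.single (fun i : Fin n => g (σ i.succ))
          ((Equiv.Perm.sign σ : ℤ) : LiftedInt.{u}) := by
    rw [← Equiv.sum_comp (Equiv.mulRight (finRotate (n + 1))), Finset.smul_sum]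
    refine Finset.sum_congr rfl fun σ _ => ?_
    simp [sign_finRotate, mul_comm]
  rw [r, smul_smul, pow_succ, mul_assoc, mul_comm (-1 : LiftedInt.{u}), ← mul_assoc, ← pow_add,
    Even.neg_one_pow ⟨n, rfl⟩]
  simp

theorem d_chain_next (g : Fin n → G) (hg : ∀ i j, Commute (g i) (g j)) :
    (groupHomology.inhomogeneousChains (Rep.trivial LiftedInt.{u} G LiftedInt.{u})).d n
      ((ComplexShape.down ℕ).next n) (chain g) = 0 := by
  cases n with
  | zero =>
    rw [HomologicalComplex.shape _ _ _ (by simp)]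
    rfl
  | succ m =>
    have : (ComplexShape.down ℕ).next (m + 1) = m := by simp
    rw [this, groupHomology.inhomogeneousChains.d_def]
    exact d_chain g hg

end BarClass

/-- The class `c(g₁, …, gₙ) = ∑_σ sign(σ) [g_{σ(1)} | ⋯ | g_{σ(n)}]` in `Hₙ(G)` attached to
pairwise commuting elements `g₁, …, gₙ` of `G`. -/
noncomputable def barClass {G : Type u} [Group G] {n : ℕ} (g : Fin n → G)
    (hg : ∀ i j, Commute (g i) (g j)) : integralHomology G n :=
  groupHomology.π _ n
    (groupHomology.cyclesMk n _ rfl (BarClass.chain g) (BarClass.d_chain_next g hg))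

/-! ### The complex of vectors in general position -/

/-- A finite sequence of vectors of `Fⁿ` is in general position if any `min(p, n)` of them
(equivalently, any at most `n` of them) are linearly independent. -/
def InGeneralPosition {F : Type u} [Field F] {n p : ℕ} (v : Fin p → Fin n → F) : Prop :=
  ∀ s : Finset (Fin p), s.card ≤ n → LinearIndepOn F v (s : Set (Fin p))

/-- Sequences of `p` vectors in general position in `Fⁿ`. -/
abbrev GenTuple (F : Type u) [Field F] (n p : ℕ) : Type u :=
  {v : Fin p → Fin n → F // InGeneralPosition v}

/-- `C_p(Fⁿ)`, the free abelian group on sequences of `p` vectors in general position. -/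
abbrev GenChain (F : Type u) [Field F] (n p : ℕ) : Type u :=
  GenTuple F n p →₀ LiftedInt.{u}

namespace GenChain

variable {F : Type u} [Field F] {n p : ℕ}

theorem inGeneralPosition_comp {q : ℕ} {v : Fin p → Fin n → F} (hv : InGeneralPosition v)
    (e : Fin q → Fin p) (he : Function.Injective e) : InGeneralPosition (v ∘ e) := by
  intro s hs
  have := hv (s.map ⟨e, he⟩) (by simpa using hs)
  refine LinearIndependent.comp this (fun i : (s : Set (Fin q)) =>
    ⟨e i, Finset.mem_coe.2 (Finset.mem_map_of_mem ⟨e, he⟩ i.2)⟩) ?_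
  intro i j h
  simp only [Subtype.mk.injEq] at h
  exact Subtype.ext (he h)

/-- Omit the `i`-th vector. -/
def face (v : GenTuple F n (p + 1)) (i : Fin (p + 1)) : GenTuple F n p :=
  ⟨v.1 ∘ i.succAbove, inGeneralPosition_comp v.2 _ Fin.succAbove_right_injective⟩

/-- The differential `C_{p+1}(Fⁿ) → C_p(Fⁿ)`, the alternating sum of the faces. -/
noncomputable def bd (F : Type u) [Field F] (n p : ℕ) :
    GenChain F n (p + 1) →ₗ[LiftedInt.{u}] GenChain F n p :=
  Finsupp.linearCombination LiftedInt.{u} fun v =>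
    ∑ i : Fin (p + 1), (-1 : LiftedInt.{u}) ^ (i : ℕ) • Finsupp.single (face v i) 1

theorem bd_single (v : GenTuple F n (p + 1)) :
    bd F n p (Finsupp.single v 1) =
      ∑ i : Fin (p + 1), (-1 : LiftedInt.{u}) ^ (i : ℕ) • Finsupp.single (face v i) 1 := by
  simp [bd]

theorem hom_ext {M : Type*} [AddCommGroup M] [Module LiftedInt.{u} M]
    {f g : GenChain F n p →ₗ[LiftedInt.{u}] M}
    (h : ∀ v, f (Finsupp.single v 1) = g (Finsupp.single v 1)) : f = g := by
  refine Finsupp.lhom_ext' fun v => LinearMap.ext_ring ?_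
  exact h v

open Classical in
/-- The cone with vertex `w` (and `0` on sequences for which the cone is not in general
position). -/
noncomputable def cone (w : Fin n → F) (p : ℕ) :
    GenChain F n p →ₗ[LiftedInt.{u}] GenChain F n (p + 1) :=
  Finsupp.linearCombination LiftedInt.{u} fun v =>
    if h : InGeneralPosition (Fin.cons w v.1 : Fin (p + 1) → Fin n → F) then
      Finsupp.single ⟨_, h⟩ 1 else 0

theorem cone_single {w : Fin n → F} {v : GenTuple F n p}
    (h : InGeneralPosition (Fin.cons w v.1 : Fin (p + 1) → Fin n → F)) :
    cone w p (Finsupp.single v 1) = Finsupp.single ⟨_, h⟩ 1 := by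
  simp [cone, h]

theorem inGeneralPosition_cons_face {w : Fin n → F} {v : GenTuple F n (p + 1)}
    (h : InGeneralPosition (Fin.cons w v.1 : Fin (p + 2) → Fin n → F)) (i : Fin (p + 1)) :
    InGeneralPosition (Fin.cons w (face v i).1 : Fin (p + 1) → Fin n → F) := by
  have := inGeneralPosition_comp h i.succ.succAbove Fin.succAbove_right_injective
  convert this using 1
  funext j
  refine Fin.cases ?_ (fun j => ?_) j <;> simp [face]

theorem bd_cone_succ {w : Fin n → F} {v : GenTuple F n (p + 1)}
    (h : InGeneralPosition (Fin.cons w v.1 : Fin (p + 2) → Fin n → F)) :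
    bd F n (p + 1) (cone w (p + 1) (Finsupp.single v 1)) =
      Finsupp.single v 1 - cone w p (bd F n p (Finsupp.single v 1)) := by
  rw [cone_single h, bd_single, bd_single, Fin.sum_univ_succ, map_sum, sub_eq_add_neg,
    ← Finset.sum_neg_distrib]
  congr 1
  · simp only [Fin.val_zero, pow_zero, one_smul]
    rfl
  · refine Finset.sum_congr rfl fun i _ => ?_
    rw [map_smul, cone_single (inGeneralPosition_cons_face h i), ← neg_smul]
    congr 1
    · simp [pow_succ]
    · congr 1
      apply Subtype.ext
      funext j
      refine Fin.cases ?_ (fun j => ?_) j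
      · simp [face]
      · simp [face, Fin.removeNth]

theorem bd_cone_zero {w : Fin n → F} {v : GenTuple F n 0}
    (h : InGeneralPosition (Fin.cons w v.1 : Fin 1 → Fin n → F)) :
    bd F n 0 (cone w 0 (Finsupp.single v 1)) = Finsupp.single v 1 := by
  rw [cone_single h, bd_single]
  rw [Fin.sum_univ_succ, Fin.sum_univ_zero, add_zero]
  simp only [Fin.val_zero, pow_zero, one_smul]
  congr 1

theorem exists_eq_cons (v : GenTuple F n (p + 1)) :
    ∃ (w : Fin n → F) (v' : GenTuple F n p)
      (h : InGeneralPosition (Fin.cons w v'.1 : Fin (p + 1) → Fin n → F)), v = ⟨_, h⟩ := by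
  have e : (Fin.cons (v.1 0) (face v 0).1 : Fin (p + 1) → Fin n → F) = v.1 := by
    funext j
    refine Fin.cases ?_ (fun j => ?_) j <;> simp [face]
  exact ⟨v.1 0, face v 0, by rw [e]; exact v.2, Subtype.ext e.symm⟩

theorem bd_comp_bd : ∀ p, bd F n p ∘ₗ bd F n (p + 1) = 0 := by
  intro p
  induction p with
  | zero =>
    refine hom_ext fun v => ?_
    rw [LinearMap.comp_apply, bd_single, Fin.sum_univ_two, map_add, map_smul, map_smul,
      bd_single, bd_single]
    have : ∀ x y : GenTuple F n 0, x = y := fun x y => Subtype.ext (Subsingleton.elim _ _)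
    rw [Fin.sum_univ_one, Fin.sum_univ_one, this (face (face v 0) 0) (face (face v 1) 0)]
    simp
  | succ p ih =>
    refine hom_ext fun v => ?_
    obtain ⟨w, v', h, rfl⟩ := exists_eq_cons v
    rw [LinearMap.comp_apply, ← cone_single h, bd_cone_succ h, map_sub]
    have key : bd F n (p + 1) (cone w (p + 1) (bd F n (p + 1) (Finsupp.single v' 1))) =
        bd F n (p + 1) (Finsupp.single v' 1) := by
      rw [bd_single, map_sum, map_sum]
      simp only [map_smul]
      rw [Finset.sum_congr rfl fun i _ => by
        rw [bd_cone_succ (inGeneralPosition_cons_face h i), smul_sub]]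
      rw [Finset.sum_sub_distrib, sub_eq_self]
      simp only [← map_smul]
      rw [← map_sum, ← map_sum, ← bd_single]
      have := LinearMap.congr_fun ih (Finsupp.single v' 1)
      rw [LinearMap.comp_apply] at this
      rw [this]; simp
    rw [key, sub_self]; rfl

theorem inGeneralPosition_cons {w : Fin n → F} {v : Fin p → Fin n → F}
    (hv : InGeneralPosition v)
    (hw : ∀ s : Finset (Fin p), s.card < n → w ∉ Submodule.span F (v '' (s : Set (Fin p)))) :
    InGeneralPosition (Fin.cons w v : Fin (p + 1) → Fin n → F) := by
  classical
  intro t ht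
  set s : Finset (Fin p) := Finset.univ.filter fun i => i.succ ∈ t with hs
  have im : ((Fin.cons w v : Fin (p + 1) → Fin n → F) '' (Fin.succ '' (s : Set (Fin p)))) =
      v '' (s : Set (Fin p)) := by
    rw [← Set.image_comp]; rfl
  have ind : s.card ≤ n → LinearIndepOn F (Fin.cons w v : Fin (p + 1) → Fin n → F)
      (Fin.succ '' (s : Set (Fin p))) := by
    intro hc
    exact LinearIndepOn.image_of_comp Fin.succ _ (hv s hc)
  by_cases h0 : (0 : Fin (p + 1)) ∈ t
  · have ht' : (t : Set (Fin (p + 1))) = insert 0 (Fin.succ '' (s : Set (Fin p))) := by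
      ext j
      refine Fin.cases ?_ (fun j => ?_) j
      · simpa using h0
      · simp [hs, Fin.succ_ne_zero]
    have hc : t.card = s.card + 1 := by
      have : t = insert 0 (s.map (Fin.succEmb p)) := by
        apply Finset.coe_injective
        rw [ht']; simp
      rw [this, Finset.card_insert_of_notMem (by simp), Finset.card_map]
    rw [ht', linearIndepOn_insert (by simp)]
    refine ⟨ind (by omega), ?_⟩
    rw [im]
    exact hw s (by omega)
  · have ht' : (t : Set (Fin (p + 1))) = Fin.succ '' (s : Set (Fin p)) := by
      ext j
      refine Fin.cases ?_ (fun j => ?_) j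
      · simpa using h0
      · simp [hs]
    have hc : t.card = s.card := by
      have : t = s.map (Fin.succEmb p) := by
        apply Finset.coe_injective
        rw [ht']; simp
      rw [this, Finset.card_map]
    rw [ht']
    exact ind (by omega)

theorem exists_cone [Infinite F] (T : Finset (GenTuple F n p)) :
    ∃ w : Fin n → F, ∀ v ∈ T,
      InGeneralPosition (Fin.cons w v.1 : Fin (p + 1) → Fin n → F) := by
  classical
  let S : Finset (Subspace F (Fin n → F)) := T.biUnion fun v =>
    (Finset.univ.filter fun s : Finset (Fin p) => s.card < n).image fun s : Finset (Fin p) =>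
      Submodule.span F (v.1 '' (s : Set (Fin p)))
  have hS : ⊤ ∉ S := by
    intro h
    simp only [S, Finset.mem_biUnion, Finset.mem_image, Finset.mem_filter, Finset.mem_univ,
      true_and] at h
    obtain ⟨v, -, s, hs, e⟩ := h
    have h1 := finrank_span_finset_le_card (R := F) (s.image v.1)
    rw [Finset.coe_image, Set.finrank, e, finrank_top] at h1
    have h2 : (s.image v.1).card ≤ s.card := Finset.card_image_le
    simp at h1
    omega
  obtain ⟨w, hw⟩ := (Set.ne_univ_iff_exists_notMem _).1
    (Subspace.biUnion_ne_univ_of_top_notMem hS)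
  refine ⟨w, fun v hv => inGeneralPosition_cons v.2 fun s hs hmem => hw ?_⟩
  simp only [Set.mem_iUnion]
  refine ⟨_, ?_, hmem⟩
  simp only [S, Finset.mem_biUnion, Finset.mem_image, Finset.mem_filter, Finset.mem_univ,
      true_and]
  exact ⟨v, hv, s, hs, rfl⟩

/-- The cycles in `C_p(Fⁿ)`, where `C₋₁ = 0`. -/
noncomputable def cyc (F : Type u) [Field F] (n : ℕ) :
    (p : ℕ) → Submodule LiftedInt.{u} (GenChain F n p)
  | 0 => ⊤
  | p + 1 => LinearMap.ker (bd F n p)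

theorem bd_mem_cyc : ∀ (p : ℕ) (y : GenChain F n (p + 1)), bd F n p y ∈ cyc F n p
  | 0, _ => trivial
  | p + 1, y => LinearMap.congr_fun (bd_comp_bd p) y

theorem exists_bd_eq [Infinite F] : ∀ (p : ℕ) (z : GenChain F n p), z ∈ cyc F n p →
    ∃ y, bd F n p y = z := by
  intro p z hz
  obtain ⟨w, hw⟩ := exists_cone z.support
  refine ⟨cone w p z, ?_⟩
  have hsum : z = ∑ v ∈ z.support, z v • Finsupp.single v 1 := by
    conv_lhs => rw [← Finsupp.sum_single z]
    simp [Finsupp.sum]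
  cases p with
  | zero =>
    conv_lhs => rw [hsum, map_sum, map_sum]
    conv_rhs => rw [hsum]
    refine Finset.sum_congr rfl fun v hv => ?_
    rw [map_smul, map_smul, bd_cone_zero (hw v hv)]
  | succ p =>
    have : bd F n (p + 1) (cone w (p + 1) z) = z - cone w p (bd F n p z) := by
      conv_lhs => rw [hsum, map_sum, map_sum]
      conv_rhs => rw [hsum, map_sum, map_sum]
      rw [← Finset.sum_sub_distrib]
      refine Finset.sum_congr rfl fun v hv => ?_
      rw [map_smul, map_smul, bd_cone_succ (hw v hv), map_smul, map_smul, smul_sub]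
    rw [this, LinearMap.mem_ker.1 hz]; simp

end GenChain

/-! ### Symbols of vectors in general position -/

namespace GenChain

variable {F : Type u} [Field F] {n p : ℕ}

theorem linearIndependent_castSucc (v : GenTuple F n (n + 1)) :
    LinearIndependent F fun i : Fin n => v.1 i.castSucc := by
  have h := inGeneralPosition_comp v.2 _ (Fin.castSucc_injective n) Finset.univ (by simp)
  rw [Finset.coe_univ, linearIndepOn_univ_iff] at h
  exact h

theorem exists_coords (v : GenTuple F n (n + 1)) :
    ∃ a : Fin n → Fˣ, v.1 (Fin.last n) = ∑ i, (a i : F) • v.1 i.castSucc := by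
  have hsp := (linearIndependent_castSucc v).span_eq_top_of_card_eq_finrank' (by simp)
  have hm : v.1 (Fin.last n) ∈ Submodule.span F (Set.range fun i : Fin n => v.1 i.castSucc) := by
    rw [hsp]; trivial
  obtain ⟨c, hc⟩ := (Submodule.mem_span_range_iff_exists_fun F).1 hm
  have hne : ∀ i, c i ≠ 0 := by
    intro i hi
    have h := v.2 (Finset.univ.erase i.castSucc) (by simp)
    rw [linearIndepOn_finset_iff] at h
    have := h (Fin.snoc c (-1) : Fin (n + 1) → F) (by
      rw [Finset.sum_erase _ (by simp [hi]), Fin.sum_univ_castSucc]; simp [hc]) (Fin.last n)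
      (by simp [(Fin.castSucc_lt_last i).ne'])
    simp at this
  exact ⟨fun i => Units.mk0 _ (hne i), hc.symm⟩

/-- The coordinates of the last vector in the basis formed by the first `n` vectors; they are all
nonzero. -/
noncomputable def coords (v : GenTuple F n (n + 1)) : Fin n → Fˣ :=
  (exists_coords v).choose

theorem coords_spec (v : GenTuple F n (n + 1)) :
    v.1 (Fin.last n) = ∑ i, (coords v i : F) • v.1 i.castSucc :=
  (exists_coords v).choose_spec

theorem coords_eq (v : GenTuple F n (n + 1)) (a : Fin n → Fˣ)
    (h : v.1 (Fin.last n) = ∑ i, (a i : F) • v.1 i.castSucc) : coords v = a := by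
  have := Fintype.linearIndependent_iff.1 (linearIndependent_castSucc v)
    (fun i => (coords v i : F) - a i) (by
      simp only [sub_smul, Finset.sum_sub_distrib]
      rw [← h, ← coords_spec, sub_self])
  funext i
  exact Units.ext (sub_eq_zero.1 (this i))

/-- The homomorphism `C_{n+1}(Fⁿ) → K_n^M(F)` which sends `(v₁, …, vₙ, ∑ aᵢ vᵢ)` to
`{a₁, …, aₙ}`. -/
noncomputable def symb (F : Type u) [Field F] (n : ℕ) :
    GenChain F n (n + 1) →ₗ[LiftedInt.{u}] MilnorK F n :=
  Finsupp.linearCombination LiftedInt.{u} fun v => MilnorK.symbol (coords v)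

theorem symb_single (v : GenTuple F n (n + 1)) :
    symb F n (Finsupp.single v 1) = MilnorK.symbol (coords v) := by
  simp [symb]

theorem face_apply_cycle {m : ℕ} (v : GenTuple F (m + 1) (m + 3)) (i j : Fin (m + 1)) :
    (face v i.castSucc.castSucc).1 j.castSucc =
      Function.update (fun l : Fin (m + 1) => v.1 l.castSucc.castSucc) i
        (v.1 (Fin.last (m + 1)).castSucc) (Fin.cycleIcc i (Fin.last m) j) := by
  change v.1 (i.castSucc.castSucc.succAbove j.castSucc) = _
  rcases lt_or_ge j i with hj | hj
  · rw [Fin.cycleIcc_of_lt hj, Function.update_of_ne hj.ne,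
      Fin.succAbove_of_castSucc_lt _ _ (by simpa using hj)]
  · rw [Fin.succAbove_of_le_castSucc _ _ (by simpa using hj),
      Fin.cycleIcc_of_le_of_le hj (Fin.le_last j)]
    split_ifs with h
    · subst h; simp
      rfl
    · have hlt : (j : ℕ) < m := by
        exact Fin.val_lt_last h
      have e : ((j + 1 : Fin (m + 1)) : ℕ) = j + 1 := Fin.val_add_one_of_lt (Fin.lt_last_iff_ne_last.2 h)
      have hne : j + 1 ≠ i := by
        intro h'
        rw [← h'] at hj
        have : ((j + 1 : Fin (m + 1)) : ℕ) ≤ j := hj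
        omega
      rw [Function.update_of_ne hne]
      refine congrArg v.1 (Fin.ext ?_)
      simp only [Fin.val_succ, Fin.val_castSucc, e]

theorem coords_faces (v : GenTuple F n (n + 2)) :
    ∃ a c : Fin n → Fˣ, Function.Injective c ∧
      coords (face v (Fin.last (n + 1))) = a ∧
      coords (face v (Fin.last n).castSucc) = a * c ∧
      ∀ i : Fin n, MilnorK.symbol (coords (face v i.castSucc.castSucc)) =
        (-1 : ℤ) ^ (n - 1 - (i : ℕ)) • MilnorK.symbol
          (Function.update (fun j => a j * MilnorK.diff (c i) (c j)) i (c i)) := by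
  set e : Fin n → Fin n → F := fun i => v.1 i.castSucc.castSucc with he
  set x := v.1 (Fin.last n).castSucc with hx
  set y := v.1 (Fin.last (n + 1)) with hy
  set a := coords (face v (Fin.last (n + 1))) with ha
  set b := coords (face v (Fin.last n).castSucc) with hb
  have h0 : ∀ i : Fin (n + 1), (face v (Fin.last (n + 1))).1 i = v.1 i.castSucc := by
    intro i
    change v.1 ((Fin.last (n + 1)).succAbove i) = _
    rw [Fin.succAbove_last]
  have hxe : x = ∑ i, (a i : F) • e i := by
    have := coords_spec (face v (Fin.last (n + 1)))
    simpa only [h0] using this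
  have hye : y = ∑ i, (b i : F) • e i := by
    have := coords_spec (face v (Fin.last n).castSucc)
    have h1 : ∀ i : Fin n, (face v (Fin.last n).castSucc).1 i.castSucc = e i := by
      intro i
      change v.1 ((Fin.last n).castSucc.succAbove i.castSucc) = _
      rw [Fin.succAbove_of_castSucc_lt _ _ (by simp [Fin.lt_def])]
    have h2 : (face v (Fin.last n).castSucc).1 (Fin.last n) = y := by
      change v.1 ((Fin.last n).castSucc.succAbove (Fin.last n)) = _
      rw [Fin.succAbove_of_le_castSucc _ _ (by simp)]
      rfl
    rw [h2] at this
    simpa only [h1] using this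
  have hli : LinearIndependent F e := by
    have := linearIndependent_castSucc (face v (Fin.last (n + 1)))
    simpa only [h0] using this
  have main : ∀ i : Fin n, ∃ β : Fin n → Fˣ,
      (b i : F) = β i * a i ∧ (∀ j, j ≠ i → (b j : F) = β j + β i * a j) ∧
      MilnorK.symbol (coords (face v i.castSucc.castSucc)) =
        (-1 : ℤ) ^ (n - 1 - (i : ℕ)) • MilnorK.symbol β := by
    intro i
    obtain ⟨m, rfl⟩ : ∃ m, n = m + 1 := ⟨n - 1, by have := i.2; omega⟩
    set σ := Fin.cycleIcc i (Fin.last m) with hσ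
    set α := coords (face v i.castSucc.castSucc) with hα
    have hs := coords_spec (face v i.castSucc.castSucc)
    have hlast : (face v i.castSucc.castSucc).1 (Fin.last (m + 1)) = y := by
      change v.1 (i.castSucc.castSucc.succAbove (Fin.last (m + 1))) = _
      rw [Fin.succAbove_of_le_castSucc _ _ (by simp [Fin.le_def])]
      rfl
    rw [hlast] at hs
    simp only [face_apply_cycle] at hs
    set β : Fin (m + 1) → Fˣ := α ∘ σ.symm with hβ
    have hαβ : α = β ∘ σ := by funext j; simp [hβ]
    have hs' : y = ∑ j, (β j : F) • Function.update e i x j := by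
      rw [← Equiv.sum_comp σ, hs]
      refine Finset.sum_congr rfl fun j _ => ?_
      simp [hβ, hα, hσ, he, hx]
    have hs'' : y = ∑ j, ((if j = i then 0 else (β j : F)) + β i * a j) • e j := by
      rw [hs', ← Finset.add_sum_erase _ _ (Finset.mem_univ i)]
      simp only [add_smul, Finset.sum_add_distrib, mul_smul, ← Finset.smul_sum]
      have r : ∑ j, (if j = i then 0 else (β j : F)) • e j =
          ∑ j ∈ Finset.univ.erase i, (if j = i then 0 else (β j : F)) • e j :=
        (Finset.sum_erase _ (by simp)).symm
      rw [← hxe, r, Function.update_self, add_comm ((β i : F) • x)]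
      congr 1
      refine Finset.sum_congr rfl fun j hj => ?_
      have := Finset.ne_of_mem_erase hj
      simp [this]
    have hc := fun j => sub_eq_zero.1 (Fintype.linearIndependent_iff.1 hli
      (fun j => (b j : F) - ((if j = i then 0 else (β j : F)) + β i * a j)) (by
        simp only [sub_smul, Finset.sum_sub_distrib]
        rw [← hye, ← hs'', sub_self]) j)
    refine ⟨β, by simpa using hc i, fun j hj => by simpa [hj] using hc j, ?_⟩
    rw [hαβ, MilnorK.symbol_perm, hσ, Fin.sign_cycleIcc_of_le (Fin.le_last i)]
    simp
  set c : Fin n → Fˣ := fun i => b i * (a i)⁻¹ with hc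
  have hcv : ∀ i, (b i : F) = c i * a i := fun i => by simp [hc]
  have hβi : ∀ (i : Fin n) (t : Fˣ), (b i : F) = t * a i → t = c i := by
    intro i t h
    have : b i = t * a i := Units.ext (by simpa using h)
    simp [hc, this]
  refine ⟨a, c, ?_, rfl, by funext i; simp [hc], ?_⟩
  · intro j i hij
    by_contra hne
    obtain ⟨β, h1, h2, -⟩ := main i
    have h3 := h2 j hne
    rw [hβi i _ h1, hcv j, hij] at h3
    simp at h3
  · intro i
    obtain ⟨β, h1, h2, h3⟩ := main i
    rw [h3]
    congr 2
    funext j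
    by_cases hj : j = i
    · subst hj; simpa using hβi j _ h1
    · have h4 := h2 j hj
      rw [hβi i _ h1, hcv j] at h4
      have hne : c i ≠ c j := by
        intro h
        rw [h] at h4
        simp at h4
      rw [Function.update_of_ne hj]
      ext
      rw [Units.val_mul, MilnorK.val_diff hne, mul_sub, mul_comm (a j : F) (c j : F), h4]
      ring

theorem symb_bd (y : GenChain F n (n + 2)) : symb F n (bd F n (n + 1) y) = 0 := by
  suffices h : symb F n ∘ₗ bd F n (n + 1) = 0 from LinearMap.congr_fun h y
  refine hom_ext fun v => ?_
  obtain ⟨a, c, hc, h1, h2, h3⟩ := coords_faces v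
  have key := MilnorK.symbol_mul_sub_symbol n a c hc
  have u : ∀ (k : ℕ) (t : MilnorK F n), ((-1 : LiftedInt.{u}) ^ k) • t = (-1 : ℤ) ^ k • t := by
    intro k t
    rcases neg_one_pow_eq_or LiftedInt.{u} k with h | h <;>
    rcases Nat.even_or_odd k with h' | h' <;> simp [h'.neg_one_pow]
  rw [LinearMap.comp_apply, bd_single, map_sum, LinearMap.zero_apply]
  simp only [map_smul, symb_single, u]
  rw [Fin.sum_univ_castSucc, Fin.sum_univ_castSucc, h1, h2]
  have t : ∀ i : Fin n, (-1 : ℤ) ^ (i.castSucc.castSucc : ℕ) •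
      MilnorK.symbol (coords (face v i.castSucc.castSucc)) =
      - ((-1 : ℤ) ^ n • MilnorK.symbol
          (Function.update (fun j => a j * MilnorK.diff (c i) (c j)) i (c i))) := by
    intro i
    rw [h3, smul_smul, ← neg_smul]
    congr 1
    have := i.2
    obtain ⟨m, rfl⟩ : ∃ m, n = m + 1 := ⟨n - 1, by omega⟩
    rw [Fin.val_castSucc, Fin.val_castSucc, ← pow_add]
    rw [show (i : ℕ) + (m + 1 - 1 - i) = m by omega, pow_succ]; ring
  rw [Finset.sum_congr rfl fun i _ => t i, Finset.sum_neg_distrib, ← Finset.smul_sum, ← key]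
  simp only [Fin.val_castSucc, Fin.val_last, pow_succ, smul_sub]
  simp

end GenChain

/-! ### The complex as a complex of representations of `GLₙ(F)` -/

namespace GenChain

open CategoryTheory

variable {F : Type u} [Field F] {n p : ℕ}

/-- The action of `GLₙ(F)` on sequences of vectors. -/
def act (g : GL (Fin n) F) (v : GenTuple F n p) : GenTuple F n p :=
  ⟨fun i => g.1.mulVec (v.1 i), fun s hs => by
    refine LinearIndependent.map' (v.2 s hs) g.1.mulVecLin (LinearMap.ker_eq_bot'.2 ?_)
    intro x hx
    have h : (g⁻¹).1.mulVec (g.1.mulVec x) = x := by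
      rw [Matrix.mulVec_mulVec, ← Units.val_mul, inv_mul_cancel, Units.val_one,
        Matrix.one_mulVec]
    rw [Matrix.mulVecLin_apply] at hx
    rw [← h, hx, Matrix.mulVec_zero]⟩

theorem act_one (v : GenTuple F n p) : act 1 v = v :=
  Subtype.ext (funext fun i => by simp [act])

theorem act_mul (g h : GL (Fin n) F) (v : GenTuple F n p) : act (g * h) v = act g (act h v) :=
  Subtype.ext (funext fun i => by simp [act, Matrix.mulVec_mulVec])

theorem face_act (g : GL (Fin n) F) (v : GenTuple F n (p + 1)) (i : Fin (p + 1)) :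
    face (act g v) i = act g (face v i) := rfl

/-- The permutation representation of `GLₙ(F)` on `C_p(Fⁿ)`. -/
noncomputable def rho (F : Type u) [Field F] (n p : ℕ) :
    Representation LiftedInt.{u} (GL (Fin n) F) (GenChain F n p) where
  toFun g := Finsupp.lmapDomain _ _ (act g)
  map_one' := by
    refine hom_ext fun v => ?_
    simp [act_one]
  map_mul' g h := by
    refine hom_ext fun v => ?_
    simp [act_mul]

theorem rho_single (g : GL (Fin n) F) (v : GenTuple F n p) (r : LiftedInt.{u}) :
    rho F n p g (Finsupp.single v r) = Finsupp.single (act g v) r := by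
  simp [rho]

theorem bd_rho (g : GL (Fin n) F) (y : GenChain F n (p + 1)) :
    bd F n p (rho F n (p + 1) g y) = rho F n p g (bd F n p y) := by
  suffices h : bd F n p ∘ₗ rho F n (p + 1) g = rho F n p g ∘ₗ bd F n p from
    LinearMap.congr_fun h y
  refine hom_ext fun v => ?_
  simp only [LinearMap.comp_apply, rho_single, bd_single, map_sum, map_smul, face_act]

/-- The representation of `GLₙ(F)` on the cycles in `C_p(Fⁿ)`. -/
noncomputable def cycRho (F : Type u) [Field F] (n p : ℕ) :
    Representation LiftedInt.{u} (GL (Fin n) F) (cyc F n p) where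
  toFun g := (rho F n p g).restrict fun z hz => by
    cases p with
    | zero => trivial
    | succ p =>
      have hz' : bd F n p z = 0 := hz
      change bd F n p (rho F n (p + 1) g z) = 0
      rw [bd_rho, hz', map_zero]
  map_one' := LinearMap.ext fun z => Subtype.ext (by simp)
  map_mul' g h := LinearMap.ext fun z => Subtype.ext (by simp)

/-- `C_p(Fⁿ)` as an object of the category of representations. -/
noncomputable abbrev chainRep (F : Type u) [Field F] (n p : ℕ) :
    Rep.{u} LiftedInt.{u} (GL (Fin n) F) :=
  Rep.of (rho F n p)

/-- The cycles `Z_p(Fⁿ) ⊆ C_p(Fⁿ)` as an object of the category of representations. The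
representation `Z_n(Fⁿ)` is Suslin's module `S(Fⁿ)`. -/
noncomputable abbrev cycRep (F : Type u) [Field F] (n p : ℕ) :
    Rep.{u} LiftedInt.{u} (GL (Fin n) F) :=
  Rep.of (X := cyc F n p) (cycRho F n p)

/-- The inclusion `Z_p(Fⁿ) → C_p(Fⁿ)`. -/
noncomputable def incl (F : Type u) [Field F] (n p : ℕ) : cycRep F n p ⟶ chainRep F n p :=
  Rep.ofHom ⟨(cyc F n p).subtype, fun _ => rfl⟩

/-- The differential `C_{p+1}(Fⁿ) → Z_p(Fⁿ)`. -/
noncomputable def bdRep (F : Type u) [Field F] (n p : ℕ) : chainRep F n (p + 1) ⟶ cycRep F n p :=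
  Rep.ofHom ⟨(bd F n p).codRestrict (cyc F n p) (bd_mem_cyc p), fun g =>
    LinearMap.ext fun y => Subtype.ext (bd_rho g y)⟩

/-- The sequence `0 → Z_{p+1}(Fⁿ) → C_{p+1}(Fⁿ) → Z_p(Fⁿ) → 0`. -/
noncomputable def shortComplex (F : Type u) [Field F] (n p : ℕ) :
    ShortComplex (Rep.{u} LiftedInt.{u} (GL (Fin n) F)) where
  X₁ := cycRep F n (p + 1)
  X₂ := chainRep F n (p + 1)
  X₃ := cycRep F n p
  f := incl F n (p + 1)
  g := bdRep F n p
  zero := by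
    refine Rep.hom_ext (Representation.IntertwiningMap.ext (LinearMap.ext fun z => ?_))
    exact Subtype.ext z.2

theorem shortComplex_shortExact (F : Type u) [Field F] [Infinite F] (n p : ℕ) :
    (shortComplex F n p).ShortExact where
  exact := (forget₂ (Rep LiftedInt.{u} (GL (Fin n) F))
      (ModuleCat LiftedInt.{u})).reflects_exact_of_faithful _ <|
    (ShortComplex.moduleCat_exact_iff _).2 fun x hx => ⟨⟨x, congrArg Subtype.val hx⟩, rfl⟩
  mono_f := (Rep.mono_iff_injective _).2 fun _ _ h => Subtype.ext h
  epi_g := (Rep.epi_iff_surjective _).2 fun z => by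
    obtain ⟨y, hy⟩ := exists_bd_eq p z.1 z.2
    exact ⟨y, Subtype.ext hy⟩

/-- The identification of `ℤ` with `Z_0(Fⁿ) = C_0(Fⁿ)`; it sends `1` to the empty sequence. -/
noncomputable def augment (F : Type u) [Field F] (n : ℕ) :
    Rep.trivial LiftedInt.{u} (GL (Fin n) F) LiftedInt.{u} ⟶ cycRep F n 0 :=
  Rep.ofHom ⟨(Finsupp.lsingle (⟨Fin.elim0, fun s _ => by
      have : s = ∅ := Subsingleton.elim _ _
      subst this; simp⟩ : GenTuple F n 0)).codRestrict (cyc F n 0) fun _ => trivial, fun g => by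
    refine LinearMap.ext fun r => Subtype.ext ?_
    change _ = rho F n 0 g (Finsupp.single _ r)
    rw [rho_single]
    exact congrArg (Finsupp.single · r) (Subtype.ext (Subsingleton.elim _ _))⟩

/-- The iterated connecting homomorphism `H_m(GLₙ(F), Z_0(Fⁿ)) → H_i(GLₙ(F), Z_q(Fⁿ))`, where
`m = i + q`. -/
noncomputable def edge (F : Type u) [Field F] [Infinite F] (n : ℕ) : (q i m : ℕ) → i + q = m →
    (groupHomology (cycRep F n 0) m ⟶ groupHomology (cycRep F n q) i)
  | 0, _, _, rfl => 𝟙 _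
  | q + 1, i, m, h => edge F n q (i + 1) m (by omega) ≫
      groupHomology.δ (shortComplex_shortExact F n q) (i + 1) i rfl

theorem coords_act (g : GL (Fin n) F) (v : GenTuple F n (n + 1)) :
    coords (act g v) = coords v := by
  refine coords_eq _ _ ?_
  change g.1.mulVecLin (v.1 (Fin.last n)) = ∑ i, (coords v i : F) • g.1.mulVecLin (v.1 i.castSucc)
  conv_lhs => rw [coords_spec v]
  simp only [map_sum, map_smul]

theorem symb_rho (g : GL (Fin n) F) (y : GenChain F n (n + 1)) :
    symb F n (rho F n (n + 1) g y) = symb F n y := by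
  suffices h : symb F n ∘ₗ rho F n (n + 1) g = symb F n from LinearMap.congr_fun h y
  refine hom_ext fun v => ?_
  rw [LinearMap.comp_apply, rho_single, symb_single, symb_single, coords_act]

theorem symb_eq_of_bd_eq [Infinite F] {x y : GenChain F n (n + 1)}
    (h : bd F n n x = bd F n n y) : symb F n x = symb F n y := by
  obtain ⟨w, hw⟩ := exists_bd_eq (n + 1) (x - y) (by
    change bd F n n (x - y) = 0
    rw [map_sub, h, sub_self])
  rw [← sub_eq_zero, ← map_sub, ← hw, symb_bd]

/-- The homomorphism `S(Fⁿ) = Z_n(Fⁿ) → K_n^M(F)` which sends the boundary of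
`(v₁, …, vₙ, ∑ aᵢ vᵢ)` to `{a₁, …, aₙ}`. -/
noncomputable def cycSymb (F : Type u) [Field F] [Infinite F] (n : ℕ) :
    cyc F n n →ₗ[LiftedInt.{u}] MilnorK F n where
  toFun z := symb F n (exists_bd_eq n z.1 z.2).choose
  map_add' x y := by
    rw [← map_add]
    refine symb_eq_of_bd_eq ?_
    rw [map_add, (exists_bd_eq n x.1 x.2).choose_spec, (exists_bd_eq n y.1 y.2).choose_spec]
    exact (exists_bd_eq n (x + y).1 (x + y).2).choose_spec
  map_smul' r x := by
    rw [RingHom.id_apply, ← map_smul]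
    refine symb_eq_of_bd_eq ?_
    rw [map_smul, (exists_bd_eq n x.1 x.2).choose_spec]
    exact (exists_bd_eq n (r • x).1 (r • x).2).choose_spec

theorem cycSymb_bd [Infinite F] (y : GenChain F n (n + 1)) :
    cycSymb F n ⟨bd F n n y, bd_mem_cyc n y⟩ = symb F n y :=
  symb_eq_of_bd_eq (exists_bd_eq n _ (bd_mem_cyc n y)).choose_spec

/-- The homomorphism `H₀(GLₙ(F), S(Fⁿ)) = S(Fⁿ)_{GLₙ(F)} → K_n^M(F)` induced by `cycSymb`. -/
noncomputable def coinvSymb (F : Type u) [Field F] [Infinite F] (n : ℕ) :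
    groupHomology (cycRep F n n) 0 →ₗ[LiftedInt.{u}] MilnorK F n :=
  Representation.Coinvariants.lift (cycRep F n n).ρ (cycSymb F n) (fun g => by
    refine LinearMap.ext fun z => ?_
    obtain ⟨y, hy⟩ := exists_bd_eq n z.1 z.2
    obtain rfl : z = ⟨bd F n n y, bd_mem_cyc n y⟩ := Subtype.ext hy.symm
    have e : (cycRep F n n).ρ g ⟨bd F n n y, bd_mem_cyc n y⟩ =
        ⟨bd F n n (rho F n (n + 1) g y), bd_mem_cyc n _⟩ := Subtype.ext (bd_rho g y).symm
    rw [LinearMap.comp_apply, e, cycSymb_bd, cycSymb_bd, symb_rho]) ∘ₗ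
  (groupHomology.H0Iso (cycRep F n n)).hom.hom

theorem coinvSymb_H0π [Infinite F] (z : cyc F n n) :
    coinvSymb F n (groupHomology.H0π (cycRep F n n) z) = cycSymb F n z := by
  unfold coinvSymb
  rw [LinearMap.comp_apply]
  have := ConcreteCategory.congr_hom (groupHomology.H0π_comp_H0Iso_hom (cycRep F n n)) z
  erw [this]
  rfl

/-- The edge homomorphism `Hₙ(GLₙ(F), ℤ) → H₀(GLₙ(F), S(Fⁿ))` of the exact complex
`0 → S(Fⁿ) → Cₙ(Fⁿ) → ⋯ → C₁(Fⁿ) → ℤ → 0`. -/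
noncomputable def suslinEdge (F : Type u) [Field F] [Infinite F] (n : ℕ) :
    integralHomology (GL (Fin n) F) n ⟶ groupHomology (cycRep F n n) 0 :=
  groupHomology.map (MonoidHom.id (GL (Fin n) F)) (augment F n) n ≫
    edge F n n 0 n (Nat.zero_add n)

end GenChain

/-- Suslin's map `s_n : Hₙ(GLₙ(F)) → K_n^M(F)`: the composite of the edge homomorphism
`Hₙ(GLₙ(F), ℤ) → H₀(GLₙ(F), S(Fⁿ))` with the map
`H₀(GLₙ(F), S(Fⁿ)) → K_n^M(F)`, `[∂(v₁, …, vₙ, ∑ aᵢ vᵢ)] ↦ {a₁, …, aₙ}`.  With the sign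
conventions used here for the bar complex and for connecting homomorphisms, the sign
`(-1)^{n(n+1)/2}` is the one for which the class `c(d₁, …, dₙ)`, where `dᵢ` is the diagonal matrix
with `i`-th entry `aᵢ` and all other diagonal entries `1`, is sent to `{a₁, …, aₙ}`. -/
noncomputable def suslinMap (F : Type u) [Field F] [Infinite F] (n : ℕ) :
    integralHomology (GL (Fin n) F) n →+ MilnorK F n :=
  (-1 : ℤ) ^ (n * (n + 1) / 2) •
    (GenChain.coinvSymb F n ∘ₗ (GenChain.suslinEdge F n).hom).toAddMonoidHom

theorem suslinMap_apply (F : Type u) [Field F] [Infinite F] (n : ℕ)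
    (x : integralHomology (GL (Fin n) F) n) :
    suslinMap F n x =
      (-1 : ℤ) ^ (n * (n + 1) / 2) • GenChain.coinvSymb F n (GenChain.suslinEdge F n x) := rfl

/-! ### The classes `[a₁, …, aₙ]` -/

/-- The embedding of the group of diagonal matrices in `GLₙ(F)`. -/
noncomputable def diagGL (F : Type u) [Field F] (n : ℕ) : (Fin n → Fˣ) →* GL (Fin n) F :=
  (Units.map (Matrix.diagonalRingHom (Fin n) F).toMonoidHom).comp
    MulEquiv.piUnits.symm.toMonoidHom

/-- The matrix `A_{i,n}` attached to `a`, where the indices start at `0`: it is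
`diag(a, 1, …, 1)` for `i = 0` and `diag(a, …, a, a⁻ⁱ, 1, …, 1)`, with `i` entries equal to `a`
in front of `a⁻ⁱ`, for `i > 0`. -/
noncomputable def bracketMatrix {F : Type u} [Field F] {n : ℕ} (i : Fin n) (a : Fˣ) :
    GL (Fin n) F :=
  diagGL F n fun j =>
    if j < i then a else if j = i then (if (i : ℕ) = 0 then a else (a ^ (i : ℕ))⁻¹) else 1

/-- The class `[a₁, …, aₙ] = c(A_{1,n}, …, A_{n,n})` in `Hₙ(GLₙ(F))`. -/
noncomputable def bracket {F : Type u} [Field F] {n : ℕ} (a : Fin n → Fˣ) :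
    integralHomology (GL (Fin n) F) n :=
  barClass (fun i => bracketMatrix i (a i)) fun _ _ => (Commute.all _ _).map (diagGL F n)

/-!
# The homomorphism from Milnor `K`-theory to the homology of `GLₙ` and Suslin's map

The classes `c(g₁, …, gₙ)` of elements of a commutative group are alternating and multilinear: the
prism operator of an element `t` is a homotopy between the identity and the conjugation by `t`
(`BarClass.bdry_prism_succ`), for central `t` it multiplies by the class of `t`
(`BarClass.prism_chain`), and this reduces additivity to degree one. The same homotopy shows that
conjugation does not change the classes. So `[a₁, …, aₙ]` is multilinear in the `aᵢ`, and the invariance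
of the classes of diagonal matrices under permutations of the coordinates makes it antisymmetric
(`bracket_swap_adjacent`). It is therefore enough to prove the Steinberg relation at the first two
places. There `A_{1,n}` and `A_{2,n}` lie in `GL₂(F)` and the other matrices centralize `GL₂(F)`, so that
the relation follows from `c(diag(a, 1), diag(b, b⁻¹)) = 0` in `H₂(GL₂(F))` for `a + b = 1`
(`BarClass.chain_dg_mem_boundaries`). A class `c(g, h)` in the second homology vanishes as soon as
lifts of `g` and `h` to the extension given by the universal 2-cocycle commute, and Steinberg's
computation with lifts of unitriangular matrices shows that they commute in each central extension
of `GL₂(F)` (`CentralExtension.commute_of_add_eq_one`).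

For Suslin's map, a connecting homomorphism sends the class `c(g₀, …, g_m) ⊗ z` to
`c(g₁, …, g_m) ⊗ (g₀⁻¹ y - y)` if `y` is a lift of `z` which is fixed by `g₁, …, g_m`
(`BarClass.exists_δ_mkClass`). If all the matrices are diagonal and fix the same basis vector `e_k`, the
sequence `(e_k)` is a fixed lift in the first step, and the image is zero
(`GenChain.suslinMap_torusClass_eq_zero`). For the matrices `tₖ = diag(1, …, 1, aₖ, 1, …, 1)` the
lifts are `± ∏ (tₖ⁻¹ - 1) (e₀, …, e_q)`, and the last coefficient is the boundary of a signed sum of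
sequences `(u₀e₀, …, uₙ₋₁eₙ₋₁, ∑ eᵢ)`, whose symbols add up to `{a₁, …, aₙ}`
(`GenChain.suslinMap_diag`). In the expansion of `[a₁, …, aₙ]` only the entry at the `i`-th place of each
`A_{i,n}` contributes; its exponents are `1, -1, -2, …, -(n-1)`, with product
`(-1)^(n-1) (n-1)!` (`suslinMap_bracket`, `prod_bracketWeight`).
-/

/-! ### The bar complex and its prism operators -/

namespace BarClass

variable {G : Type u} {n : ℕ}

/-- Bar chains of degree `n` with integral coefficients. -/
abbrev BarChain (G : Type u) (n : ℕ) : Type u := (Fin n → G) →₀ LiftedInt.{u}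

theorem linearMap_ext {M : Type*} [AddCommGroup M] [Module LiftedInt.{u} M]
    {f g : BarChain G n →ₗ[LiftedInt.{u}] M}
    (h : ∀ x, f (Finsupp.single x 1) = g (Finsupp.single x 1)) : f = g :=
  Finsupp.lhom_ext' fun x => LinearMap.ext_ring (h x)

/-- Insertion of `x` in front. -/
noncomputable def consMap (x : G) (n : ℕ) : BarChain G n →ₗ[LiftedInt.{u}] BarChain G (n + 1) :=
  Finsupp.lmapDomain _ _ fun g => (Fin.cons x g : Fin (n + 1) → G)

/-- The map of bar chains induced by a map of groups. -/
noncomputable def mapChain {H : Type u} (f : G → H) (n : ℕ) :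
    BarChain G n →ₗ[LiftedInt.{u}] BarChain H n :=
  Finsupp.lmapDomain _ _ fun g => f ∘ g

theorem consMap_single (x : G) (g : Fin n → G) (r : LiftedInt.{u}) :
    consMap x n (Finsupp.single g r) = Finsupp.single (Fin.cons x g) r := by
  simp [consMap]

theorem mapChain_single {H : Type u} (f : G → H) (g : Fin n → G) (r : LiftedInt.{u}) :
    mapChain f n (Finsupp.single g r) = Finsupp.single (f ∘ g) r := by
  simp [mapChain]

theorem single_eq_consMap (g : Fin (n + 1) → G) (r : LiftedInt.{u}) :
    Finsupp.single g r = consMap (g 0) n (Finsupp.single (Fin.tail g) r) := by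
  rw [consMap_single, Fin.cons_self_tail]

theorem mapChain_consMap {H : Type u} (f : G → H) (x : G) (y : BarChain G n) :
    mapChain f (n + 1) (consMap x n y) = consMap (f x) n (mapChain f n y) := by
  suffices h : mapChain f (n + 1) ∘ₗ consMap x n = consMap (f x) n ∘ₗ mapChain f n from
    LinearMap.congr_fun h y
  refine linearMap_ext fun g => ?_
  have e : f ∘ (Fin.cons x g : Fin (n + 1) → G) = Fin.cons (f x) (f ∘ g) := by
    funext k
    refine Fin.cases ?_ (fun k => ?_) k <;> simp
  simp only [LinearMap.comp_apply, consMap_single, mapChain_single, e]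

variable [Group G]

/-- The differential of the bar complex. -/
noncomputable def bdry (G : Type u) [Group G] (n : ℕ) :
    BarChain G (n + 1) →ₗ[LiftedInt.{u}] BarChain G n :=
  (groupHomology.inhomogeneousChains.d (Rep.trivial LiftedInt.{u} G LiftedInt.{u}) n).hom

/-- The alternating sum of all the faces of the bar complex but the first one, with the sign of
the second one positive. -/
noncomputable def mulFaces (G : Type u) [Group G] (n : ℕ) :
    BarChain G (n + 1) →ₗ[LiftedInt.{u}] BarChain G n :=
  Finsupp.linearCombination LiftedInt.{u} fun g =>
    ∑ j : Fin (n + 1), (-1 : LiftedInt.{u}) ^ (j : ℕ) •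
      Finsupp.single (Fin.contractNth j (· * ·) g) 1

/-- Multiplication of the first entry by `x` on the left. -/
noncomputable def headMul (x : G) (n : ℕ) :
    BarChain G (n + 1) →ₗ[LiftedInt.{u}] BarChain G (n + 1) :=
  Finsupp.lmapDomain _ _ fun g => Fin.cons (x * g 0) (Fin.tail g)

theorem headMul_single (x : G) (g : Fin (n + 1) → G) (r : LiftedInt.{u}) :
    headMul x n (Finsupp.single g r) = Finsupp.single (Fin.cons (x * g 0) (Fin.tail g)) r := by
  simp [headMul]

theorem bdry_single_one (g : Fin (n + 1) → G) :
    bdry G n (Finsupp.single g 1) =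
      Finsupp.single (Fin.tail g) 1 - mulFaces G n (Finsupp.single g 1) := by
  have h := groupHomology.inhomogeneousChains.d_single (A := Rep.trivial LiftedInt.{u} G LiftedInt.{u})
    n g (1 : LiftedInt.{u})
  refine h.trans ?_
  rw [sub_eq_add_neg]
  congr 1
  simp only [mulFaces, Finsupp.linearCombination_single, one_smul, ← Finset.sum_neg_distrib, 
    ← neg_smul]
  refine Finset.sum_congr rfl fun j _ => ?_
  rw [pow_succ, mul_neg_one]

theorem contractNth_succ_cons (j : Fin (n + 1)) (x : G) (g : Fin (n + 1) → G) :
    Fin.contractNth j.succ (· * ·) (Fin.cons x g : Fin (n + 2) → G) =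
      (Fin.cons x (Fin.contractNth j (· * ·) g) : Fin (n + 1) → G) := by
  funext k
  refine Fin.cases ?_ (fun k => ?_) k
  · rw [Fin.contractNth_apply_of_lt _ _ _ _ (by simp)]; simp
  · rcases lt_trichotomy (k : ℕ) j with hk | hk | hk
    · rw [Fin.contractNth_apply_of_lt _ _ _ _ (by simpa using hk), Fin.cons_succ,
        Fin.contractNth_apply_of_lt _ _ _ _ hk, Fin.castSucc_succ, Fin.cons_succ]
    · rw [Fin.contractNth_apply_of_eq _ _ _ _ (by simpa using hk), Fin.cons_succ,
        Fin.cons_succ, Fin.contractNth_apply_of_eq _ _ _ _ hk, Fin.castSucc_succ, Fin.cons_succ]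
    · rw [Fin.contractNth_apply_of_gt _ _ _ _ (by simpa using hk), Fin.cons_succ,
        Fin.cons_succ, Fin.contractNth_apply_of_gt _ _ _ _ hk]

theorem contractNth_zero_cons (x : G) (g : Fin (n + 1) → G) :
    Fin.contractNth 0 (· * ·) (Fin.cons x g : Fin (n + 2) → G) =
      Fin.cons (x * g 0) (Fin.tail g) := by
  funext k
  refine Fin.cases ?_ (fun k => ?_) k
  · rw [Fin.contractNth_apply_of_eq _ _ _ _ (by simp)]; rfl
  · rw [Fin.contractNth_apply_of_gt _ _ _ _ (by simp), Fin.cons_succ, Fin.cons_succ]; rfl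

theorem mulFaces_consMap (x : G) (y : BarChain G (n + 1)) :
    mulFaces G (n + 1) (consMap x (n + 1) y) = headMul x n y - consMap x n (mulFaces G n y) := by
  suffices h : mulFaces G (n + 1) ∘ₗ consMap x (n + 1) =
    headMul x n - consMap x n ∘ₗ mulFaces G n from LinearMap.congr_fun h y
  refine linearMap_ext fun g => ?_
  simp only [LinearMap.comp_apply, LinearMap.sub_apply, consMap_single, headMul_single]
  simp only [mulFaces, Finsupp.linearCombination_single, one_smul, map_sum, map_smul,
    consMap_single]
  rw [Fin.sum_univ_succ, contractNth_zero_cons, sub_eq_add_neg, ← Finset.sum_neg_distrib]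
  simp only [contractNth_succ_cons, Fin.val_zero, pow_zero, one_smul, ← neg_smul, Fin.val_succ,
    pow_succ, mul_neg_one]

theorem bdry_consMap (x : G) (y : BarChain G n) :
    bdry G n (consMap x n y) = y - mulFaces G n (consMap x n y) := by
  suffices h : bdry G n ∘ₗ consMap x n =
    LinearMap.id - mulFaces G n ∘ₗ consMap x n from LinearMap.congr_fun h y
  refine linearMap_ext fun g => ?_
  simp only [LinearMap.comp_apply, LinearMap.sub_apply, consMap_single, bdry_single_one]
  rfl

/-- The prism operator of `t`: the alternating sum of the insertions of `t`, where the entries in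
front of `t` are conjugated by `t`. -/
noncomputable def prism (t : G) : (n : ℕ) → BarChain G n →ₗ[LiftedInt.{u}] BarChain G (n + 1)
  | 0 => consMap t 0
  | n + 1 => Finsupp.linearCombination LiftedInt.{u} fun g =>
      consMap t (n + 1) (Finsupp.single g 1) -
        consMap (t * g 0 * t⁻¹) (n + 1) (prism t n (Finsupp.single (Fin.tail g) 1))

theorem prism_consMap (t x : G) (y : BarChain G n) :
    prism t (n + 1) (consMap x n y) =
      consMap t (n + 1) (consMap x n y) - consMap (t * x * t⁻¹) (n + 1) (prism t n y) := by
  suffices h : prism t (n + 1) ∘ₗ consMap x n =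
    consMap t (n + 1) ∘ₗ consMap x n - consMap (t * x * t⁻¹) (n + 1) ∘ₗ prism t n from
    LinearMap.congr_fun h y
  refine linearMap_ext fun g => ?_
  simp only [LinearMap.comp_apply, LinearMap.sub_apply, consMap_single, prism,
    Finsupp.linearCombination_single, one_smul]
  rfl

theorem headMul_consMap (x y : G) (z : BarChain G n) :
    headMul x n (consMap y n z) = consMap (x * y) n z := by
  suffices h : headMul x n ∘ₗ consMap y n = consMap (x * y) n from LinearMap.congr_fun h z
  refine linearMap_ext fun g => ?_
  simp only [LinearMap.comp_apply, consMap_single, headMul_single]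
  rfl

theorem mulFaces_zero (y : BarChain G 1) (f : Fin 0 → G) :
    mulFaces G 0 (y) = Finsupp.single f (Finsupp.linearCombination LiftedInt.{u} (fun _ => 1) y) := by
  suffices h : mulFaces G 0 = Finsupp.lsingle f ∘ₗ
      Finsupp.linearCombination LiftedInt.{u} (fun _ => 1) from LinearMap.congr_fun h y
  refine linearMap_ext fun g => ?_
  simp [mulFaces, Subsingleton.elim _ f]

/-- On the complex of bar chains with the differential `mulFaces`, the prism operator of `t` is a
null homotopy of the conjugation by `t`. The induction removes the first entry. -/
theorem mulFaces_prism (t : G) : ∀ (n : ℕ) (y : BarChain G (n + 1)),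
    mulFaces G (n + 1) (prism t (n + 1) y) + prism t n (mulFaces G n y) =
      mapChain (fun x => t * x * t⁻¹) (n + 1) y := by
  intro n
  suffices h : mulFaces G (n + 1) ∘ₗ prism t (n + 1) + prism t n ∘ₗ mulFaces G n =
      mapChain (fun x => t * x * t⁻¹) (n + 1) from fun y => LinearMap.congr_fun h y
  induction n with
  | zero =>
    refine linearMap_ext fun g => ?_
    obtain ⟨x, r, rfl⟩ : ∃ x r, g = Fin.cons x r := ⟨g 0, Fin.tail g, (Fin.cons_self_tail g).symm⟩
    rw [← consMap_single]
    simp only [LinearMap.add_apply, LinearMap.comp_apply, prism_consMap, map_sub,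
      mulFaces_consMap, headMul_consMap, mapChain_consMap]
    simp only [prism, consMap_single, mapChain_single]
    rw [← consMap_single t, headMul_consMap, inv_mul_cancel_right]
    simp only [consMap_single]
    have e : mulFaces G 0 (Finsupp.single (Fin.cons x r) 1) = Finsupp.single r 1 := by
      rw [mulFaces_zero _ r]; simp
    have e' : mulFaces G 0 (Finsupp.single (Fin.cons t r) 1) = Finsupp.single r 1 := by
      rw [mulFaces_zero _ r]; simp
    rw [e, e', consMap_single, consMap_single,
      Subsingleton.elim ((fun x => t * x * t⁻¹) ∘ r) r]
    abel
  | succ n ih =>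
    refine linearMap_ext fun g => ?_
    obtain ⟨x, y, r, rfl⟩ : ∃ x y r, g = Fin.cons x (Fin.cons y r : Fin (n + 1) → G) :=
      ⟨g 0, g 1, Fin.tail (Fin.tail g), by
        rw [show g 1 = (Fin.tail g) 0 from rfl, Fin.cons_self_tail, Fin.cons_self_tail]⟩
    have ih' := LinearMap.congr_fun ih (consMap y n (Finsupp.single r 1))
    simp only [LinearMap.add_apply, LinearMap.comp_apply] at ih'
    rw [← consMap_single, ← consMap_single]
    simp only [LinearMap.add_apply, LinearMap.comp_apply]
    rw [mapChain_consMap, ← ih']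
    simp only [prism_consMap, map_sub, map_add,
      mulFaces_consMap, headMul_consMap, inv_mul_cancel_right]
    rw [show t * x * t⁻¹ * (t * y * t⁻¹) = t * (x * y) * t⁻¹ by group]
    abel

/-- The prism operator of `t` is a homotopy between the identity and the conjugation by `t`. -/
theorem bdry_prism_succ (t : G) (y : BarChain G (n + 1)) :
    bdry G (n + 1) (prism t (n + 1) y) + prism t n (bdry G n y) =
      y - mapChain (fun x => t * x * t⁻¹) (n + 1) y := by
  suffices h : bdry G (n + 1) ∘ₗ prism t (n + 1) + prism t n ∘ₗ bdry G n =
      LinearMap.id - mapChain (fun x => t * x * t⁻¹) (n + 1) from LinearMap.congr_fun h y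
  refine linearMap_ext fun g => ?_
  rw [single_eq_consMap]
  simp only [LinearMap.add_apply, LinearMap.comp_apply, LinearMap.sub_apply, LinearMap.id_apply]
  rw [← mulFaces_prism]
  simp only [prism_consMap, map_sub, bdry_consMap]
  abel

theorem bdry_mapChain {H : Type u} [Group H] (f : G →* H) (y : BarChain G (n + 1)) :
    bdry H n (mapChain f (n + 1) y) = mapChain f n (bdry G n y) := by
  suffices h : bdry H n ∘ₗ mapChain f (n + 1) = mapChain f n ∘ₗ bdry G n from
    LinearMap.congr_fun h y
  refine linearMap_ext fun g => ?_
  simp only [LinearMap.comp_apply, mapChain_single, bdry_single_one, map_sub, mulFaces,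
    Finsupp.linearCombination_single, one_smul, map_sum, map_smul]
  congr 1
  refine Finset.sum_congr rfl fun j _ => ?_
  congr 2
  funext k
  rcases lt_trichotomy (k : ℕ) j with hk | hk | hk
  · simp [Fin.contractNth_apply_of_lt _ _ _ _ hk]
  · simp [Fin.contractNth_apply_of_eq _ _ _ _ hk]
  · simp [Fin.contractNth_apply_of_gt _ _ _ _ hk]

/-- The boundaries of the bar complex. -/
noncomputable def boundaries (G : Type u) [Group G] (n : ℕ) :
    Submodule LiftedInt.{u} (BarChain G n) :=
  LinearMap.range (bdry G n)

theorem mapChain_mem_boundaries {H : Type u} [Group H] (f : G →* H) {y : BarChain G n}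
    (hy : y ∈ boundaries G n) : mapChain f n y ∈ boundaries H n := by
  obtain ⟨z, rfl⟩ := hy
  exact ⟨mapChain f (n + 1) z, bdry_mapChain f z⟩

/-- For central `t` the prism operator anticommutes with the differential: it is the multiplication
with the class of `t` in `H₁`. -/
theorem prism_mem_boundaries (t : G) (ht : ∀ x, t * x = x * t) {y : BarChain G n}
    (hy : y ∈ boundaries G n) : prism t n y ∈ boundaries G (n + 1) := by
  obtain ⟨z, rfl⟩ := hy
  have h := bdry_prism_succ t z
  have e : (fun x => t * x * t⁻¹) = id := by
    funext x; simp [ht]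
  have : mapChain (fun x => t * x * t⁻¹) (n + 1) z = z := by
    rw [e]; exact Finsupp.mapDomain_id
  rw [this, sub_self] at h
  exact ⟨-prism t (n + 1) z, by rw [map_neg, neg_eq_of_add_eq_zero_right h]⟩

/-- Conjugation acts trivially on homology. -/
theorem sub_conj_mem_boundaries (t : G) {y : BarChain G (n + 1)} (hy : bdry G n y = 0) :
    y - mapChain (fun x => t * x * t⁻¹) (n + 1) y ∈ boundaries G (n + 1) :=
  ⟨prism t (n + 1) y, by rw [← bdry_prism_succ, hy, map_zero, add_zero]⟩

end BarClass

/-! ### The chains of commuting elements -/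

namespace BarClass

section Chain

variable {G : Type u} {n : ℕ}

theorem chain_perm (g : Fin n → G) (τ : Equiv.Perm (Fin n)) :
    chain (g ∘ τ) = ((Equiv.Perm.sign τ : ℤ) : LiftedInt.{u}) • chain g := by
  rw [chain, chain, ← Equiv.sum_comp (Equiv.mulLeft τ⁻¹), Finset.smul_sum]
  refine Finset.sum_congr rfl fun σ _ => ?_
  have e : (g ∘ τ) ∘ ⇑(τ⁻¹ * σ) = g ∘ σ := by
    funext i; simp
  simp only [Equiv.coe_mulLeft]
  rw [e, Finsupp.smul_single, Equiv.Perm.sign_mul, Equiv.Perm.sign_inv]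
  simp

theorem chain_eq_zero_of_eq (g : Fin n → G) {i j : Fin n} (hij : i ≠ j) (h : g i = g j) :
    chain g = 0 := by
  rw [chain]
  refine Finset.sum_involution (fun σ _ => Equiv.swap i j * σ) ?_ ?_ ?_ ?_
  · intro σ _
    have : g ∘ ⇑(Equiv.swap i j * σ) = g ∘ σ := by
      funext k
      simp only [Function.comp_apply, Equiv.Perm.coe_mul]
      rcases eq_or_ne (σ k) i with h1 | h1
      · rw [h1, Equiv.swap_apply_left, h]
      · rcases eq_or_ne (σ k) j with h2 | h2
        · rw [h2, Equiv.swap_apply_right, h]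
        · rw [Equiv.swap_apply_of_ne_of_ne h1 h2]
    rw [this, ← Finsupp.single_add]
    simp [Equiv.Perm.sign_swap hij]
  · intro σ _ _ e
    exact hij (Equiv.swap_eq_one_iff.1 (mul_eq_right.1 e))
  · intro σ _; exact Finset.mem_univ _
  · intro σ _; simp [← mul_assoc]

theorem mapChain_chain {H : Type u} (f : G → H) (g : Fin n → G) :
    mapChain f n (chain g) = chain (f ∘ g) := by
  simp only [chain, map_sum, mapChain_single]
  rfl

variable [Group G]

/-- If `t` commutes with the entries of a bar chain, its prism operator is the shuffle product with
`[t]`. -/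
theorem prism_single (t : G) : ∀ (n : ℕ) (g : Fin n → G), (∀ i, t * g i = g i * t) →
    prism t n (Finsupp.single g 1) = ∑ j : Fin (n + 1), (-1 : LiftedInt.{u}) ^ (j : ℕ) •
      Finsupp.single (Fin.insertNth j t g : Fin (n + 1) → G) 1
  | 0, g, _ => by
    simp only [prism, consMap_single]
    rw [Fin.sum_univ_succ, Fin.sum_univ_zero, add_zero]
    simp only [Fin.val_zero, pow_zero, one_smul]
    congr 1
    funext i
    obtain rfl : i = 0 := Subsingleton.elim (α := Fin 1) _ _
    rfl
  | n + 1, g, hg => by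
    obtain ⟨x, r, rfl⟩ : ∃ x r, g = Fin.cons x r := ⟨g 0, Fin.tail g, (Fin.cons_self_tail g).symm⟩
    rw [← consMap_single, prism_consMap, prism_single t n r fun i => by simpa using hg i.succ,
      Fin.sum_univ_succ (n := n + 1), map_sum, sub_eq_add_neg, ← Finset.sum_neg_distrib]
    have hx : t * x * t⁻¹ = x := by simpa [mul_inv_eq_iff_eq_mul] using hg 0
    congr 1
    · simp [consMap_single]
    · refine Finset.sum_congr rfl fun j _ => ?_
      rw [map_smul, consMap_single, hx, ← neg_smul]
      rw [Fin.insertNth_succ_cons, Fin.val_succ, pow_succ, mul_neg_one]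

theorem prism_chain (t : G) (g : Fin n → G) (hg : ∀ i, t * g i = g i * t) :
    prism t n (chain g) = chain (Fin.cons t g : Fin (n + 1) → G) := by
  -- a permutation is determined by the place of `0` and by a permutation of the other elements
  let f : Fin (n + 1) × Equiv.Perm (Fin n) → Equiv.Perm (Fin (n + 1)) := fun p =>
    Equiv.Perm.decomposeFin.symm (0, p.2) * p.1.cycleRange
  have f0 : ∀ p, f p p.1 = 0 := fun p => by simp [f]
  have f1 : ∀ p k, f p (p.1.succAbove k) = (p.2 k).succ := fun p k => by simp [f]
  have hf : Function.Bijective f := by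
    rw [Fintype.bijective_iff_injective_and_card]
    refine ⟨?_, by simp [Fintype.card_perm, Nat.factorial_succ]⟩
    rintro ⟨j, e⟩ ⟨j', e'⟩ h
    have h0 : j = j' := by
      have := f0 (j, e)
      rw [h, ← f0 (j', e')] at this
      exact (f (j', e')).injective this
    subst h0
    refine Prod.ext rfl (Equiv.ext fun k => ?_)
    have := f1 (j, e) k
    rw [h, f1] at this
    exact (Fin.succ_injective _ this).symm
  have hs : ∀ p, (Equiv.Perm.sign (f p) : ℤ) = (-1) ^ (p.1 : ℕ) * Equiv.Perm.sign p.2 := by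
    intro p
    simp [f, Equiv.Perm.sign_mul, Fin.sign_cycleRange, mul_comm]
  have hc : ∀ p, (Fin.cons t g : Fin (n + 1) → G) ∘ f p =
      Fin.insertNth p.1 t (g ∘ p.2) := by
    intro p
    funext k
    refine Fin.succAboveCases p.1 ?_ (fun k => ?_) k
    · simp [f0]
    · simp [f1]
  rw [chain, chain, ← (Equiv.ofBijective f hf).sum_comp, Fintype.sum_prod_type_right, map_sum]
  refine Finset.sum_congr rfl fun e _ => ?_
  rw [← mul_one ((Equiv.Perm.sign e : ℤ) : LiftedInt.{u}), ← smul_eq_mul, ← Finsupp.smul_single,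
    map_smul, prism_single t n (g ∘ e) fun i => hg _, Finset.smul_sum]
  refine Finset.sum_congr rfl fun j _ => ?_
  rw [Equiv.ofBijective_apply, hc, hs]
  simp [mul_comm]

/-- If all elements but the last two are central, then a relation between the last two elements can
be multiplied by the others. -/
theorem chain_mem_boundaries_of_central : ∀ (m : ℕ) (h : Fin (m + 2) → G),
    (∀ i : Fin m, ∀ x, h i.castSucc.castSucc * x = x * h i.castSucc.castSucc) →
    chain ![h (Fin.last m).castSucc, h (Fin.last (m + 1))] ∈ boundaries G 2 →
    chain h ∈ boundaries G (m + 2)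
  | 0, h, _, h2 => by
    convert h2 using 2
    funext i
    fin_cases i <;> rfl
  | m + 1, h, hc, h2 => by
    rw [← Fin.cons_self_tail h, ← prism_chain (h 0) (Fin.tail h) fun i => hc 0 _]
    exact prism_mem_boundaries _ (hc 0) (chain_mem_boundaries_of_central m (Fin.tail h)
      (fun i => hc i.succ) h2)

end Chain

section Comm

variable {T : Type u} [CommGroup T] {n : ℕ}

/-- Additivity in the last place. In degree one it is the boundary of `[x | y]`, and the other
elements are multiplied in by their prism operators, since the group is commutative. -/
theorem chain_snoc_mul : ∀ (n : ℕ) (r : Fin n → T) (x y : T),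
    chain (Fin.snoc r (x * y) : Fin (n + 1) → T) - chain (Fin.snoc r x : Fin (n + 1) → T) -
      chain (Fin.snoc r y : Fin (n + 1) → T) ∈ boundaries T (n + 1)
  | 0, r, x, y => by
    have c : ∀ z : T, chain (Fin.snoc r z : Fin 1 → T) =
        Finsupp.single (Fin.cons z Fin.elim0 : Fin 1 → T) 1 := by
      intro z
      have u : (Finset.univ : Finset (Equiv.Perm (Fin (0 + 1)))) = {1} := by
        ext σ
        simp only [Finset.mem_univ, Finset.mem_singleton, true_iff]
        exact Subsingleton.elim (α := Equiv.Perm (Fin 1)) _ _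
      rw [chain, u, Finset.sum_singleton]
      simp only [Equiv.Perm.sign_one, Units.val_one, Int.cast_one]
      congr 1
      funext i
      obtain rfl : i = 0 := Subsingleton.elim (α := Fin 1) _ _
      rfl
    rw [c, c, c]
    refine ⟨- consMap x 1 (consMap y 0 (Finsupp.single Fin.elim0 1)), ?_⟩
    rw [map_neg, bdry_consMap, mulFaces_consMap, headMul_consMap, mulFaces_zero _ Fin.elim0]
    simp only [consMap_single, Finsupp.linearCombination_single, one_smul]
    abel
  | n + 1, r, x, y => by
    have e : ∀ z, (Fin.snoc r z : Fin (n + 2) → T) =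
        Fin.cons (r 0) (Fin.snoc (Fin.tail r) z : Fin (n + 1) → T) := by
      intro z
      rw [Fin.cons_snoc_eq_snoc_cons, Fin.cons_self_tail]
    rw [e, e, e, ← prism_chain _ _ fun i => mul_comm _ _, ← prism_chain _ _ fun i => mul_comm _ _,
      ← prism_chain _ _ fun i => mul_comm _ _, ← map_sub, ← map_sub]
    exact prism_mem_boundaries _ (fun i => mul_comm _ _) (chain_snoc_mul n _ x y)

theorem chain_update_mul (g : Fin n → T) (i : Fin n) (x y : T) :
    chain (Function.update g i (x * y)) - chain (Function.update g i x) -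
      chain (Function.update g i y) ∈ boundaries T n := by
  obtain ⟨m, rfl⟩ : ∃ m, n = m + 1 := ⟨n - 1, by have := i.2; omega⟩
  set τ := Equiv.swap i (Fin.last m)
  have e : ∀ z, chain (Function.update g i z) = ((Equiv.Perm.sign τ : ℤ) : LiftedInt.{u}) •
      chain (Fin.snoc (fun k : Fin m => g (τ k.castSucc)) z : Fin (m + 1) → T) := by
    intro z
    rw [← chain_perm]
    congr 1
    funext k
    obtain ⟨l, rfl⟩ := τ.surjective k
    have hl : τ (τ l) = l := Equiv.swap_apply_self _ _ _
    rw [Function.comp_apply, hl]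
    refine Fin.lastCases ?_ (fun l => ?_) l
    · simp [τ]
    · rw [Fin.snoc_castSucc, Function.update_of_ne]
      intro h
      have : τ (Fin.last m) = i := Equiv.swap_apply_right _ _
      rw [← this] at h
      exact (Fin.castSucc_lt_last l).ne (τ.injective h)
  simp only [e]
  rw [← smul_sub, ← smul_sub]
  exact Submodule.smul_mem _ _ (chain_snoc_mul m _ x y)

end Comm

/-! ### Homology classes of bar cycles -/

section Class

open CategoryTheory groupHomology

variable {G : Type u} [Group G] {n : ℕ}

/-- The cycles of the bar complex. -/
noncomputable def barCycles (G : Type u) [Group G] (n : ℕ) :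
    Submodule LiftedInt.{u} (BarChain G n) :=
  LinearMap.ker ((inhomogeneousChains (Rep.trivial LiftedInt.{u} G LiftedInt.{u})).d n
      ((ComplexShape.down ℕ).next n)).hom

theorem cycles_ext {x y : cycles (Rep.trivial LiftedInt.{u} G LiftedInt.{u}) n}
    (h : iCycles (Rep.trivial LiftedInt.{u} G LiftedInt.{u}) n x =
      iCycles (Rep.trivial LiftedInt.{u} G LiftedInt.{u}) n y) : x = y :=
  (ModuleCat.mono_iff_injective
    (iCycles (Rep.trivial LiftedInt.{u} G LiftedInt.{u}) n)).1 inferInstance h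

/-- The homology class of a bar cycle. -/
noncomputable def cls (G : Type u) [Group G] (n : ℕ) :
    barCycles G n →ₗ[LiftedInt.{u}] integralHomology G n :=
  (groupHomology.π (Rep.trivial LiftedInt.{u} G LiftedInt.{u}) n).hom ∘ₗ
  { toFun := fun y => cyclesMk n _ rfl y.1 y.2
    map_add' := fun x y => cycles_ext <| by
      refine (iCycles_mk rfl _ _).trans (.trans ?_ (map_add _ _ _).symm)
      exact congrArg₂ (· + ·)
        (iCycles_mk (A := Rep.trivial LiftedInt.{u} G LiftedInt.{u}) rfl x.1 x.2).symm
        (iCycles_mk (A := Rep.trivial LiftedInt.{u} G LiftedInt.{u}) rfl y.1 y.2).symm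
    map_smul' := fun r y => cycles_ext <| by
      refine (iCycles_mk rfl _ _).trans (.trans ?_ (map_smul _ _ _).symm)
      exact congrArg (r • ·)
        (iCycles_mk (A := Rep.trivial LiftedInt.{u} G LiftedInt.{u}) rfl y.1 y.2).symm }

theorem barClass_eq_cls (g : Fin n → G) (hg : ∀ i j, Commute (g i) (g j)) :
    barClass g hg = cls G n ⟨chain g, d_chain_next g hg⟩ := rfl

theorem cls_eq_zero (y : barCycles G n) (hy : y.1 ∈ boundaries G n) : cls G n y = 0 := by
  obtain ⟨z, hz⟩ := hy
  have e : cyclesMk (A := Rep.trivial LiftedInt.{u} G LiftedInt.{u}) n _ rfl y.1 y.2 =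
      toCycles (Rep.trivial LiftedInt.{u} G LiftedInt.{u}) (n + 1) n z := by
    refine cycles_ext ((iCycles_mk rfl _ _).trans (hz.symm.trans ?_))
    have h := HomologicalComplex.toCycles_i
      (inhomogeneousChains (Rep.trivial LiftedInt.{u} G LiftedInt.{u})) (n + 1) n
    rw [inhomogeneousChains.d_def] at h
    exact (LinearMap.congr_fun (congrArg ModuleCat.Hom.hom h) z).symm
  have h := HomologicalComplex.toCycles_comp_homologyπ
      (inhomogeneousChains (Rep.trivial LiftedInt.{u} G LiftedInt.{u})) (n + 1) n
  exact (congrArg (groupHomology.π (Rep.trivial LiftedInt.{u} G LiftedInt.{u}) n) e).trans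
    (LinearMap.congr_fun (congrArg ModuleCat.Hom.hom h) z)

theorem mem_barCycles_succ {y : BarChain G (n + 1)} : y ∈ barCycles G (n + 1) ↔ bdry G n y = 0 := by
  have h : (ComplexShape.down ℕ).next (n + 1) = n := by simp
  rw [barCycles, LinearMap.mem_ker, h, inhomogeneousChains.d_def]
  rfl

end Class

end BarClass

/-! ### Central extensions of `GL₂(F)` -/

namespace CentralExtension

open scoped commutatorElement

section Commutator

variable {E G : Type*} [Group E] [Group G] {p : E →* G}

theorem eq_mul_of_map_eq (hp : ∀ z, p z = 1 → ∀ e, z * e = e * z) {a b : E} (h : p a = p b) :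
    ∃ z, (∀ e, z * e = e * z) ∧ a = b * z :=
  ⟨b⁻¹ * a, hp _ (by simp [h]), by simp⟩

/-- In a central extension, commutators depend only on the images of their entries. -/
theorem commutator_eq_of_map_eq (hp : ∀ z, p z = 1 → ∀ e, z * e = e * z) {a b a' b' : E}
    (ha : p a = p a') (hb : p b = p b') : ⁅a, b⁆ = ⁅a', b'⁆ := by
  obtain ⟨z, hz, rfl⟩ := eq_mul_of_map_eq hp ha
  obtain ⟨w, hw, rfl⟩ := eq_mul_of_map_eq hp hb
  rw [commutatorElement_def, commutatorElement_def]
  calc a' * z * (b' * w) * (a' * z)⁻¹ * (b' * w)⁻¹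
      = a' * (z * (b' * w)) * (z⁻¹ * a'⁻¹) * (w⁻¹ * b'⁻¹) := by group
    _ = a' * b' * w * a'⁻¹ * w⁻¹ * b'⁻¹ := by rw [hz]; group
    _ = a' * b' * (w * a'⁻¹) * w⁻¹ * b'⁻¹ := by group
    _ = a' * b' * a'⁻¹ * b'⁻¹ := by rw [hw]; group

theorem conj_commutator (e a b : E) : e * ⁅a, b⁆ * e⁻¹ = ⁅e * a * e⁻¹, e * b * e⁻¹⁆ := by
  simp only [commutatorElement_def]; group

end Commutator

variable {F : Type u} [Field F]

/-- The matrix `diag(a, b)`. -/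
noncomputable def dg (a b : Fˣ) : GL (Fin 2) F := diagGL F 2 ![a, b]

/-- The upper unitriangular matrix with upper right entry `t`. -/
def upper (t : F) : GL (Fin 2) F :=
  ⟨!![1, t; 0, 1], !![1, -t; 0, 1], by simp [Matrix.one_fin_two], by simp [Matrix.one_fin_two]⟩

/-- The lower unitriangular matrix with lower left entry `t`. -/
def lower (t : F) : GL (Fin 2) F :=
  ⟨!![1, 0; t, 1], !![1, 0; -t, 1], by simp [Matrix.one_fin_two], by simp [Matrix.one_fin_two]⟩

/-- The antidiagonal matrix with entries `v` and `-v⁻¹`. -/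
def anti (v : Fˣ) : GL (Fin 2) F :=
  ⟨!![0, (v : F); -(v⁻¹ : Fˣ), 0], !![0, -(v : F); (v⁻¹ : Fˣ), 0],
    by simp [Matrix.one_fin_two], by simp [Matrix.one_fin_two]⟩

theorem val_dg (a b : Fˣ) : (dg a b).1 = !![(a : F), 0; 0, (b : F)] := by
  ext i j
  fin_cases i <;> fin_cases j <;> simp [dg, diagGL, Matrix.diagonal]

theorem upper_add (s t : F) : upper (s + t) = upper s * upper t := by
  ext i j; fin_cases i <;> fin_cases j <;> simp [upper, add_comm]

theorem dg_mul (a b c d : Fˣ) : dg a b * dg c d = dg (a * c) (b * d) := by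
  ext i j; rw [Units.val_mul, val_dg, val_dg, val_dg]
  fin_cases i <;> fin_cases j <;> simp

theorem dg_mul_upper (a b : Fˣ) (t : F) :
    dg a b * upper t = upper (a * t * (b⁻¹ : Fˣ)) * dg a b := by
  ext i j; rw [Units.val_mul, Units.val_mul, val_dg]
  fin_cases i <;> fin_cases j <;> simp [upper]

theorem dg_mul_lower (a b : Fˣ) (t : F) :
    dg a b * lower t = lower (b * t * (a⁻¹ : Fˣ)) * dg a b := by
  ext i j; rw [Units.val_mul, Units.val_mul, val_dg]
  fin_cases i <;> fin_cases j <;> simp [lower]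

theorem anti_mul_upper (v : Fˣ) (t : F) :
    anti v * upper t = lower (-(v⁻¹ : Fˣ) * (v⁻¹ : Fˣ) * t) * anti v := by
  ext i j; rw [Units.val_mul, Units.val_mul]
  fin_cases i <;> fin_cases j <;> simp [upper, lower, anti]
  field_simp

theorem anti_mul_lower (v : Fˣ) (t : F) :
    anti v * lower t = upper (-v * v * t) * anti v := by
  ext i j; rw [Units.val_mul, Units.val_mul]
  fin_cases i <;> fin_cases j <;> simp [upper, lower, anti]
  field_simp

theorem anti_mul_dg (v a b : Fˣ) : anti v * dg a b = dg b a * anti v := by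
  ext i j; rw [Units.val_mul, Units.val_mul, val_dg, val_dg]
  fin_cases i <;> fin_cases j <;> simp [anti, mul_comm]

theorem upper_mul_lower_mul_upper (v : Fˣ) :
    upper (v : F) * lower (-(v⁻¹ : Fˣ) : F) * upper (v : F) = anti v := by
  ext i j; rw [Units.val_mul, Units.val_mul]
  fin_cases i <;> fin_cases j <;> simp [upper, lower, anti]

theorem anti_mul_anti (v : Fˣ) : anti v * anti (-1) = dg v v⁻¹ := by
  ext i j; rw [Units.val_mul, val_dg]
  fin_cases i <;> fin_cases j <;> simp [anti]

theorem exists_unit_ne [Infinite F] : ∃ u : Fˣ, (u : F) - 1 ≠ 0 ∧ (u : F) * u - u + 1 ≠ 0 := by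
  classical
  obtain ⟨u, hu⟩ := Infinite.exists_notMem_finset
    (({0, 1} : Finset F) ∪ (Polynomial.X * Polynomial.X - Polynomial.X + 1 : Polynomial F).roots.toFinset)
  have hp : (Polynomial.X * Polynomial.X - Polynomial.X + 1 : Polynomial F) ≠ 0 := by
    intro h
    have := congrArg (Polynomial.eval 0) h
    simp at this
  simp only [Finset.mem_union, Finset.mem_insert, Finset.mem_singleton, Multiset.mem_toFinset,
    Polynomial.mem_roots hp, not_or] at hu
  obtain ⟨⟨h0, h1⟩, h2⟩ := hu
  refine ⟨Units.mk0 u h0, sub_ne_zero.2 h1, ?_⟩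
  simpa [Polynomial.IsRoot] using h2

variable {E : Type*} [Group E] {p : E →* GL (Fin 2) F}

/-- Lifts of upper unitriangular matrices to a central extension commute: their commutator is a
biadditive form in the matrix entries which is invariant under simultaneous scaling, and such a
form vanishes over an infinite field. -/
theorem commute_of_map_eq_upper [Infinite F] (hs : Function.Surjective p)
    (hp : ∀ z, p z = 1 → ∀ e, z * e = e * z) {a b : E} {s t : F} (ha : p a = upper s)
    (hb : p b = upper t) : a * b = b * a := by
  obtain ⟨L, hL⟩ := hs.hasRightInverse
  set β : F → F → E := fun s t => ⁅L (upper s), L (upper t)⁆ with hβ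
  have comm : ∀ s t : F, upper s * upper t = upper t * upper s := fun s t => by
    rw [← upper_add, ← upper_add, add_comm]
  have central : ∀ s t e, β s t * e = e * β s t := fun s t => hp _ (by
    rw [hβ, map_commutatorElement, hL, hL, commutatorElement_eq_one_iff_mul_comm]
    exact comm s t)
  have lift : ∀ {a b : E} {s t : F}, p a = upper s → p b = upper t → ⁅a, b⁆ = β s t :=
    fun h h' => commutator_eq_of_map_eq hp (by rw [h, hL]) (by rw [h', hL])
  have add_right : ∀ s t t', β s (t + t') = β s t * β s t' := by
    intro s t t'
    rw [← lift (hL _) (show p (L (upper t) * L (upper t')) = _ by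
      rw [map_mul, hL, hL, upper_add])]
    have : ∀ x y z : E, ⁅x, y * z⁆ = ⁅x, y⁆ * (y * ⁅x, z⁆ * y⁻¹) := fun x y z => by
      simp only [commutatorElement_def]; group
    rw [this, lift (hL _) (hL _), lift (hL _) (hL _), ← central s t' (L (upper t)),
      mul_inv_cancel_right]
  have add_left : ∀ s s' t, β (s + s') t = β s t * β s' t := by
    intro s s' t
    rw [← lift (show p (L (upper s) * L (upper s')) = _ by
      rw [map_mul, hL, hL, upper_add]) (hL _)]
    have : ∀ x y z : E, ⁅x * y, z⁆ = (x * ⁅y, z⁆ * x⁻¹) * ⁅x, z⁆ := fun x y z => by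
      simp only [commutatorElement_def]; group
    rw [this, lift (hL _) (hL _), lift (hL _) (hL _), ← central s' t (L (upper s)),
      mul_inv_cancel_right, central]
  have scale : ∀ (c : Fˣ) (s t : F), β (c * s) (c * t) = β s t := by
    intro c s t
    have k : ∀ r : F, p (L (dg c 1) * L (upper r) * (L (dg c 1))⁻¹) = upper (c * r) := by
      intro r
      rw [map_mul, map_mul, map_inv, hL, hL, dg_mul_upper]
      simp
    rw [← lift (k s) (k t), ← conj_commutator]
    change L (dg c 1) * β s t * _ = _
    rw [← central, mul_inv_cancel_right]
  obtain ⟨v, hv1, hv2⟩ := exists_unit_ne (F := F)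
  have hv1' : 1 - (v : F) ≠ 0 := fun h => hv1 (by rw [← neg_sub, h, neg_zero])
  set v' : Fˣ := Units.mk0 _ hv1' with hv'
  -- since `v + v' = 1`, the form `β` is invariant under `t ↦ (v⁻¹ + v'⁻¹) t`
  have inv : ∀ s t, β s t = β s (((v⁻¹ : Fˣ) + (v'⁻¹ : Fˣ)) * t) := by
    intro s t
    have e : ∀ c : Fˣ, β s ((c⁻¹ : Fˣ) * t) = β (c * s) t := fun c => by
      rw [← scale c s, ← mul_assoc, Units.mul_inv, one_mul]
    rw [add_mul, add_right, e, e, ← add_left, ← add_mul, hv', Units.val_mk0, add_sub_cancel,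
      one_mul]
  have one : ∀ s t, β s ((((v⁻¹ : Fˣ) + (v'⁻¹ : Fˣ)) - 1) * t) = 1 := by
    intro s t
    have h := inv s t
    rw [show (((v⁻¹ : Fˣ) : F) + (v'⁻¹ : Fˣ)) * t =
      (((v⁻¹ : Fˣ) + (v'⁻¹ : Fˣ)) - 1) * t + t by ring, add_right] at h
    exact (mul_eq_right.1 h.symm)
  have hc : (((v⁻¹ : Fˣ) : F) + (v'⁻¹ : Fˣ)) - 1 ≠ 0 := by
    intro h
    apply hv2
    rw [hv'] at h
    simp only [Units.val_inv_eq_inv_val, Units.val_mk0] at h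
    field_simp at h
    linear_combination h
  have hab := lift ha hb
  rw [show t = ((((v⁻¹ : Fˣ) : F) + (v'⁻¹ : Fˣ)) - 1) *
    (((((v⁻¹ : Fˣ) : F) + (v'⁻¹ : Fˣ)) - 1)⁻¹ * t) by field_simp, one] at hab
  exact commutatorElement_eq_one_iff_mul_comm.1 hab

/-- In a central extension of `GL₂(F)`, the lifts of `diag(a, 1)` and of `diag(b, b⁻¹)` commute if
`a + b = 1`. With the canonical lifts `X`, `Y` of the unitriangular matrices and
`W v = X v * Y (-v⁻¹) * X v`, the matrix `diag(b, b⁻¹)` is lifted by `W b * W (-1)`, conjugation by a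
lift of `diag(a, 1)` sends it to `W (a b) * W (-a)`, and these two lifts agree by the identity
`W (b a) = W b * W (-1) * W a`, which is the place where `a + b = 1` is used. -/
theorem commute_of_add_eq_one [Infinite F] (hs : Function.Surjective p)
    (hp : ∀ z, p z = 1 → ∀ e, z * e = e * z) {a b : Fˣ} (hab : (a : F) + b = 1) {x y : E}
    (hx : p x = dg a 1) (hy : p y = dg b b⁻¹) : x * y = y * x := by
  obtain ⟨L, hL⟩ := hs.hasRightInverse
  obtain ⟨u, hu, -⟩ := exists_unit_ne (F := F)
  -- canonical lifts of unitriangular matrices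
  set X : F → E := fun t => ⁅L (dg u 1), L (upper (((u : F) - 1)⁻¹ * t))⁆ with hX
  set Y : F → E := fun t => ⁅L (dg 1 u), L (lower (((u : F) - 1)⁻¹ * t))⁆ with hY
  have pX : ∀ t, p (X t) = upper t := by
    intro t
    rw [hX, map_commutatorElement, hL, hL, commutatorElement_def, dg_mul_upper, mul_inv_cancel_right,
      mul_inv_eq_iff_eq_mul, ← upper_add]
    congr 1
    simp
    field_simp
    ring
  -- conjugation permutes the canonical lifts
  have conj : ∀ (e : E) (g g' h h' : GL (Fin 2) F), p e * g = g' * p e → p e * h = h' * p e →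
      e * ⁅L g, L h⁆ * e⁻¹ = ⁅L g', L h'⁆ := by
    intro e g g' h h' h1 h2
    rw [conj_commutator]
    refine commutator_eq_of_map_eq hp ?_ ?_
    · rw [map_mul, map_mul, map_inv, hL, hL, h1, mul_inv_cancel_right]
    · rw [map_mul, map_mul, map_inv, hL, hL, h2, mul_inv_cancel_right]
  have dX : ∀ (e : E) (c d : Fˣ) (t : F), p e = dg c d →
      e * X t * e⁻¹ = X (c * t * (d⁻¹ : Fˣ)) := by
    intro e c d t he
    refine conj _ _ _ _ _ ?_ ?_
    · rw [he, dg_mul, dg_mul, mul_comm c, mul_comm d]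
    · rw [he, dg_mul_upper]
      congr 2; ring
  have dY : ∀ (e : E) (c d : Fˣ) (t : F), p e = dg c d →
      e * Y t * e⁻¹ = Y (d * t * (c⁻¹ : Fˣ)) := by
    intro e c d t he
    refine conj _ _ _ _ _ ?_ ?_
    · rw [he, dg_mul, dg_mul, mul_comm c, mul_comm d]
    · rw [he, dg_mul_lower]
      congr 2; ring
  have wX : ∀ (e : E) (v : Fˣ) (t : F), p e = anti v →
      e * X t * e⁻¹ = Y (-(v⁻¹ : Fˣ) * (v⁻¹ : Fˣ) * t) := by
    intro e v t he
    refine conj _ _ _ _ _ ?_ ?_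
    · rw [he, anti_mul_dg]
    · rw [he, anti_mul_upper]
      congr 2; ring
  have wY : ∀ (e : E) (v : Fˣ) (t : F), p e = anti v →
      e * Y t * e⁻¹ = X (-v * v * t) := by
    intro e v t he
    refine conj _ _ _ _ _ ?_ ?_
    · rw [he, anti_mul_dg]
    · rw [he, anti_mul_lower]
      congr 2; ring
  have Xadd : ∀ s t, X (s + t) = X s * X t := by
    intro s t
    have h1 : X (s + t) = ⁅L (dg u 1), L (upper (((u : F) - 1)⁻¹ * s)) *
        L (upper (((u : F) - 1)⁻¹ * t))⁆ :=
      commutator_eq_of_map_eq hp rfl (by rw [map_mul, hL, hL, hL, ← upper_add, mul_add])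
    have : ∀ x y z : E, ⁅x, y * z⁆ = ⁅x, y⁆ * (y * ⁅x, z⁆ * y⁻¹) := fun x y z => by
      simp only [commutatorElement_def]; group
    rw [h1, this]
    change X s * (_ * X t * _) = _
    rw [commute_of_map_eq_upper hs hp (hL (upper (((u : F) - 1)⁻¹ * s))) (pX t),
      mul_inv_cancel_right]
  have Yconj : ∀ t, Y t = L (anti 1) * X (-t) * (L (anti 1))⁻¹ := by
    intro t
    rw [wX _ 1 _ (hL _)]
    congr 1; simp
  have Yadd : ∀ s t, Y (s + t) = Y s * Y t := by
    intro s t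
    rw [Yconj, Yconj, Yconj, neg_add, Xadd]; group
  have X0 : X 0 = 1 := by simpa using Xadd 0 0
  have Y0 : Y 0 = 1 := by simpa using Yadd 0 0
  have pY : ∀ t, p (Y t) = lower t := by
    intro t
    rw [Yconj, map_mul, map_mul, map_inv, hL, pX, anti_mul_upper, mul_inv_cancel_right]
    congr 1; simp
  set W : Fˣ → E := fun v => X v * Y (-(v⁻¹ : Fˣ) : F) * X v with hW
  have pW : ∀ v, p (W v) = anti v := by
    intro v
    rw [hW, map_mul, map_mul, pX, pY, upper_mul_lower_mul_upper]
  have Winv : ∀ v, W (-v) * W v = 1 := by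
    intro v
    simp only [hW]
    calc X ((-v : Fˣ) : F) * Y (-((-v)⁻¹ : Fˣ) : F) * X ((-v : Fˣ) : F) *
        (X v * Y (-(v⁻¹ : Fˣ) : F) * X v)
        = X ((-v : Fˣ) : F) * Y (-((-v)⁻¹ : Fˣ) : F) * (X ((-v : Fˣ) : F) * X v) *
          Y (-(v⁻¹ : Fˣ) : F) * X v := by group
      _ = 1 := by
        rw [← Xadd, Units.val_neg, neg_add_cancel, X0, mul_one, mul_assoc (X _), ← Yadd]
        rw [show (-((-v)⁻¹ : Fˣ) : F) + (-(v⁻¹ : Fˣ) : F) = 0 by simp, Y0, mul_one, ← Xadd,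
          neg_add_cancel, X0]
  have dW : ∀ (e : E) (c v : Fˣ), p e = dg c 1 → e * W v * e⁻¹ = W (c * v) := by
    intro e c v he
    have h1 := dX e c 1 v he
    have h2 := dY e c 1 (-(v⁻¹ : Fˣ) : F) he
    calc e * W v * e⁻¹ = (e * X v * e⁻¹) * (e * Y (-(v⁻¹ : Fˣ) : F) * e⁻¹) * (e * X v * e⁻¹) := by
          simp only [hW]; group
      _ = W (c * v) := by
        rw [h1, h2]
        simp only [hW]
        congr 1
        · congr 1
          · congr 1; simp
          · congr 1; simp [mul_comm]
        · congr 1; simp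
  have W1 : W (-1) = Y 1 * X (-1) * Y 1 := by
    have h1 := wX _ (-1) (((-1 : Fˣ)) : F) (pW (-1))
    have h2 := wY _ (-1) (-(((-1 : Fˣ)⁻¹ : Fˣ)) : F) (pW (-1))
    calc W (-1) = W (-1) * W (-1) * (W (-1))⁻¹ := by group
      _ = (W (-1) * X ((-1 : Fˣ) : F) * (W (-1))⁻¹) *
          (W (-1) * Y (-(((-1 : Fˣ)⁻¹ : Fˣ)) : F) * (W (-1))⁻¹) *
          (W (-1) * X ((-1 : Fˣ) : F) * (W (-1))⁻¹) := by
        conv_lhs => enter [1, 2]; simp only [hW]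
        group
      _ = _ := by
        rw [h1, h2]; simp
  -- the key identity
  have key : W (b * a) = W b * W (-1) * W a := by
    have k1 : W b * Y 1 = X (-b * b * 1) * W b := by
      rw [← wY _ b 1 (pW b)]; group
    have k2 : Y 1 * W a = W a * X (-a * a) := by
      have := wX _ a (-a * a) (pW a)
      rw [show -(a⁻¹ : Fˣ) * ((a⁻¹ : Fˣ) : F) * (-a * a) = 1 by
        simp only [Units.val_inv_eq_inv_val]; field_simp] at this
      rw [← this]; group
    symm
    calc W b * W (-1) * W a = (W b * Y 1) * X (-1) * (Y 1 * W a) := by rw [W1]; group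
      _ = X (-b * b * 1) * X b * Y (-(b⁻¹ : Fˣ) : F) * (X b * X (-1) * X a) *
          Y (-(a⁻¹ : Fˣ) : F) * (X a * X (-a * a)) := by
        rw [k1, k2]; simp only [hW]; group
      _ = W (b * a) := by
        rw [← Xadd, ← Xadd, ← Xadd, ← Xadd]
        rw [show (b : F) + -1 + a = 0 by linear_combination hab, X0, mul_one, mul_assoc (X _),
          ← Yadd]
        have ha : (a : F) = 1 - b := by linear_combination hab
        have hb : (1 : F) - b ≠ 0 := by rw [← ha]; exact a.ne_zero
        simp only [hW]
        congr 1
        · congr 1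
          · congr 1; push_cast; rw [ha]; ring
          · congr 1; simp only [mul_inv, Units.val_mul, Units.val_inv_eq_inv_val]
            rw [ha]; field_simp; ring
        · congr 1; push_cast; rw [ha]; ring
  have hxy : x * (W b * W (-1)) * x⁻¹ = W b * W (-1) := by
    have e1 := dW x a b hx
    have e2 := dW x a (-1) hx
    have e3 : W (-a) = (W a)⁻¹ := eq_inv_of_mul_eq_one_left (Winv a)
    calc x * (W b * W (-1)) * x⁻¹ = (x * W b * x⁻¹) * (x * W (-1) * x⁻¹) := by group
      _ = W b * W (-1) := by
        rw [e1, e2, mul_comm a b, key, mul_neg_one, e3, mul_inv_cancel_right]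
  obtain ⟨z, hz, rfl⟩ := eq_mul_of_map_eq hp (a := y) (b := W b * W (-1)) (by
    rw [hy, map_mul, pW, pW, anti_mul_anti])
  rw [mul_inv_eq_iff_eq_mul] at hxy
  rw [← mul_assoc, hxy, mul_assoc (W b * W (-1)), ← hz x, mul_assoc (W b * W (-1)) z]

end CentralExtension

/-! ### The Steinberg relation in the second homology of `GL₂(F)` -/

namespace BarClass

variable {G : Type u} [Group G]

/-- The class of `[g | h]` modulo boundaries: the universal 2-cocycle of `G`. -/
noncomputable def univCocycle (g h : G) : BarChain G 2 ⧸ boundaries G 2 :=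
  (boundaries G 2).mkQ (Finsupp.single ![g, h] 1)

theorem univCocycle_add (g h k : G) :
    univCocycle g h + univCocycle (g * h) k = univCocycle h k + univCocycle g (h * k) := by
  have e : ∀ x y : G, Finsupp.single ![x, y] (1 : LiftedInt.{u}) =
      consMap x 1 (consMap y 0 (Finsupp.single ![] 1)) := fun x y => by
    rw [consMap_single, consMap_single]; rfl
  have h0 : (boundaries G 2).mkQ (bdry G 2 (consMap g 2 (consMap h 1 (consMap k 0
      (Finsupp.single ![] 1))))) = 0 := (Submodule.Quotient.mk_eq_zero _).2 ⟨_, rfl⟩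
  have m0 : consMap g 1 (consMap h 0 (mulFaces G 0 (consMap k 0 (Finsupp.single ![] 1)))) =
      Finsupp.single ![g, h] 1 := by
    rw [e, mulFaces_zero (consMap k 0 _) ![], consMap_single k, Finsupp.linearCombination_single]
    simp
  simp only [bdry_consMap, mulFaces_consMap, headMul_consMap, map_sub] at h0
  rw [m0] at h0
  simp only [univCocycle, e] at h0 ⊢
  rw [← sub_eq_zero, ← neg_eq_zero, ← h0]
  abel

theorem univCocycle_one_left (g : G) : univCocycle 1 g = univCocycle 1 (1 : G) := by
  simpa using (univCocycle_add 1 1 g).symm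

theorem univCocycle_one_right (g : G) : univCocycle g 1 = univCocycle 1 (1 : G) := by
  simpa using univCocycle_add g 1 1

/-- The central extension of `G` by the group of bar 2-chains modulo boundaries which is given by
the universal 2-cocycle. -/
@[ext]
structure UnivExt (G : Type u) [Group G] where
  /-- The component in the kernel. -/
  ker : BarChain G 2 ⧸ boundaries G 2
  /-- The image in `G`. -/
  val : G

namespace UnivExt

noncomputable instance : Mul (UnivExt G) :=
  ⟨fun x y => ⟨x.ker + y.ker + univCocycle x.val y.val, x.val * y.val⟩⟩

noncomputable instance : One (UnivExt G) := ⟨⟨-univCocycle 1 1, 1⟩⟩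

noncomputable instance : Inv (UnivExt G) :=
  ⟨fun x => ⟨-x.ker - univCocycle x.val⁻¹ x.val - univCocycle 1 1, x.val⁻¹⟩⟩

theorem mul_def (x y : UnivExt G) :
    x * y = ⟨x.ker + y.ker + univCocycle x.val y.val, x.val * y.val⟩ := rfl

theorem one_def : (1 : UnivExt G) = ⟨-univCocycle 1 1, 1⟩ := rfl

theorem inv_def (x : UnivExt G) :
    x⁻¹ = ⟨-x.ker - univCocycle x.val⁻¹ x.val - univCocycle 1 1, x.val⁻¹⟩ := rfl

noncomputable instance : Group (UnivExt G) :=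
  Group.ofLeftAxioms
    (fun x y z => by
      have h := univCocycle_add x.val y.val z.val
      simp only [mul_def, mul_assoc, UnivExt.mk.injEq, and_true]
      rw [show x.ker + y.ker + univCocycle x.val y.val + z.ker + univCocycle (x.val * y.val) z.val =
        x.ker + y.ker + z.ker + (univCocycle x.val y.val + univCocycle (x.val * y.val) z.val) by
          abel, h]
      abel)
    (fun x => by
      ext1
      · simp [mul_def, one_def, univCocycle_one_left x.val]
      · simp [mul_def, one_def])
    (fun x => by
      ext1
      · simp only [mul_def, one_def, inv_def]
        abel
      · simp [mul_def, one_def, inv_def])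

/-- The projection of the extension to `G`. -/
noncomputable def proj (G : Type u) [Group G] : UnivExt G →* G :=
  MonoidHom.mk' UnivExt.val fun _ _ => rfl

theorem proj_surjective : Function.Surjective (proj G) := fun g => ⟨⟨0, g⟩, rfl⟩

theorem ker_proj_central (z : UnivExt G) (hz : proj G z = 1) (x : UnivExt G) : z * x = x * z := by
  have h : z.val = 1 := hz
  ext1
  · simp only [mul_def, h, univCocycle_one_left x.val, univCocycle_one_right x.val]
    abel
  · simp [mul_def, h]

end UnivExt

/-- If lifts of commuting elements `g` and `h` commute in every central extension, then `c(g, h)`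
is trivial; it suffices to consider the extension given by the universal 2-cocycle. -/
theorem chain_two_mem_boundaries (g h : G)
    (H : ∀ x y : UnivExt G, UnivExt.proj G x = g → UnivExt.proj G y = h → x * y = y * x) :
    chain ![g, h] ∈ boundaries G 2 := by
  have e := congrArg UnivExt.ker (H ⟨0, g⟩ ⟨0, h⟩ rfl rfl)
  simp only [UnivExt.mul_def, zero_add] at e
  have c : chain ![g, h] = Finsupp.single ![g, h] 1 - Finsupp.single ![h, g] 1 := by
    have hu : (Finset.univ : Finset (Equiv.Perm (Fin 2))) = {1, Equiv.swap 0 1} := by decide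
    have hs : ![g, h] ∘ ⇑(Equiv.swap (0 : Fin 2) 1) = ![h, g] := by
      funext i; fin_cases i <;> rfl
    rw [chain, hu, Finset.sum_pair (by decide), hs, Equiv.Perm.sign_swap (by decide)]
    simp [sub_eq_add_neg]
  rw [c]
  exact (Submodule.Quotient.eq _).1 e

/-- Steinberg's relation in the second homology of `GL₂(F)`. -/
theorem chain_dg_mem_boundaries {F : Type u} [Field F] [Infinite F] {a b : Fˣ}
    (hab : (a : F) + b = 1) :
    chain ![CentralExtension.dg a 1, CentralExtension.dg b b⁻¹] ∈ boundaries (GL (Fin 2) F) 2 :=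
  chain_two_mem_boundaries _ _ fun _ _ hx hy => CentralExtension.commute_of_add_eq_one
    UnivExt.proj_surjective UnivExt.ker_proj_central hab hx hy

end BarClass

/-! ### The classes of commuting elements as an alternating map -/

namespace BarClass

variable {G : Type u} [Group G] {n : ℕ}

theorem barClass_conj (x : G) (g : Fin n → G) (hg : ∀ i j, Commute (g i) (g j))
    (hg' : ∀ i j, Commute (x * g i * x⁻¹) (x * g j * x⁻¹)) :
    barClass (fun i => x * g i * x⁻¹) hg' = barClass g hg := by
  symm
  rw [barClass_eq_cls, barClass_eq_cls, ← sub_eq_zero, ← map_sub]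
  refine cls_eq_zero _ ?_
  have e : chain (fun i => x * g i * x⁻¹) = mapChain (fun y => x * y * x⁻¹) n (chain g) :=
    (mapChain_chain (fun y => x * y * x⁻¹) g).symm
  change chain g - chain _ ∈ _
  cases n with
  | zero =>
    rw [Subsingleton.elim (fun i => x * g i * x⁻¹) g, sub_self]
    exact Submodule.zero_mem _
  | succ m =>
    rw [e]
    exact sub_conj_mem_boundaries x (mem_barCycles_succ.1 (d_chain_next g hg))

theorem barClass_perm (g : Fin n → G) (hg : ∀ i j, Commute (g i) (g j)) (σ : Equiv.Perm (Fin n)) :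
    barClass (g ∘ σ) (fun _ _ => hg _ _) = (Equiv.Perm.sign σ : ℤ) • barClass g hg := by
  rw [barClass_eq_cls, barClass_eq_cls, ← Int.cast_smul_eq_zsmul LiftedInt.{u}, ← map_smul]
  congr 1
  exact Subtype.ext (chain_perm g σ)

theorem barClass_eq_zero (g : Fin n → G) (hg : ∀ i j, Commute (g i) (g j))
    (h : chain g ∈ boundaries G n) : barClass g hg = 0 :=
  cls_eq_zero ⟨chain g, d_chain_next g hg⟩ h

variable {T : Type u} [CommGroup T]

theorem barClass_update_mul (φ : T →* G) (t : Fin n → T) (i : Fin n) (x y : T) :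
    barClass (fun k => φ (Function.update t i (x * y) k)) (fun _ _ => (Commute.all _ _).map φ) =
      barClass (fun k => φ (Function.update t i x k)) (fun _ _ => (Commute.all _ _).map φ) +
      barClass (fun k => φ (Function.update t i y k)) (fun _ _ => (Commute.all _ _).map φ) := by
  rw [barClass_eq_cls, barClass_eq_cls, barClass_eq_cls, ← sub_eq_zero, ← sub_sub, ← map_sub,
    ← map_sub]
  refine cls_eq_zero _ ?_
  have h := mapChain_mem_boundaries φ (chain_update_mul t i x y)
  rw [map_sub, map_sub, mapChain_chain, mapChain_chain, mapChain_chain] at h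
  exact h

/-- The alternating map `(t₁, …, tₙ) ↦ c(φ(t₁), …, φ(tₙ))` attached to a homomorphism `φ` defined
on a commutative group. -/
noncomputable def altClass (φ : T →* G) (n : ℕ) :
    Additive T [⋀^Fin n]→ₗ[ℤ] integralHomology G n where
  toFun t := barClass (fun k => φ (t k).toMul) fun _ _ => (Commute.all _ _).map φ
  map_update_add' {inst} t i x y := by
    obtain rfl : inst = instDecidableEqFin n := Subsingleton.elim _ _
    exact barClass_update_mul φ t i x y
  map_update_smul' {inst} t i c x := by
    obtain rfl : inst = instDecidableEqFin n := Subsingleton.elim _ _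
    let f : Additive T →+ integralHomology G n := AddMonoidHom.mk'
      (fun x => barClass (fun k => φ (Function.update t i x k).toMul)
        fun _ _ => (Commute.all _ _).map φ) (fun x y => barClass_update_mul φ t i x y)
    exact map_zsmul f c x
  map_eq_zero_of_eq' t i j h hij := by
    refine barClass_eq_zero _ _ ?_
    rw [chain_eq_zero_of_eq _ hij (by rw [h])]
    exact Submodule.zero_mem _

end BarClass

/-! ### The torus of diagonal matrices -/

section Torus

open BarClass

variable (F : Type u) [Field F] (n : ℕ)

/-- The alternating map `(t₁, …, tₙ) ↦ c(t₁, …, tₙ)` on the group of diagonal matrices. -/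
noncomputable def torusClass :
    Additive (Fin n → Fˣ) [⋀^Fin n]→ₗ[ℤ] integralHomology (GL (Fin n) F) n :=
  altClass (diagGL F n) n

variable {F n}

/-- The permutation matrix of a transposition. -/
noncomputable def swapGL (k l : Fin n) : GL (Fin n) F :=
  ⟨(Equiv.swap k l).permMatrix F, (Equiv.swap k l).permMatrix F,
    by rw [← Matrix.permMatrix_mul, Equiv.swap_mul_self, Matrix.permMatrix_one],
    by rw [← Matrix.permMatrix_mul, Equiv.swap_mul_self, Matrix.permMatrix_one]⟩

theorem val_diagGL (t : Fin n → Fˣ) : (diagGL F n t).1 = Matrix.diagonal fun i => (t i : F) := by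
  simp [diagGL]

theorem swapGL_conj (k l : Fin n) (t : Fin n → Fˣ) :
    swapGL k l * diagGL F n t * (swapGL k l)⁻¹ = diagGL F n (t ∘ Equiv.swap k l) := by
  rw [mul_inv_eq_iff_eq_mul]
  ext i j
  rw [Units.val_mul, Units.val_mul, val_diagGL, val_diagGL]
  change ((Equiv.swap k l).toPEquiv.toMatrix * _ : Matrix _ _ F) i j =
    (_ * (Equiv.swap k l).toPEquiv.toMatrix : Matrix _ _ F) i j
  rw [PEquiv.toMatrix_toPEquiv_mul, PEquiv.mul_toMatrix_toPEquiv]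
  simp only [Matrix.submatrix_apply, Matrix.diagonal_apply, id, Function.comp_apply,
    Equiv.symm_swap]
  by_cases h : Equiv.swap k l i = j
  · rw [if_pos h, if_pos]
    rw [← h, Equiv.swap_apply_self]
  · rw [if_neg h, if_neg]
    rintro rfl
    exact h (Equiv.swap_apply_self _ _ _)

/-- Exchanging two coordinates in all the matrices is a conjugation and does not change the class. -/
theorem torusClass_comp_swap (t : Fin n → Additive (Fin n → Fˣ)) (k l : Fin n) :
    torusClass F n (fun i => Additive.ofMul ((t i).toMul ∘ Equiv.swap k l)) = torusClass F n t := by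
  refine Eq.trans ?_ (barClass_conj (swapGL k l) (fun i => diagGL F n (t i).toMul)
    (fun _ _ => (Commute.all _ _).map _) (fun i j => by
      rw [swapGL_conj, swapGL_conj]; exact (Commute.all _ _).map _))
  simp only [swapGL_conj]
  rfl

/-- The diagonal matrix with the entry `a` at the places before `i` and `1` elsewhere. -/
def low (i : Fin n) : Fˣ →* (Fin n → Fˣ) where
  toFun a l := if l < i then a else 1
  map_one' := by funext l; simp
  map_mul' a b := by funext l; by_cases h : l < i <;> simp [h]

/-- The exponent of the `i`-th entry of the matrix `A_{i,n}`. -/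
def bracketWeight (i : ℕ) : ℤ := if i = 0 then 1 else -i

/-- The matrix `A_{i,n}` as a function of its argument. -/
noncomputable def bracketHom (i : Fin n) : Fˣ →* (Fin n → Fˣ) :=
  low i * (MonoidHom.mulSingle (fun _ : Fin n => Fˣ) i).comp (zpowGroupHom (bracketWeight i))

theorem bracketHom_apply (i : Fin n) (a : Fˣ) :
    bracketHom i a = low i a * Pi.mulSingle i (a ^ bracketWeight i) := rfl

theorem bracketMatrix_eq (i : Fin n) (a : Fˣ) :
    bracketMatrix i a = diagGL F n (bracketHom i a) := by
  unfold bracketMatrix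
  congr 1
  funext l
  rw [bracketHom_apply, Pi.mul_apply]
  rcases lt_trichotomy l i with h | h | h
  · simp [low, h, Pi.mulSingle_eq_of_ne h.ne]
  · subst h
    by_cases h0 : (l : ℕ) = 0 <;> simp [low, bracketWeight, h0]
  · simp [low, h.not_gt, h.ne']

variable (F n) in
/-- The classes `[a₁, …, aₙ]` as a multilinear map. -/
noncomputable def bracketMap :
    MultilinearMap ℤ (fun _ : Fin n => Additive Fˣ) (integralHomology (GL (Fin n) F) n) :=
  (torusClass F n).toMultilinearMap.compLinearMap
    fun i => (MonoidHom.toAdditive (bracketHom i)).toIntLinearMap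

theorem bracket_eq (a : Fin n → Fˣ) : bracket a = bracketMap F n fun i => Additive.ofMul (a i) := by
  change _ = barClass (fun k => diagGL F n (bracketHom k (a k)))
    fun _ _ => (Commute.all _ _).map _
  unfold bracket
  simp only [bracketMatrix_eq]

/-- The values of an alternating map at two places, as a bilinear map. -/
noncomputable def bilinAt {T M : Type*} [AddCommGroup T] [AddCommGroup M]
    (f : T [⋀^Fin n]→ₗ[ℤ] M) (v : Fin n → T) (i j : Fin n) (hij : i ≠ j) : T →ₗ[ℤ] T →ₗ[ℤ] M :=
  LinearMap.mk₂ ℤ (fun s t => f (Function.update (Function.update v i s) j t))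
    (fun s s' t => by
      simp only [Function.update_comm hij]
      exact f.map_update_add _ _ _ _)
    (fun c s t => by
      simp only [Function.update_comm hij]
      exact f.map_update_smul _ _ _ _)
    (fun s t t' => f.map_update_add _ _ _ _)
    (fun c s t => f.map_update_smul _ _ _ _)

theorem bilinAt_self {T M : Type*} [AddCommGroup T] [AddCommGroup M]
    (f : T [⋀^Fin n]→ₗ[ℤ] M) (v : Fin n → T) (i j : Fin n) (hij : i ≠ j) (t : T) :
    bilinAt f v i j hij t t = 0 :=
  f.map_eq_zero_of_eq _ (i := i) (j := j) (by simp [hij]) hij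

theorem bilinAt_neg {T M : Type*} [AddCommGroup T] [AddCommGroup M]
    (f : T [⋀^Fin n]→ₗ[ℤ] M) (v : Fin n → T) (i j : Fin n) (hij : i ≠ j) (s t : T) :
    bilinAt f v i j hij s t = -bilinAt f v i j hij t s := by
  have h := bilinAt_self f v i j hij (s + t)
  simp only [map_add, LinearMap.add_apply, bilinAt_self, zero_add, add_zero] at h
  rw [add_comm] at h
  exact eq_neg_of_add_eq_zero_left h

theorem bilinAt_torusClass_swap (v : Fin n → Additive (Fin n → Fˣ)) (i j : Fin n) (hij : i ≠ j)
    (k l : Fin n) (hv : ∀ m, m ≠ i → m ≠ j → (v m).toMul ∘ Equiv.swap k l = (v m).toMul)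
    (s t : Fin n → Fˣ) :
    bilinAt (torusClass F n) v i j hij (.ofMul (s ∘ Equiv.swap k l))
      (.ofMul (t ∘ Equiv.swap k l)) = bilinAt (torusClass F n) v i j hij (.ofMul s) (.ofMul t) := by
  change torusClass F n _ = torusClass F n _
  rw [← torusClass_comp_swap (Function.update (Function.update v i _) j _) k l]
  congr 1
  funext m
  have e : ∀ r : Fin n → Fˣ, (r ∘ Equiv.swap k l) ∘ Equiv.swap k l = r := fun r => by
    funext p; simp
  by_cases h1 : m = j
  · subst h1; simp [e]
  · by_cases h2 : m = i
    · subst h2; simp [hij, e]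
    · simp only [Function.update_of_ne h1, Function.update_of_ne h2, hv m h2 h1]
      rfl


theorem low_comp_swap (i j : Fin n) (hij : i < j) (k : Fin n) (hk : k ≤ i) (a : Fˣ) :
    low k a ∘ Equiv.swap i j = low k a := by
  funext l
  simp only [low, MonoidHom.coe_mk, OneHom.coe_mk, Function.comp_apply]
  rcases eq_or_ne l i with rfl | h1
  · rw [Equiv.swap_apply_left, if_neg (not_lt.2 (hk.trans hij.le)), if_neg (not_lt.2 hk)]
  · rcases eq_or_ne l j with rfl | h2
    · rw [Equiv.swap_apply_right, if_neg (not_lt.2 hk), if_neg (not_lt.2 (hk.trans hij.le))]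
    · rw [Equiv.swap_apply_of_ne_of_ne h1 h2]

theorem low_comp_swap' (i j : Fin n) (hij : i < j) (k : Fin n) (hk : j < k) (a : Fˣ) :
    low k a ∘ Equiv.swap i j = low k a := by
  funext l
  simp only [low, MonoidHom.coe_mk, OneHom.coe_mk, Function.comp_apply]
  rcases eq_or_ne l i with rfl | h1
  · rw [Equiv.swap_apply_left, if_pos hk, if_pos (hij.trans hk)]
  · rcases eq_or_ne l j with rfl | h2
    · rw [Equiv.swap_apply_right, if_pos hk, if_pos (hij.trans hk)]
    · rw [Equiv.swap_apply_of_ne_of_ne h1 h2]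

theorem mulSingle_comp_swap (i j k : Fin n) (a : Fˣ) :
    (Pi.mulSingle k a : Fin n → Fˣ) ∘ Equiv.swap i j = Pi.mulSingle (Equiv.swap i j k) a := by
  funext l
  simp only [Function.comp_apply, Pi.mulSingle_apply]
  congr 1
  rw [eq_iff_iff]
  constructor
  · rintro rfl; simp
  · rintro rfl; simp

/-- The matrices `A_{k,n}` with `k ≠ i, i + 1` commute with the permutation matrices of the block
at the places `i, i + 1`. -/
theorem bracketHom_comp_swap (i j : Fin n) (hij : (j : ℕ) = i + 1) (k : Fin n) (h1 : k ≠ i)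
    (h2 : k ≠ j) (a : Fˣ) : bracketHom k a ∘ Equiv.swap i j = bracketHom k a := by
  have hlt : i < j := Fin.lt_def.2 (by omega)
  have e : low k a ∘ Equiv.swap i j = low k a := by
    rcases lt_or_ge i k with h | h
    · refine low_comp_swap' i j hlt k ?_ a
      have : (k : ℕ) ≠ j := fun h => h2 (Fin.ext h)
      rw [Fin.lt_def] at h ⊢
      omega
    · exact low_comp_swap i j hlt k h a
  rw [bracketHom_apply, Pi.mul_comp, e, mulSingle_comp_swap,
    Equiv.swap_apply_of_ne_of_ne h1 h2]

theorem low_succ (i j : Fin n) (hij : (j : ℕ) = i + 1) (a : Fˣ) :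
    low j a = low i a * Pi.mulSingle i a := by
  funext l
  simp only [low, MonoidHom.coe_mk, OneHom.coe_mk, Pi.mul_apply, Pi.mulSingle_apply, Fin.lt_def,
    Fin.ext_iff]
  rcases lt_trichotomy (l : ℕ) i with h | h | h
  · rw [if_pos (by omega), if_pos h, if_neg (by omega), mul_one]
  · rw [if_pos (by omega), if_neg (by omega), if_pos h, one_mul]
  · rw [if_neg (by omega), if_neg (by omega), if_neg (by omega), mul_one]

/-- The class `[a₁, …, aₙ]` changes its sign if two adjacent arguments are exchanged. The matrices
`A_{i,n}` and `A_{i+1,n}` are products of powers of `P = diag(a, …, a, 1, …, 1)` and of two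
matrices `Q`, `R` with a single nontrivial entry, and the transposition of the places of `Q` and `R`
does not change the homology class. -/
theorem bracket_swap_adjacent (a : Fin n → Fˣ) (i j : Fin n) (hij : (j : ℕ) = i + 1) :
    bracket (a ∘ Equiv.swap i j) = -bracket a := by
  have hne : i ≠ j := by rintro rfl; omega
  have hlt : i < j := Fin.lt_def.2 (by omega)
  set v : Fin n → Additive (Fin n → Fˣ) := fun k => .ofMul (bracketHom k (a k)) with hv
  set B := bilinAt (torusClass F n) v i j hne with hB
  have e : ∀ b : Fin n → Fˣ, (∀ k, k ≠ i → k ≠ j → b k = a k) →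
      bracket b = B (.ofMul (bracketHom i (b i))) (.ofMul (bracketHom j (b j))) := by
    intro b hb
    rw [bracket_eq]
    change torusClass F n (fun k => .ofMul (bracketHom k (b k))) = torusClass F n _
    congr 1
    funext k
    by_cases h1 : k = j
    · subst h1; simp
    · by_cases h2 : k = i
      · subst h2; simp [hne]
      · rw [Function.update_of_ne h1, Function.update_of_ne h2, hb k h2 h1]
  have neg : ∀ s t, B s t = - B t s := bilinAt_neg _ _ _ _ _
  have sw : ∀ s t : Fin n → Fˣ, B (.ofMul (s ∘ Equiv.swap i j)) (.ofMul (t ∘ Equiv.swap i j)) =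
      B (.ofMul s) (.ofMul t) :=
    bilinAt_torusClass_swap v i j hne i j fun m h1 h2 => bracketHom_comp_swap i j hij m h1 h2 _
  set P : Fˣ → Additive (Fin n → Fˣ) := fun x => .ofMul (low i x) with hP
  set Q : Fˣ → Additive (Fin n → Fˣ) := fun x => .ofMul (Pi.mulSingle i x) with hQ
  set R : Fˣ → Additive (Fin n → Fˣ) := fun x => .ofMul (Pi.mulSingle j x) with hR
  have hi : ∀ x, Additive.ofMul (bracketHom i x) = P x + bracketWeight i • Q x := fun x => by
    rw [bracketHom_apply, ofMul_mul, Pi.mulSingle_zpow, ofMul_zpow]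
  have hj : ∀ x, Additive.ofMul (bracketHom j x) = P x + Q x + (-((i : ℤ) + 1)) • R x := fun x => by
    rw [bracketHom_apply, ofMul_mul, Pi.mulSingle_zpow, ofMul_zpow, low_succ i j hij, ofMul_mul]
    have : bracketWeight j = -((i : ℤ) + 1) := by
      rw [bracketWeight, if_neg (by omega), hij]; push_cast; rfl
    rw [this]
  have PR : ∀ x y, B (P x) (R y) = B (P x) (Q y) := fun x y => by
    have := sw (low i x) (Pi.mulSingle i y)
    rw [low_comp_swap i j hlt i le_rfl, mulSingle_comp_swap, Equiv.swap_apply_left] at this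
    exact this
  have QR : ∀ x y, B (Q x) (R y) = - B (Q y) (R x) := fun x y => by
    have := sw (Pi.mulSingle j y) (Pi.mulSingle i x)
    rw [mulSingle_comp_swap, mulSingle_comp_swap, Equiv.swap_apply_left,
      Equiv.swap_apply_right] at this
    rw [neg]
    exact congrArg Neg.neg this.symm
  rw [e (a ∘ Equiv.swap i j) fun k h1 h2 => by
    rw [Function.comp_apply, Equiv.swap_apply_of_ne_of_ne h1 h2], e a fun _ _ _ => rfl]
  simp only [Function.comp_apply, Equiv.swap_apply_left, Equiv.swap_apply_right, hi, hj]
  rw [eq_neg_iff_add_eq_zero]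
  simp only [map_add, map_smul, LinearMap.add_apply, LinearMap.smul_apply, PR]
  rw [neg (P (a j)) (P (a i)), neg (Q (a j)) (Q (a i)), QR (a j) (a i), neg (Q (a j)) (P (a i)),
    neg (Q (a i)) (P (a j))]
  by_cases h0 : (i : ℕ) = 0
  · have : ∀ x, P x = 0 := fun x => by
      rw [hP]
      refine congrArg Additive.ofMul (funext fun l => ?_)
      simp [low, Fin.lt_def, h0]
    simp only [this, map_zero, LinearMap.zero_apply]
    module
  · rw [bracketWeight, if_neg h0]
    module

theorem bracket_perm (a : Fin n → Fˣ) (σ : Equiv.Perm (Fin n)) :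
    bracket (a ∘ σ) = (Equiv.Perm.sign σ : ℤ) • bracket a := by
  cases n with
  | zero =>
    obtain rfl : σ = 1 := Subsingleton.elim _ _
    simp
  | succ m =>
    have h : σ ∈ Submonoid.closure (Set.range fun i : Fin m ↦ Equiv.swap i.castSucc i.succ) := by
      rw [Equiv.Perm.mclosure_swap_castSucc_succ]
      trivial
    induction h using Submonoid.closure_induction generalizing a with
    | mem x hx =>
      obtain ⟨i, rfl⟩ := hx
      rw [bracket_swap_adjacent a _ _ (by simp),
        Equiv.Perm.sign_swap (Fin.castSucc_lt_succ (i := i)).ne]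
      simp
    | one => simp
    | mul x y _ _ hx hy =>
      have : a ∘ ⇑(x * y) = (a ∘ x) ∘ y := rfl
      rw [this, hy, hx, smul_smul, Equiv.Perm.sign_mul]
      simp [mul_comm]

end Torus

/-! ### The Steinberg relation for the classes `[a₁, …, aₙ]` -/

section Steinberg

open BarClass CentralExtension

variable {F : Type u} [Field F] {m : ℕ}

/-- The inclusion of the first two coordinates. -/
def blockIncl (F : Type u) [Field F] (m : ℕ) : Matrix (Fin (m + 2)) (Fin 2) F :=
  fun i k => if (i : ℕ) = k then 1 else 0

theorem blockIncl_transpose_mul : (blockIncl F m).transpose * blockIncl F m = 1 := by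
  ext k l
  rw [Matrix.mul_apply, Finset.sum_eq_single ⟨k, by omega⟩]
  · simp [blockIncl, Matrix.one_apply, Fin.ext_iff]
  · intro i _ hi
    have : (i : ℕ) ≠ k := fun h => hi (Fin.ext h)
    simp [blockIncl, this]
  · simp

/-- The embedding `A ↦ diag(A, 1, …, 1)` of `2 × 2`-matrices, written as `1 + V (A - 1) Vᵀ` where `V`
is the inclusion of the first two coordinates. -/
def blockHom (F : Type u) [Field F] (m : ℕ) :
    Matrix (Fin 2) (Fin 2) F →* Matrix (Fin (m + 2)) (Fin (m + 2)) F where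
  toFun A := 1 + blockIncl F m * (A - 1) * (blockIncl F m).transpose
  map_one' := by simp
  map_mul' A B := by
    set V := blockIncl F m
    have h : V.transpose * V = 1 := blockIncl_transpose_mul
    have e : V * (A - 1) * V.transpose * (V * (B - 1) * V.transpose) =
        V * ((A - 1) * (B - 1)) * V.transpose := by
      calc V * (A - 1) * V.transpose * (V * (B - 1) * V.transpose)
          = V * (A - 1) * (V.transpose * V) * (B - 1) * V.transpose := by
            simp only [Matrix.mul_assoc]
        _ = _ := by rw [h, Matrix.mul_one]; simp only [Matrix.mul_assoc]
    rw [mul_add, add_mul, add_mul, e]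
    simp only [one_mul, mul_one]
    rw [add_assoc, ← Matrix.add_mul, ← Matrix.mul_add, ← Matrix.add_mul, ← Matrix.mul_add]
    congr 3
    noncomm_ring

/-- The embedding of `GL₂(F)` in the upper left corner. -/
def blockGL (F : Type u) [Field F] (m : ℕ) : GL (Fin 2) F →* GL (Fin (m + 2)) F :=
  Units.map (blockHom F m)

theorem val_blockGL (g : GL (Fin 2) F) :
    (blockGL F m g).1 = 1 + blockIncl F m * (g.1 - 1) * (blockIncl F m).transpose := rfl

theorem diagonal_mul_blockIncl (d : Fin (m + 2) → F) (c : F) (h0 : d 0 = c) (h1 : d 1 = c) :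
    Matrix.diagonal d * blockIncl F m = c • blockIncl F m := by
  ext i k
  rw [Matrix.diagonal_mul, Matrix.smul_apply, smul_eq_mul]
  by_cases h : (i : ℕ) = k
  · have : d i = c := by
      fin_cases k
      · rwa [show i = 0 from Fin.ext h]
      · rwa [show i = 1 from Fin.ext (by simpa using h)]
    rw [this]
  · simp [blockIncl, h]

theorem commute_diagGL_blockGL (d : Fin (m + 2) → Fˣ) (h : d 0 = d 1) (g : GL (Fin 2) F) :
    diagGL F (m + 2) d * blockGL F m g = blockGL F m g * diagGL F (m + 2) d := by
  ext1
  rw [Units.val_mul, Units.val_mul, val_diagGL, val_blockGL]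
  set D := Matrix.diagonal fun i => (d i : F) with hD
  set V := blockIncl F m
  have h1 : D * V = (d 0 : F) • V := diagonal_mul_blockIncl _ _ rfl (by rw [h])
  have h2 : V.transpose * D = (d 0 : F) • V.transpose := by
    have := congrArg Matrix.transpose h1
    rwa [Matrix.transpose_mul, hD, Matrix.diagonal_transpose, Matrix.transpose_smul] at this
  rw [mul_add, add_mul, mul_one, one_mul, ← Matrix.mul_assoc, ← Matrix.mul_assoc, h1,
    Matrix.mul_assoc (V * _), h2, Matrix.mul_smul, Matrix.smul_mul, Matrix.smul_mul]

theorem blockGL_dg (x y : Fˣ) : blockGL F m (dg x y) =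
    diagGL F (m + 2) fun l => if (l : ℕ) = 0 then x else if (l : ℕ) = 1 then y else 1 := by
  ext1
  rw [val_diagGL, val_blockGL, val_dg]
  ext i j
  simp only [Matrix.add_apply, Matrix.mul_apply, Matrix.one_apply, Matrix.sub_apply,
    Matrix.transpose_apply, blockIncl, Fin.sum_univ_two, Matrix.diagonal_apply, Fin.ext_iff]
  by_cases hi0 : (i : ℕ) = 0
  · by_cases hj0 : (j : ℕ) = 0
    · simp [hi0, hj0]
    · have : ¬ 0 = (j : ℕ) := fun h => hj0 h.symm
      simp [hi0, hj0, this]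
  · by_cases hi1 : (i : ℕ) = 1
    · by_cases hj1 : (j : ℕ) = 1
      · simp [hi1, hj1]
      · have : ¬ 1 = (j : ℕ) := fun h => hj1 h.symm
        simp [hi1, hj1, this]
    · simp [hi0, hi1]

theorem bracketHom_zero (a : Fˣ) : diagGL F (m + 2) (bracketHom 0 a) = blockGL F m (dg a 1) := by
  rw [blockGL_dg, bracketHom_apply]
  congr 1
  funext l
  by_cases h : l = 0
  · subst h; simp [low, bracketWeight]
  · have : (l : ℕ) ≠ 0 := fun h' => h (Fin.ext h')
    simp [low, this, Pi.mulSingle_eq_of_ne h]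

theorem bracketHom_one (a : Fˣ) : diagGL F (m + 2) (bracketHom 1 a) = blockGL F m (dg a a⁻¹) := by
  rw [blockGL_dg, bracketHom_apply]
  congr 1
  funext l
  by_cases h : l = 0
  · subst h; simp [low, Pi.mulSingle_eq_of_ne]
  · have h' : (l : ℕ) ≠ 0 := fun h' => h (Fin.ext h')
    by_cases h1 : l = 1
    · subst h1; simp [low, bracketWeight]
    · have : (l : ℕ) ≠ 1 := fun h' => h1 (Fin.ext (by simpa using h'))
      have : ¬ l < 1 := by rw [Fin.lt_def, Fin.val_one]; omega
      simp [low, *]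

theorem bracketHom_block (i : Fin (m + 2)) (hi : 2 ≤ (i : ℕ)) (a : Fˣ) :
    bracketHom i a 0 = bracketHom i a 1 := by
  have h0 : 0 < i := Fin.lt_def.2 (by rw [Fin.val_zero]; omega)
  have h1 : 1 < i := Fin.lt_def.2 (by rw [Fin.val_one]; omega)
  simp [bracketHom_apply, low, h0, h1, h0.ne, h1.ne, Pi.mulSingle_eq_of_ne]

/-- The Steinberg relation at the first two places. The matrices `A_{i,n}` with `i ≥ 2` centralize
the image of `GL₂(F)`, and in their centralizer the relation in `H₂(GL₂(F))` can be multiplied by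
them. -/
theorem bracket_eq_zero [Infinite F] (a : Fin (m + 2) → Fˣ) (h : (a 0 : F) + a 1 = 1) :
    bracket a = 0 := by
  set A : Fin (m + 2) → GL (Fin (m + 2)) F := fun i => diagGL F (m + 2) (bracketHom i (a i)) with hA
  have hAc : ∀ i j, Commute (A i) (A j) := fun _ _ => (Commute.all _ _).map _
  have e : bracket a = barClass A hAc := by
    rw [bracket_eq]; rfl
  set S := Subgroup.centralizer {x | ∃ i : Fin (m + 2), 2 ≤ (i : ℕ) ∧ x = A i} with hS
  have hAS : ∀ i, A i ∈ S := fun i => by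
    rw [hS, Subgroup.mem_centralizer_iff]
    rintro _ ⟨j, -, rfl⟩
    exact hAc _ _
  have hBS : ∀ g, blockGL F m g ∈ S := fun g => by
    rw [hS, Subgroup.mem_centralizer_iff]
    rintro _ ⟨j, hj, rfl⟩
    exact commute_diagGL_blockGL _ (bracketHom_block j hj _) g
  -- the cyclic shift which moves the first two places to the end
  set ρ : Equiv.Perm (Fin (m + 2)) := Equiv.addRight 2 with hρ
  have ρ1 : ρ (Fin.last m).castSucc = 0 := by
    ext; simp [hρ, Fin.val_add]
  have ρ2 : ρ (Fin.last (m + 1)) = 1 := by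
    ext
    rw [hρ, Equiv.coe_addRight, Fin.val_add, Fin.val_last]
    change (m + 1 + 2 % (m + 2)) % (m + 2) = 1 % (m + 2)
    rw [Nat.add_mod_mod, show m + 1 + 2 = 1 + (m + 2) by omega, Nat.add_mod_right]
  have ρ3 : ∀ i : Fin m, 2 ≤ (ρ i.castSucc.castSucc : ℕ) := by
    intro i
    have := i.2
    rw [hρ, Equiv.coe_addRight, Fin.val_add]
    change 2 ≤ ((i : ℕ) + 2 % (m + 2)) % (m + 2)
    rw [Nat.add_mod_mod, Nat.mod_eq_of_lt (by omega)]
    omega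
  have key : chain (fun k => (⟨A (ρ k), hAS _⟩ : S)) ∈ boundaries S (m + 2) := by
    refine chain_mem_boundaries_of_central m _ (fun i x => ?_) ?_
    · exact Subtype.ext (Subgroup.mem_centralizer_iff.1 x.2 _ ⟨_, ρ3 i, rfl⟩)
    · have h2 := mapChain_mem_boundaries ((blockGL F m).codRestrict S hBS)
        (chain_dg_mem_boundaries h)
      rw [mapChain_chain] at h2
      convert h2 using 2
      funext k
      fin_cases k
      · refine Subtype.ext ?_
        change A (ρ (Fin.last m).castSucc) = blockGL F m (dg (a 0) 1)
        rw [ρ1]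
        exact bracketHom_zero _
      · refine Subtype.ext ?_
        change A (ρ (Fin.last (m + 1))) = blockGL F m (dg (a 1) (a 1)⁻¹)
        rw [ρ2]
        exact bracketHom_one _
  have h3 := mapChain_mem_boundaries S.subtype key
  rw [mapChain_chain] at h3
  have h4 := barClass_perm A hAc ρ
  rw [barClass_eq_zero (A ∘ ρ) _ h3] at h4
  rw [e]
  rcases Int.units_eq_one_or (Equiv.Perm.sign ρ) with h | h
  · simpa [h] using h4.symm
  · simpa [h] using h4.symm

theorem bracket_eq_zero_of_adjacent [Infinite F] {n : ℕ} (a : Fin n → Fˣ) (i j : Fin n)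
    (hij : (j : ℕ) = i + 1) (h : (a i : F) + a j = 1) : bracket a = 0 := by
  obtain ⟨m, rfl⟩ : ∃ m, n = m + 2 := ⟨n - 2, by omega⟩
  have hne : i ≠ j := by rintro rfl; omega
  -- a permutation which moves the places `0, 1` to `i, j`
  set j' := Equiv.swap 0 i j with hj'
  have hj0 : j' ≠ 0 := fun h0 => by
    have : Equiv.swap 0 i j' = j := Equiv.swap_apply_self 0 i j
    rw [h0, Equiv.swap_apply_left] at this
    exact hne this
  set σ : Equiv.Perm (Fin (m + 2)) := Equiv.swap 0 i * Equiv.swap 1 j' with hσ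
  have h1 : σ 0 = i := by
    rw [hσ, Equiv.Perm.mul_apply, Equiv.swap_apply_of_ne_of_ne (by simp) hj0.symm,
      Equiv.swap_apply_left]
  have h2 : σ 1 = j := by simp [hσ, hj']
  have h3 := bracket_perm a σ
  rw [bracket_eq_zero (a ∘ σ) (by simpa [h1, h2] using h)] at h3
  rcases Int.units_eq_one_or (Equiv.Perm.sign σ) with h | h
  · simpa [h] using h3.symm
  · simpa [h] using h3.symm

end Steinberg

/-! ### The homomorphism on Milnor `K`-theory -/

namespace MilnorK

variable {F : Type u} [Field F] {n : ℕ}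

/-- The homomorphism `{a₁, …, aₙ} ↦ [a₁, …, aₙ]`. -/
noncomputable def toHomology (F : Type u) [Field F] [Infinite F] (n : ℕ) :
    MilnorK F n →ₗ[ℤ] integralHomology (GL (Fin n) F) n :=
  (steinberg F n).liftQ (PiTensorProduct.lift (bracketMap F n)) <| by
    rw [steinberg, Submodule.span_le]
    rintro _ ⟨a, i, j, hij, h, rfl⟩
    rw [SetLike.mem_coe, LinearMap.mem_ker, PiTensorProduct.lift.tprod, ← bracket_eq]
    exact bracket_eq_zero_of_adjacent a i j hij h

theorem toHomology_symbol [Infinite F] (a : Fin n → Fˣ) :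
    toHomology F n (symbol a) = bracket a := by
  rw [bracket_eq]
  change PiTensorProduct.lift (bracketMap F n)
    (PiTensorProduct.tprod ℤ fun l => Additive.ofMul (a l)) = _
  rw [PiTensorProduct.lift.tprod]

theorem addHom_ext {M : Type*} [AddCommGroup M] {f g : MilnorK F n →+ M}
    (h : ∀ a : Fin n → Fˣ, f (symbol a) = g (symbol a)) : f = g := by
  suffices e : f.toIntLinearMap = g.toIntLinearMap from
    AddMonoidHom.ext fun x => LinearMap.congr_fun e x
  refine Submodule.linearMap_qext _ (PiTensorProduct.ext (MultilinearMap.ext fun a => ?_))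
  exact h fun i => (a i).toMul

end MilnorK

/-! ### Connecting homomorphisms and chains of commuting elements with coefficients -/

namespace BarClass

open CategoryTheory groupHomology

variable {G : Type u} [Group G] {n : ℕ}

/-- The chain `∑_σ sign(σ) [g_{σ(1)} | ⋯ | g_{σ(n)}] ⊗ m` as a linear function of `m`. -/
noncomputable def coefChain (A : Rep.{u} LiftedInt.{u} G) (g : Fin n → G) :
    A →ₗ[LiftedInt.{u}] ((Fin n → G) →₀ A) :=
  ∑ σ : Equiv.Perm (Fin n), ((Equiv.Perm.sign σ : ℤ) : LiftedInt.{u}) • Finsupp.lsingle (g ∘ σ)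

theorem coefChain_apply (A : Rep.{u} LiftedInt.{u} G) (g : Fin n → G) (m : A) :
    coefChain A g m = ∑ σ : Equiv.Perm (Fin n), ((Equiv.Perm.sign σ : ℤ) : LiftedInt.{u}) •
      Finsupp.single (g ∘ σ) m := by
  simp [coefChain]

/-- The inner faces cancel in pairs, and the last faces agree with the first ones up to the action on
the coefficients. -/
theorem d_coefChain (A : Rep.{u} LiftedInt.{u} G) (g : Fin (n + 1) → G)
    (hg : ∀ i j, Commute (g i) (g j)) (m : A) :
    inhomogeneousChains.d A n (coefChain A g m) =
      ∑ σ : Equiv.Perm (Fin (n + 1)), ((Equiv.Perm.sign σ : ℤ) : LiftedInt.{u}) •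
        Finsupp.single (fun i => g (σ i.succ)) (A.ρ (g (σ 0))⁻¹ m - m) := by
  rw [coefChain_apply, map_sum]
  have e : ∀ σ : Equiv.Perm (Fin (n + 1)), inhomogeneousChains.d A n
      (((Equiv.Perm.sign σ : ℤ) : LiftedInt.{u}) • Finsupp.single (g ∘ σ) m) =
      (((Equiv.Perm.sign σ : ℤ) : LiftedInt.{u}) •
          Finsupp.single (fun i => g (σ i.succ)) (A.ρ (g (σ 0))⁻¹ m) +
        (-1 : LiftedInt.{u}) ^ (n + 1) • ((Equiv.Perm.sign σ : ℤ) : LiftedInt.{u}) •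
          Finsupp.single (fun i => g (σ i.castSucc)) m) +
      ∑ j : Fin n, (-1 : LiftedInt.{u}) ^ ((j : ℕ) + 1) • ((Equiv.Perm.sign σ : ℤ) : LiftedInt.{u}) •
        Finsupp.single (Fin.contractNth j.castSucc (· * ·) (g ∘ σ)) m := by
    intro σ
    rw [map_smul, inhomogeneousChains.d_single, Fin.sum_univ_castSucc]
    have : Fin.contractNth (Fin.last n) (· * ·) (g ∘ σ) = fun i => g (σ i.castSucc) := by
      funext k
      rw [Fin.contractNth_apply_of_lt _ _ _ _ (by simp)]
      rfl
    rw [this, add_comm (Finset.sum _ _), ← add_assoc, smul_add, smul_add, Finset.smul_sum,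
      Fin.val_last, smul_comm ((-1 : LiftedInt.{u}) ^ (n + 1))]
    congr 1
    refine Finset.sum_congr rfl fun j _ => ?_
    rw [smul_comm, Fin.val_castSucc]
  rw [Finset.sum_congr rfl (fun σ _ => e σ), Finset.sum_add_distrib, Finset.sum_comm]
  have z : ∀ j : Fin n, ∑ σ : Equiv.Perm (Fin (n + 1)), (-1 : LiftedInt.{u}) ^ ((j : ℕ) + 1) •
        ((Equiv.Perm.sign σ : ℤ) : LiftedInt.{u}) •
        Finsupp.single (Fin.contractNth j.castSucc (· * ·) (g ∘ σ)) m = 0 := by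
    intro j
    rw [← Finset.smul_sum]
    have ne : j.castSucc ≠ j.succ := (Fin.castSucc_lt_succ (i := j)).ne
    rw [Finset.sum_involution (fun σ _ => σ * Equiv.swap j.castSucc j.succ), smul_zero]
    · intro σ _
      have : g ∘ ⇑(σ * Equiv.swap j.castSucc j.succ) =
        (g ∘ σ) ∘ Equiv.swap j.castSucc j.succ := rfl
      rw [this, contractNth_swap j (g ∘ σ) (hg _ _), ← add_smul]
      simp [Equiv.Perm.sign_swap ne]
    · intro σ _ _ h
      exact ne (Equiv.swap_eq_one_iff.1 (mul_eq_left.1 h))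
    · intro σ _; exact Finset.mem_univ _
    · intro σ _; simp [mul_assoc]
  have r : ∑ σ : Equiv.Perm (Fin (n + 1)), ((Equiv.Perm.sign σ : ℤ) : LiftedInt.{u}) •
      Finsupp.single (fun i : Fin n => g (σ i.castSucc)) m =
      (-1 : LiftedInt.{u}) ^ n • ∑ σ : Equiv.Perm (Fin (n + 1)),
        ((Equiv.Perm.sign σ : ℤ) : LiftedInt.{u}) •
        Finsupp.single (fun i : Fin n => g (σ i.succ)) m := by
    -- the cyclic rotation of the entries turns the last face into the first one
    rw [← Equiv.sum_comp (Equiv.mulRight (finRotate (n + 1))), Finset.smul_sum]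
    refine Finset.sum_congr rfl fun σ _ => ?_
    simp [sign_finRotate, mul_comm, smul_smul]
  rw [Finset.sum_eq_zero (fun j _ => z j), add_zero, Finset.sum_add_distrib, ← Finset.smul_sum,
    r, smul_smul, pow_succ, mul_assoc, mul_comm (-1 : LiftedInt.{u}), ← mul_assoc, ← pow_add,
    Even.neg_one_pow ⟨n, rfl⟩, one_mul, neg_one_smul, ← Finset.sum_neg_distrib,
    ← Finset.sum_add_distrib]
  refine Finset.sum_congr rfl fun σ _ => ?_
  rw [← smul_neg, ← smul_add, ← Finsupp.single_neg, ← Finsupp.single_add, sub_eq_add_neg]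

theorem d_coefChain_of_fixed_succ (A : Rep.{u} LiftedInt.{u} G) (g : Fin (n + 1) → G)
    (hg : ∀ i j, Commute (g i) (g j)) (m : A) (hm : ∀ k : Fin n, A.ρ (g k.succ)⁻¹ m = m) :
    inhomogeneousChains.d A n (coefChain A g m) =
      coefChain A (Fin.tail g) (A.ρ (g 0)⁻¹ m - m) := by
  rw [d_coefChain A g hg, coefChain_apply, ← Equiv.Perm.decomposeFin.symm.sum_comp,
    Fintype.sum_prod_type, Fin.sum_univ_succ]
  refine (congrArg₂ (· + ·) (Finset.sum_congr rfl fun σ _ => ?_)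
    (Finset.sum_eq_zero fun k _ => Finset.sum_eq_zero fun σ _ => ?_)).trans (add_zero _)
  · simp only [Equiv.Perm.decomposeFin_symm_apply_zero, Equiv.Perm.decomposeFin.symm_sign,
      if_true, one_mul, Equiv.Perm.decomposeFin_symm_apply_succ, Equiv.swap_self, Equiv.refl_apply]
    rfl
  · rw [Equiv.Perm.decomposeFin_symm_apply_zero, hm, sub_self, Finsupp.single_zero, smul_zero]

/-- The homology class of a cycle. -/
noncomputable def mkClass {A : Rep.{u} LiftedInt.{u} G} {x : (Fin n → G) →₀ A}
    (hx : (inhomogeneousChains A).d n ((ComplexShape.down ℕ).next n) x = 0) : groupHomology A n :=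
  groupHomology.π A n (cyclesMk n _ rfl x hx)

theorem cyclesMk_eq {A : Rep.{u} LiftedInt.{u} G} (j : ℕ) (h : (ComplexShape.down ℕ).next n = j)
    {x : (Fin n → G) →₀ A} (hx : (inhomogeneousChains A).d n j x = 0) :
    cyclesMk n j h x hx = cyclesMk n _ rfl x (by rw [h]; exact hx) := by
  subst h; rfl

/-- The connecting homomorphism on the classes of commuting elements with coefficients in `m`, in
the case that all the elements but the first fix a lift `y` of `m`. -/
theorem exists_δ_mkClass {X : ShortComplex (Rep.{u} LiftedInt.{u} G)} (hX : X.ShortExact)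
    (g : Fin (n + 1) → G) (hg : ∀ i j, Commute (g i) (g j)) (z : X.X₃) (y : X.X₂) (x : X.X₁)
    (hy : X.g.hom y = z) (hm : ∀ k : Fin n, X.X₂.ρ (g k.succ)⁻¹ y = y)
    (hx : X.f.hom x = X.X₂.ρ (g 0)⁻¹ y - y)
    (hz : (inhomogeneousChains X.X₃).d (n + 1) ((ComplexShape.down ℕ).next (n + 1))
      (coefChain X.X₃ g z) = 0) :
    ∃ hx : (inhomogeneousChains X.X₁).d n ((ComplexShape.down ℕ).next n)
      (coefChain X.X₁ (Fin.tail g) x) = 0,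
      groupHomology.δ hX (n + 1) n rfl (mkClass hz) = mkClass hx := by
  have hnext : (ComplexShape.down ℕ).next (n + 1) = n := by simp
  have hz' : (inhomogeneousChains X.X₃).d (n + 1) n (coefChain X.X₃ g z) = 0 := by
    rw [hnext] at hz; exact hz
  have hx' : Finsupp.mapRange.linearMap X.f.hom.toLinearMap (coefChain X.X₁ (Fin.tail g) x) =
      (inhomogeneousChains X.X₂).d (n + 1) n (coefChain X.X₂ g y) := by
    rw [inhomogeneousChains.d_def, d_coefChain_of_fixed_succ X.X₂ g hg y hm, ← hx]
    simp only [coefChain_apply, map_sum, map_smul]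
    refine Finset.sum_congr rfl fun σ _ => ?_
    simp
  have hy' : (chainsMap (MonoidHom.id G) X.g).f (n + 1) (coefChain X.X₂ g y) =
      coefChain X.X₃ g z := by
    rw [← hy]
    simp only [coefChain_apply, map_sum, map_smul]
    refine Finset.sum_congr rfl fun σ _ => ?_
    simp
  have := groupHomology.δ_apply hX rfl (coefChain X.X₃ g z) hz' (coefChain X.X₂ g y) hy'
    (coefChain X.X₁ (Fin.tail g) x) hx'
  rw [cyclesMk_eq n hnext] at this
  exact ⟨_, this⟩

end BarClass

/-! ### Suslin's map on classes of commuting elements -/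

namespace GenChain

open CategoryTheory groupHomology BarClass

variable {F : Type u} [Field F] {n : ℕ}

/-- The iterated connecting homomorphism on the class of the commuting elements `g₀, g₁, …`: in
each step the coefficient `∂ y_q` is lifted to `y_q`, and the lift is fixed by all the remaining
elements but the first. -/
theorem exists_edge_mkClass [Infinite F] (g : ℕ → GL (Fin n) F)
    (hg : ∀ i j, Commute (g i) (g j)) (y : ∀ q, GenChain F n (q + 1)) (m : ℕ)
    (hfix : ∀ q k, q < k → k < m → rho F n (q + 1) (g k)⁻¹ (y q) = y q)
    (hstep : ∀ q, q < m →
      bd F n (q + 1) (y (q + 1)) = rho F n (q + 1) (g q)⁻¹ (y q) - y q)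
    (h0 : (inhomogeneousChains (cycRep F n 0)).d m ((ComplexShape.down ℕ).next m)
      (coefChain (cycRep F n 0) (fun k : Fin m => g k)
        (⟨bd F n 0 (y 0), bd_mem_cyc 0 _⟩ : cyc F n 0)) = 0) :
    ∀ (q i : ℕ) (h : i + q = m),
      ∃ hx : (inhomogeneousChains (cycRep F n q)).d i ((ComplexShape.down ℕ).next i)
        (coefChain (cycRep F n q) (fun k : Fin i => g (q + k))
          (⟨bd F n q (y q), bd_mem_cyc q _⟩ : cyc F n q)) = 0,
        edge F n q i m h (mkClass h0) = mkClass hx := by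
  intro q
  induction q with
  | zero =>
    rintro i rfl
    simp only [Nat.zero_add]
    exact ⟨h0, rfl⟩
  | succ q ih =>
    intro i h
    obtain ⟨hz, e⟩ := ih (i + 1) (by omega)
    have key := exists_δ_mkClass (shortComplex_shortExact F n q)
      (fun k : Fin (i + 1) => g (q + k)) (fun _ _ => hg _ _)
      (⟨bd F n q (y q), bd_mem_cyc q _⟩ : cyc F n q) (y q)
      (⟨bd F n (q + 1) (y (q + 1)), bd_mem_cyc (q + 1) _⟩ : cyc F n (q + 1)) rfl
      (fun k => hfix q _ (by simp) (by rw [Fin.val_succ]; omega)) (hstep q (by omega)) hz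
    have ht : Fin.tail (fun k : Fin (i + 1) => g (q + k)) = fun k : Fin i => g (q + 1 + k) := by
      funext k
      simp only [Fin.tail, Fin.val_succ]
      congr 1
      omega
    rw [ht] at key
    obtain ⟨hx, e'⟩ := key
    exact ⟨hx, (congrArg (groupHomology.δ (shortComplex_shortExact F n q) (i + 1) i rfl)
      e).trans e'⟩

theorem mkClass_coefChain_zero {G : Type u} [Group G] (A : Rep.{u} LiftedInt.{u} G)
    (g : Fin 0 → G) (m : A)
    (hx : (inhomogeneousChains A).d 0 ((ComplexShape.down ℕ).next 0) (coefChain A g m) = 0) :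
    mkClass hx = H0π A m := by
  have e : coefChain A g m = (chainsIso₀ A).inv m := by
    rw [coefChain_apply, Fintype.sum_subsingleton _ 1, Equiv.Perm.sign_one, Units.val_one,
      Int.cast_one, one_smul, Subsingleton.elim (g ∘ _) default]
    rfl
  have h := cyclesMk₀_eq A m
  refine congrArg (π A 0) ?_
  refine Eq.trans ?_ h
  apply (ModuleCat.mono_iff_injective (iCycles A 0)).1 inferInstance
  exact (iCycles_mk _ _ _).trans (e.trans (iCycles_mk _ _ _).symm)

/-- The empty sequence of vectors, the generator of `C_0(Fⁿ)`. -/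
def emptyTuple (F : Type u) [Field F] (n : ℕ) : GenTuple F n 0 :=
  ⟨Fin.elim0, fun s _ => by
    have : s = ∅ := Subsingleton.elim _ _
    subst this; simp⟩

/-- The class of commuting elements in `Hₙ(GLₙ(F), Z_0(Fⁿ))` has the empty sequence as coefficient. -/
theorem exists_map_augment_barClass (g : Fin n → GL (Fin n) F)
    (hg : ∀ i j, Commute (g i) (g j)) (z : cyc F n 0)
    (hz : z.1 = Finsupp.single (emptyTuple F n) 1) :
    ∃ hx : (inhomogeneousChains (cycRep F n 0)).d n ((ComplexShape.down ℕ).next n)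
        (coefChain (cycRep F n 0) g z) = 0,
      groupHomology.map (MonoidHom.id (GL (Fin n) F)) (augment F n) n (barClass g hg) =
        mkClass hx := by
  have hz' : (augment F n).hom (1 : LiftedInt.{u}) = z := Subtype.ext hz.symm
  have e : (chainsMap (MonoidHom.id (GL (Fin n) F)) (augment F n)).f n (chain g) =
      coefChain (cycRep F n 0) g z := by
    rw [chain, map_sum, coefChain_apply]
    refine Finset.sum_congr rfl fun σ _ => ?_
    have : (Finsupp.single (g ∘ σ) ((Equiv.Perm.sign σ : ℤ) : LiftedInt.{u})) =
      ((Equiv.Perm.sign σ : ℤ) : LiftedInt.{u}) • Finsupp.single (g ∘ σ) (1 : LiftedInt.{u}) := by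
      rw [Finsupp.smul_single, smul_eq_mul, mul_one]
    rw [this, map_smul]
    congr 1
    refine (chainsMap_f_single _ _ _ _ _).trans ?_
    rw [← hz']
    rfl
  have hx : (inhomogeneousChains (cycRep F n 0)).d n ((ComplexShape.down ℕ).next n)
        (coefChain (cycRep F n 0) g z) = 0 := by
    rw [← e]
    have h := (chainsMap (B := cycRep F n 0) (MonoidHom.id (GL (Fin n) F)) (augment F n)).comm n
      ((ComplexShape.down ℕ).next n)
    have h' := ConcreteCategory.congr_hom h (chain g)
    refine h'.trans ?_
    exact (congrArg ((chainsMap (B := cycRep F n 0) (MonoidHom.id (GL (Fin n) F))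
      (augment F n)).f _).hom (d_chain_next g hg)).trans (map_zero _)
  refine ⟨hx, ?_⟩
  have h1 := ConcreteCategory.congr_hom (π_map (A := Rep.trivial LiftedInt.{u} (GL (Fin n) F) LiftedInt.{u})
    (B := cycRep F n 0) (MonoidHom.id (GL (Fin n) F)) (augment F n) n)
    (cyclesMk n _ rfl (chain g) (d_chain_next g hg))
  refine h1.trans (congrArg (π (cycRep F n 0) n) ?_)
  apply (ModuleCat.mono_iff_injective (iCycles (cycRep F n 0) n)).1 inferInstance
  have h2 := ConcreteCategory.congr_hom
    (HomologicalComplex.cyclesMap_i (chainsMap (B := cycRep F n 0)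
      (MonoidHom.id (GL (Fin n) F)) (augment F n)) n)
    (cyclesMk n _ rfl (chain g) (d_chain_next g hg))
  have h3 := congrArg ((chainsMap (B := cycRep F n 0) (MonoidHom.id (GL (Fin n) F))
    (augment F n)).f n).hom (iCycles_mk rfl (chain g) (d_chain_next g hg))
  exact (h2.trans h3).trans (e.trans (iCycles_mk rfl _ hx).symm)

/-- Suslin's map on the class of commuting elements `g₀, …, gₙ₋₁`, in terms of lifts `y_q` of the
successive coefficients: `∂ y₀` is the empty sequence, `∂ y_{q+1} = g_q⁻¹ y_q - y_q`, and `y_q` is fixed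
by `g_k` for `k > q`. -/
theorem suslinMap_barClass [Infinite F] (g : ℕ → GL (Fin n) F)
    (hg : ∀ i j, Commute (g i) (g j)) (y : ∀ q, GenChain F n (q + 1))
    (hzero : bd F n 0 (y 0) = Finsupp.single (emptyTuple F n) 1)
    (hfix : ∀ q k, q < k → k < n → rho F n (q + 1) (g k)⁻¹ (y q) = y q)
    (hstep : ∀ q, q < n →
      bd F n (q + 1) (y (q + 1)) = rho F n (q + 1) (g q)⁻¹ (y q) - y q) :
    suslinMap F n (barClass (fun k : Fin n => g k) fun _ _ => hg _ _) =
      (-1 : ℤ) ^ (n * (n + 1) / 2) • symb F n (y n) := by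
  obtain ⟨h0, e0⟩ := exists_map_augment_barClass (fun k : Fin n => g k) (fun _ _ => hg _ _)
    ⟨bd F n 0 (y 0), bd_mem_cyc 0 _⟩ hzero
  obtain ⟨hx, e⟩ := exists_edge_mkClass g hg y n hfix hstep h0 n 0 (Nat.zero_add n)
  rw [mkClass_coefChain_zero, ← e0] at e
  rw [suslinMap_apply, ← cycSymb_bd, ← coinvSymb_H0π]
  congr 2

end GenChain

/-! ### Suslin's map on diagonal matrices -/

namespace GenChain

variable {F : Type u} [Field F] {n : ℕ}

/-- The `j`-th vector of the sequence `(u₀e₀, …, uₙ₋₁eₙ₋₁, ∑ eᵢ)`; the sum is also the value for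
`j > n`. Diagonal matrices are indexed by `ℕ` here, so that all the sequences of at most `n + 1`
vectors are treated alike. -/
def frameVec (n : ℕ) (u : ℕ → Fˣ) (j : ℕ) : Fin n → F :=
  if h : j < n then Pi.single ⟨j, h⟩ (u j : F) else 1

theorem frameVec_congr {u v : ℕ → Fˣ} {j : ℕ} (h : u j = v j) :
    frameVec n u j = frameVec n v j := by
  unfold frameVec
  split_ifs
  · rw [h]
  · rfl

theorem inGeneralPosition_frameVec (u : ℕ → Fˣ) {p : ℕ} (hp : p ≤ n + 1) :
    InGeneralPosition fun j : Fin p => frameVec n u j := by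
  suffices h : InGeneralPosition fun j : Fin (n + 1) => frameVec n u j from
    inGeneralPosition_comp h (Fin.castLE hp) (Fin.castLE_injective hp)
  classical
  intro s hs
  rw [linearIndepOn_finset_iff]
  intro c hc
  set d : Fin (n + 1) → F := fun j => if j ∈ s then c j else 0 with hd
  have hsum : ∑ j, d j • frameVec n u j = 0 := by
    rw [← hc, ← Finset.sum_subset (Finset.subset_univ s)]
    · exact Finset.sum_congr rfl fun j hj => by simp [hd, hj]
    · intro j _ hj; simp [hd, hj]
  have hi : ∀ i : Fin n, d i.castSucc * u i + d (Fin.last n) = 0 := by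
    intro i
    have h := congrFun hsum i
    rw [Fin.sum_univ_castSucc] at h
    simpa [frameVec, Pi.single_apply] using h
  have hlast : d (Fin.last n) = 0 := by
    obtain ⟨j, hj⟩ : ∃ j, j ∉ s := by
      by_contra! h
      have : s = Finset.univ := Finset.eq_univ_iff_forall.2 h
      rw [this, Finset.card_univ, Fintype.card_fin] at hs
      omega
    have hj' : d j = 0 := by simp [hd, hj]
    rcases Fin.eq_castSucc_or_eq_last j with ⟨i, rfl⟩ | rfl
    · simpa [hj'] using hi i
    · exact hj'
  intro j hj
  have : d j = 0 := by
    rcases Fin.eq_castSucc_or_eq_last j with ⟨i, rfl⟩ | rfl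
    · simpa [hlast] using hi i
    · exact hlast
  simpa [hd, hj] using this

open Classical in
/-- The sequence of the first `p` vectors of `(u₀e₀, …, uₙ₋₁eₙ₋₁, ∑ eᵢ)`, as a chain
(and `0` for `p > n + 1`). -/
noncomputable def frame (n p : ℕ) (u : ℕ → Fˣ) : GenChain F n p :=
  if h : InGeneralPosition fun j : Fin p => frameVec n u j then Finsupp.single ⟨_, h⟩ 1 else 0

theorem frame_eq {p : ℕ} (hp : p ≤ n + 1) (u : ℕ → Fˣ) :
    frame n p u = Finsupp.single ⟨_, inGeneralPosition_frameVec u hp⟩ 1 :=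
  dif_pos _

theorem frame_congr {p : ℕ} {u v : ℕ → Fˣ} (h : ∀ j < p, u j = v j) :
    frame n p u = frame n p v := by
  have e : (fun j : Fin p => frameVec n u j) = fun j : Fin p => frameVec n v j :=
    funext fun j => frameVec_congr (h j j.2)
  classical
  exact congrArg (fun w : Fin p → Fin n → F =>
    if h : InGeneralPosition w then (Finsupp.single ⟨w, h⟩ 1 : GenChain F n p) else 0) e

theorem rho_frame {p : ℕ} (hp : p ≤ n) (t u : ℕ → Fˣ) :
    rho F n p (diagGL F n fun i => t i) (frame n p u) = frame n p (t * u) := by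
  rw [frame_eq (by omega), frame_eq (by omega), rho_single]
  congr 1
  refine Subtype.ext (funext fun j => ?_)
  change (diagGL F n fun i => t i).1.mulVec (frameVec n u j) = frameVec n (t * u) j
  rw [val_diagGL]
  have hj : (j : ℕ) < n := by omega
  funext i
  rw [Matrix.mulVec_diagonal]
  simp only [frameVec, hj, dif_pos, Pi.single_apply, Pi.mul_apply, Units.val_mul, mul_ite, mul_zero]
  split_ifs with h
  · rw [h]
  · rfl

/-- The linear extension of a function on the group of diagonal matrices to its group ring. The group
ring keeps track of the coordinates formally; it does not act on the sequences that contain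
`∑ eᵢ`, as this vector is not to be moved. -/
noncomputable def extend {M : Type*} [AddCommGroup M] [Module LiftedInt.{u} M]
    (f : (ℕ → Fˣ) → M) : MonoidAlgebra LiftedInt.{u} (ℕ → Fˣ) →ₗ[LiftedInt.{u}] M :=
  Finsupp.linearCombination LiftedInt.{u} f ∘ₗ
    (MonoidAlgebra.coeffLinearEquiv LiftedInt.{u}).toLinearMap

section extend

variable {M N : Type*} [AddCommGroup M] [Module LiftedInt.{u} M] [AddCommGroup N]
  [Module LiftedInt.{u} N] (f : (ℕ → Fˣ) → M)

theorem groupRing_ext {f g : MonoidAlgebra LiftedInt.{u} (ℕ → Fˣ) →ₗ[LiftedInt.{u}] M}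
    (h : ∀ t, f (.single t 1) = g (.single t 1)) : f = g :=
  MonoidAlgebra.lhom_ext' fun t => LinearMap.ext_ring (h t)

theorem extend_single (t : ℕ → Fˣ) : extend f (.single t 1) = f t := by
  simp [extend]

theorem map_extend (L : M →ₗ[LiftedInt.{u}] N) (x : MonoidAlgebra LiftedInt.{u} (ℕ → Fˣ)) :
    L (extend f x) = extend (fun t => L (f t)) x := by
  suffices h : L ∘ₗ extend f = extend fun t => L (f t) from LinearMap.congr_fun h x
  refine groupRing_ext fun t => ?_
  rw [LinearMap.comp_apply, extend_single, extend_single]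

theorem extend_single_mul (t : ℕ → Fˣ) (x : MonoidAlgebra LiftedInt.{u} (ℕ → Fˣ)) :
    extend f (.single t 1 * x) = extend (fun s => f (t * s)) x := by
  suffices h : extend f ∘ₗ LinearMap.mulLeft LiftedInt.{u} (.single t 1) =
    extend fun s => f (t * s) from LinearMap.congr_fun h x
  refine groupRing_ext fun s => ?_
  rw [LinearMap.comp_apply, LinearMap.mulLeft_apply, MonoidAlgebra.single_mul_single, mul_one,
    extend_single, extend_single]

/-- The element `∏_{k < q} (t_k⁻¹ - 1)` of the group ring, where `t_k` is `a_k` at the `k`-th place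
and `1` elsewhere. -/
noncomputable def diffProd (a : ℕ → Fˣ) (q : ℕ) : MonoidAlgebra LiftedInt.{u} (ℕ → Fˣ) :=
  ∏ k ∈ Finset.range q, (.single (Pi.mulSingle k (a k))⁻¹ 1 - 1)

theorem diffProd_succ (a : ℕ → Fˣ) (q : ℕ) :
    diffProd a (q + 1) = (.single (Pi.mulSingle q (a q))⁻¹ 1 - 1) * diffProd a q := by
  rw [diffProd, Finset.prod_range_succ, mul_comm]; rfl

theorem extend_sub_one_mul (t : ℕ → Fˣ) (x : MonoidAlgebra LiftedInt.{u} (ℕ → Fˣ)) :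
    extend f ((.single t 1 - 1) * x) = extend (fun s => f (t * s)) x - extend f x := by
  rw [sub_mul, one_mul, map_sub, extend_single_mul]

/-- A function which does not depend on the `k`-th coordinate is killed by the factor `t_k⁻¹ - 1`. -/
theorem extend_diffProd_eq_zero (a : ℕ → Fˣ) {k q : ℕ} (hk : k < q)
    (h : ∀ s, f ((Pi.mulSingle k (a k))⁻¹ * s) = f s) : extend f (diffProd a q) = 0 := by
  rw [diffProd, ← Finset.mul_prod_erase _ _ (Finset.mem_range.2 hk), extend_sub_one_mul]
  simp only [h, sub_self]

end extend

theorem neg_one_pow_smul {M : Type*} [AddCommGroup M] [Module LiftedInt.{u} M] (k : ℕ) (x : M) :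
    (-1 : LiftedInt.{u}) ^ k • x = (-1 : ℤ) ^ k • x := by
  rcases Nat.even_or_odd k with h | h <;> simp [h.neg_one_pow]

theorem mulSingle_inv_mul_apply_of_ne (a : ℕ → Fˣ) (s : ℕ → Fˣ) {k j : ℕ} (h : j ≠ k) :
    ((Pi.mulSingle k (a k) : ℕ → Fˣ)⁻¹ * s) j = s j := by
  simp [Pi.mulSingle_eq_of_ne h]

/-- The only face that survives is the last one: the `k`-th face does not depend on the `k`-th
coordinate. -/
theorem bd_extend_frame (a : ℕ → Fˣ) {q : ℕ} (hq : q ≤ n) :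
    bd F n q (extend (frame n (q + 1)) (diffProd a q)) =
      (-1 : ℤ) ^ q • extend (frame n q) (diffProd a q) := by
  have hp : q + 1 ≤ n + 1 := by omega
  set φ : Fin q → (ℕ → Fˣ) → GenChain F n q := fun k t =>
    Finsupp.single (face ⟨_, inGeneralPosition_frameVec t hp⟩ k.castSucc) 1 with hφ
  have key : bd F n q ∘ₗ extend (frame n (q + 1)) =
      ∑ k : Fin q, (-1 : LiftedInt.{u}) ^ (k : ℕ) • extend (φ k) +
        (-1 : LiftedInt.{u}) ^ q • extend (frame n q) := by
    refine groupRing_ext fun t => ?_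
    rw [LinearMap.comp_apply, extend_single, frame_eq hp, bd_single, Fin.sum_univ_castSucc,
      LinearMap.add_apply, LinearMap.sum_apply]
    simp only [LinearMap.smul_apply, extend_single, Fin.val_castSucc, Fin.val_last]
    congr 2
    rw [frame_eq (by omega)]
    congr 1
    refine Subtype.ext (funext fun j => ?_)
    simp [face]
  have h := LinearMap.congr_fun key (diffProd a q)
  rw [LinearMap.comp_apply, LinearMap.add_apply, LinearMap.sum_apply, Finset.sum_eq_zero,
    zero_add, LinearMap.smul_apply, neg_one_pow_smul] at h
  · exact h
  · intro k _
    rw [LinearMap.smul_apply, extend_diffProd_eq_zero _ a k.2, smul_zero]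
    intro s
    simp only [hφ]
    congr 1
    refine Subtype.ext (funext fun j => ?_)
    refine frameVec_congr (mulSingle_inv_mul_apply_of_ne a s fun h => ?_)
    exact Fin.succAbove_ne k.castSucc j (Fin.ext h)

theorem symb_frame (u : ℕ → Fˣ) :
    symb F n (frame n (n + 1) u) = MilnorK.symbol fun i : Fin n => (u i)⁻¹ := by
  rw [frame_eq le_rfl, symb_single]
  congr 1
  refine coords_eq _ _ ?_
  funext i
  simp [frameVec, Pi.single_apply]

/-- By multilinearity of the symbol, the factor `t_q⁻¹ - 1` replaces the `q`-th entry by `a_q`. -/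
theorem extend_symbol_diffProd (a : ℕ → Fˣ) : ∀ (q : ℕ), q ≤ n → ∀ v : ℕ → Fˣ,
    extend (fun u => MilnorK.symbol fun i : Fin n => (u i)⁻¹) (diffProd a q * .single v 1) =
      MilnorK.symbol fun i : Fin n => if (i : ℕ) < q then a i else (v i)⁻¹
  | 0, _, v => by simp [diffProd, extend_single]
  | q + 1, hq, v => by
    have ih := extend_symbol_diffProd a q (by omega)
    rw [diffProd_succ, mul_comm _ (diffProd a q), mul_assoc, sub_mul, one_mul,
      MonoidAlgebra.single_mul_single, mul_one, mul_sub, map_sub, ih, ih, sub_eq_iff_eq_add]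
    set b : Fin n → Fˣ := fun i => if (i : ℕ) < q then a i else (v i)⁻¹ with hb
    have e : ∀ (c : Fin n → Fˣ) (x : Fˣ), (∀ i : Fin n, (i : ℕ) ≠ q → c i = b i) → c ⟨q, hq⟩ = x →
        c = Function.update b ⟨q, hq⟩ x := by
      intro c x h1 h2
      funext i
      by_cases hi : i = ⟨q, hq⟩
      · subst hi; simpa using h2
      · rw [Function.update_of_ne hi]
        exact h1 i fun h => hi (Fin.ext h)
    rw [e (fun i : Fin n => if (i : ℕ) < q then a i else _) (a q * (v q)⁻¹),
      e (fun i : Fin n => if (i : ℕ) < q + 1 then a i else _) (a q), MilnorK.symbol_update_mul]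
    · congr 2
      refine (e b _ (fun _ _ => rfl) ?_).symm
      simp [hb]
    · intro i hi
      simp only [hb, show (i : ℕ) < q + 1 ↔ (i : ℕ) < q by omega]
    · simp
    · intro i hi
      rw [mulSingle_inv_mul_apply_of_ne a v hi]
    · simp [mul_comm]

/-- Suslin's map on the class of the matrices `diag(1, …, 1, aₖ, 1, …, 1)`. The lifts are
`± ∏_{k < q} (t_k⁻¹ - 1) (e₀, …, e_q)` for `q < n`, and in the last step the vector `∑ eᵢ` takes the
place of `e_q`. -/
theorem suslinMap_diag [Infinite F] (a : ℕ → Fˣ) :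
    suslinMap F n (barClass (fun k : Fin n => diagGL F n fun i =>
      (Pi.mulSingle (k : ℕ) (a k) : ℕ → Fˣ) i)
      fun _ _ => (Commute.all _ _).map (diagGL F n)) = MilnorK.symbol fun i : Fin n => a i := by
  set g : ℕ → GL (Fin n) F := fun k => diagGL F n fun i =>
    (Pi.mulSingle k (a k) : ℕ → Fˣ) i with hg
  -- the exponent of the sign of the `q`-th lift
  set c : ℕ → ℕ := fun q => ∑ j ∈ Finset.range (q + 1), j with hc
  have hinv : ∀ k, (g k)⁻¹ = diagGL F n fun i =>
      (Pi.mulSingle k (a k) : ℕ → Fˣ)⁻¹ i := fun k => by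
    rw [hg, ← map_inv]; rfl
  have hrho : ∀ q k, q < n → ∀ x, rho F n (q + 1) (g k)⁻¹ (extend (frame n (q + 1)) x) =
      extend (fun t => frame n (q + 1) ((Pi.mulSingle k (a k))⁻¹ * t)) x := by
    intro q k hq x
    rw [hinv, map_extend]
    simp only [rho_frame (show q + 1 ≤ n by omega)]
  have hc2 : ∀ q, (-1 : ℤ) ^ c (q + 1) * (-1) ^ (q + 1) = (-1) ^ c q := by
    intro q
    simp only [hc]
    rw [Finset.sum_range_succ _ (q + 1), pow_add, mul_assoc, ← pow_add, Even.neg_one_pow ⟨_, rfl⟩,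
      mul_one]
  have main := suslinMap_barClass g (fun _ _ => (Commute.all _ _).map (diagGL F n))
    (fun q => (-1 : ℤ) ^ c q • extend (frame n (q + 1)) (diffProd a q)) ?_ ?_ ?_
  · refine main.trans ?_
    have h := extend_symbol_diffProd (n := n) a n le_rfl 1
    rw [← MonoidAlgebra.one_def, mul_one] at h
    rw [map_zsmul, map_extend]
    simp only [symb_frame]
    rw [h, smul_smul]
    simp only [hc, Finset.sum_range_id, Nat.add_sub_cancel]
    rw [mul_comm (n + 1), ← pow_add, Even.neg_one_pow ⟨_, rfl⟩, one_smul]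
    congr 1
    funext i
    simp
  · rw [map_zsmul, bd_extend_frame a (Nat.zero_le n)]
    simp only [hc, diffProd, Finset.range_zero, Finset.prod_empty, MonoidAlgebra.one_def,
      extend_single, frame_eq (Nat.zero_le (n + 1))]
    simp only [Nat.zero_add, Finset.sum_range_one, pow_zero, one_smul]
    exact congrArg (Finsupp.single · 1) (Subtype.ext (Subsingleton.elim _ _))
  · intro q k hqk hk
    rw [map_zsmul, hrho q k (by omega)]
    congr 2
    refine congrArg _ (funext fun t => frame_congr fun j hj => ?_)
    exact mulSingle_inv_mul_apply_of_ne a t (by omega)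
  · intro q hq
    rw [map_zsmul, map_zsmul, hrho q q hq, bd_extend_frame a (show q + 1 ≤ n by omega), smul_smul,
      hc2, diffProd_succ, extend_sub_one_mul]
    exact smul_sub _ _ _

/-- Suslin's map vanishes on the class of diagonal matrices all of which fix the same basis
vector. -/
theorem suslinMap_torusClass_eq_zero [Infinite F] (t : Fin n → Additive (Fin n → Fˣ)) (k : Fin n)
    (h : ∀ i, (t i).toMul k = 1) : suslinMap F n (torusClass F n t) = 0 := by
  set s : ℕ → Fin n → Fˣ := fun j => if h : j < n then (t ⟨j, h⟩).toMul else 1 with hs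
  have hsk : ∀ j, s j k = 1 := by
    intro j
    simp only [hs]
    split_ifs
    · exact h _
    · rfl
  have hgp : InGeneralPosition fun _ : Fin 1 => (Pi.single k 1 : Fin n → F) := by
    intro s _
    exact (linearIndepOn_univ_iff.2 (linearIndependent_unique_iff.2 (by simp))).mono
      (Set.subset_univ _)
  have hact : ∀ j, act (diagGL F n (s j))⁻¹ (⟨_, hgp⟩ : GenTuple F n 1) = ⟨_, hgp⟩ := by
    intro j
    rw [← map_inv]
    refine Subtype.ext (funext fun _ => ?_)
    change (diagGL F n (s j)⁻¹).1.mulVec (Pi.single k 1) = Pi.single k 1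
    rw [val_diagGL, Matrix.diagonal_mulVec_single, Pi.inv_apply, hsk]
    simp
  -- the first lift is the sequence `(e_k)`, which all the matrices fix, so that the next ones vanish
  have main := suslinMap_barClass (fun j => diagGL F n (s j))
    (fun _ _ => (Commute.all _ _).map (diagGL F n))
    (fun q => Nat.casesOn (motive := fun q => GenChain F n (q + 1)) q
      (Finsupp.single ⟨_, hgp⟩ 1) fun _ => 0) ?_ ?_ ?_
  · have hst : ∀ j : Fin n, s j = (t j).toMul := fun j => by simp [hs]
    obtain ⟨m, rfl⟩ : ∃ m, n = m + 1 := ⟨n - 1, by have := k.2; omega⟩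
    simp only [hst] at main
    refine main.trans ?_
    rw [map_zero, smul_zero]
  · refine (bd_single _).trans ?_
    rw [Fin.sum_univ_one, Fin.val_zero, pow_zero, one_smul]
    congr 1
    exact Subtype.ext (Subsingleton.elim _ _)
  · rintro (_ | q) j _ _
    · exact (rho_single _ _ _).trans (congrArg (Finsupp.single · 1) (hact _))
    · exact map_zero _
  · rintro (_ | q) _
    · refine (map_zero _).trans (Eq.symm (sub_eq_zero.2 ?_))
      exact (rho_single _ _ _).trans (congrArg (Finsupp.single · 1) (hact _))
    · refine (map_zero _).trans (Eq.symm (sub_eq_zero.2 ?_))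
      exact map_zero _

end GenChain

/-! ### The composite of Suslin's map with the classes `[a₁, …, aₙ]` -/

section suslinMap_bracket

variable {F : Type u} [Field F] {n : ℕ}

theorem suslinMap_torusClass_mulSingle [Infinite F] (a : Fin n → Fˣ) :
    suslinMap F n (torusClass F n fun k => .ofMul (Pi.mulSingle k (a k))) = MilnorK.symbol a := by
  set b : ℕ → Fˣ := fun j => if h : j < n then a ⟨j, h⟩ else 1 with hb
  have hba : ∀ i : Fin n, b i = a i := fun i => by simp [hb]
  have e : ∀ k : Fin n, (fun i : Fin n => (Pi.mulSingle (k : ℕ) (b k) : ℕ → Fˣ) i) =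
      Pi.mulSingle k (a k) := by
    intro k
    funext i
    simp only [Pi.mulSingle_apply, hba, Fin.ext_iff]
  have h := GenChain.suslinMap_diag (n := n) b
  simp only [e] at h
  simp only [hba] at h
  exact h

/-- The matrices `A_{i,n}` can be replaced by their `i`-th diagonal entries, beginning with the
last one: the other entries in place `i` give a class of matrices which fix the `i`-th basis
vector. -/
theorem suslinMap_bracket [Infinite F] (a : Fin n → Fˣ) :
    suslinMap F n (bracket a) = MilnorK.symbol fun i => a i ^ bracketWeight i := by
  set v : ℕ → Fin n → Additive (Fin n → Fˣ) := fun r k =>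
    .ofMul (if (k : ℕ) < r then bracketHom k (a k) else Pi.mulSingle k (a k ^ bracketWeight k))
    with hv
  have step : ∀ r, r < n →
      suslinMap F n (torusClass F n (v (r + 1))) = suslinMap F n (torusClass F n (v r)) := by
    intro r hr
    set i : Fin n := ⟨r, hr⟩ with hi
    have e : v (r + 1) = Function.update (v r) i (.ofMul (low i (a i)) + v r i) := by
      funext k
      by_cases hk : k = i
      · subst hk
        rw [Function.update_self, ← ofMul_toMul (v r i), ← ofMul_mul]
        simp [hv, hi, bracketHom_apply]
      · have hk' : (k : ℕ) ≠ r := fun h => hk (Fin.ext h)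
        rw [Function.update_of_ne hk]
        simp only [hv, show (k : ℕ) < r + 1 ↔ (k : ℕ) < r by omega]
    rw [e, AlternatingMap.map_update_add, Function.update_eq_self, map_add,
      GenChain.suslinMap_torusClass_eq_zero _ i, zero_add]
    intro k
    by_cases hk : k = i
    · subst hk
      simp [low]
    · rw [Function.update_of_ne hk]
      simp only [hv, toMul_ofMul]
      split_ifs with h
      · have : ¬ i < k := not_lt_of_gt (show k < i from h)
        simp [bracketHom_apply, low, this, Pi.mulSingle_eq_of_ne (Ne.symm hk)]
      · exact Pi.mulSingle_eq_of_ne (Ne.symm hk) _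
  have all : ∀ r, r ≤ n →
      suslinMap F n (torusClass F n (v r)) = suslinMap F n (torusClass F n (v 0)) := by
    intro r
    induction r with
    | zero => intro _; rfl
    | succ r ih => intro hr; rw [step r hr, ih (by omega)]
  have hn : bracket a = torusClass F n (v n) := by
    rw [bracket_eq]
    change torusClass F n (fun k => .ofMul (bracketHom k (a k))) = _
    simp [hv]
  have h0 : v 0 = fun k => .ofMul (Pi.mulSingle k (a k ^ bracketWeight k)) := by
    simp [hv]
  rw [hn, all n le_rfl, h0, suslinMap_torusClass_mulSingle]

theorem prod_bracketWeight : ∀ n : ℕ, 1 ≤ n →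
    ∏ i : Fin n, bracketWeight i = (-1) ^ (n - 1) * ((n - 1).factorial : ℤ)
  | 1, _ => by simp [bracketWeight]
  | n + 2, _ => by
    rw [Fin.prod_univ_castSucc]
    simp only [Fin.val_castSucc, Fin.val_last]
    rw [prod_bracketWeight (n + 1) (by omega), bracketWeight, if_neg (by omega)]
    simp only [Nat.add_sub_cancel, show n + 2 - 1 = n + 1 by omega, Nat.factorial_succ, pow_succ]
    push_cast
    ring

theorem MilnorK.symbol_zpow (a : Fin n → Fˣ) (w : Fin n → ℤ) :
    symbol (fun i => a i ^ w i) = (∏ i, w i) • symbol a :=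
  symbolMap.map_smul_univ w fun i => Additive.ofMul (a i)

end suslinMap_bracket

theorem proposition3p3 (F : Type u) [Field F] [Infinite F] (n : ℕ) (hn : 1 ≤ n) :
    (∃! ν : MilnorK F n →+ integralHomology (GL (Fin n) F) n,
      ∀ a : Fin n → Fˣ, ν (MilnorK.symbol a) = bracket a) ∧
    ∀ ν : MilnorK F n →+ integralHomology (GL (Fin n) F) n,
      (∀ a : Fin n → Fˣ, ν (MilnorK.symbol a) = bracket a) →
      ∀ x : MilnorK F n,
        suslinMap F n (ν x) = ((-1 : ℤ) ^ (n - 1) * (Nat.factorial (n - 1) : ℤ)) • x := by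
  refine ⟨⟨(MilnorK.toHomology F n).toAddMonoidHom, MilnorK.toHomology_symbol, fun ν hν =>
    MilnorK.addHom_ext fun a => (hν a).trans (MilnorK.toHomology_symbol a).symm⟩, ?_⟩
  intro ν hν x
  have h : (suslinMap F n).comp ν =
      DistribSMul.toAddMonoidHom _ ((-1 : ℤ) ^ (n - 1) * (Nat.factorial (n - 1) : ℤ)) := by
    refine MilnorK.addHom_ext fun a => ?_
    rw [AddMonoidHom.comp_apply, hν, suslinMap_bracket, MilnorK.symbol_zpow,
      prod_bracketWeight n hn]
    rfl
  exact DFunLike.congr_fun h x
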